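/- Let $\mathcal T$ be a nonzero $\mathbb C$-linear triangulated category equivalent to the perfect derived category $\mathrm{perf}(A)$ of a smooth proper dg $\mathbb C$-algebra $A$, and let $\mathcal S$ be its Serre functor (an exact $\mathbb C$-linear autoequivalence with natural isomorphisms $\mathrm{Hom}(X,Y)\cong\mathrm{Hom}(Y,\mathcal S X)^*$). Let $\Lambda$ be a finitely generated free abelian group, $v:K(\mathcal T)\to\Lambda$ a surjective homomorphism from the Grothendieck group, and fix a norm $\|\cdot\|$ on $\Lambda\otimes_{\mathbb Z}\mathbb R$. For objects $G,E$ and $t\in\mathbb R$ let $\delta_t(G,E)$ be the infimum of $\sum_{i=1}^p e^{n_it}$ over all towers of exact triangles $E_{i-1}\to E_i\to G[n_i]\to E_{i-1}[1]$ $(1\le i\le p)$ with $E_0=0$ and $E_p=E\oplus M$ for some object $M$. Put $h_t(\mathcal S)=\lim_{n\to\infty}\frac1n\log\delta_t(G,\mathcal S^nG)$ for a split-generator $G$ of $\mathcal T$ (the limit exists and does not depend on $G$). The upper Serre dimension is $\overline{\mathrm{Sdim}}\,\mathcal T=\lim_{t\to+\infty}h_t(\mathcal S)/t$. Let $\mathrm{Stab}_\Lambda(\mathcal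 T)$ be the set of Bridgeland stability conditions $\sigma=(Z_\sigma,\mathcal P_\sigma)$ on $\mathcal T$ with respect to $(\Lambda,v)$: a central charge $Z_\sigma:\Lambda\to\mathbb C$ and a slicing $\mathcal P_\sigma$, satisfying the support property for $\|\cdot\|$. For $I\subset\mathbb R$ let $\mathcal P_\sigma(I)$ be the extension-closed subcategory generated by the $\mathcal P_\sigma(\phi)$, $\phi\in I$, and put $\mathrm{gldim}\,\sigma=\sup\{\phi_2-\phi_1\mid \mathrm{Hom}(E_1,E_2)\ne0\text{ for some }E_i\in\mathcal P_\sigma(\phi_i)\}$. Let $s\in\mathbb R$. (1) Suppose that for every $\varepsilon\in(0,1)$ there is $\sigma_\varepsilon\in\mathrm{Stab}_\Lambda(\mathcal T)$ with $\mathcal S(\mathcal P_{\sigma_\varepsilon}(\phi))\subset\mathcal P_{\sigma_\varepsilon}([\phi+s-\varepsilon,\phi+s+\varepsilon])$ for all $\phi\in\mathbb R$. Then $$\overline{\mathrm{Sdim}}\,\mathcal T=\inf_{\sigma\in\mathrm{Stab}_\Lambda(\mathcal T)}\mathrm{gldim}\,\sigma=s.$$ (2) If $\sigma\in\mathrm{Stab}_\Lambda(\mathcal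 T)$ satisfies $\mathcal S(\mathcal P_\sigma(\phi))=\mathcal P_\sigma(\phi+s)$ for all $\phi\in\mathbb R$, then $$s=\overline{\mathrm{Sdim}}\,\mathcal T=\inf_{\sigma'\in\mathrm{Stab}_\Lambda(\mathcal T)}\mathrm{gldim}\,\sigma'=\mathrm{gldim}\,\sigma\ge0.$$ -/

import Mathlib

open CategoryTheory CategoryTheory.Limits CategoryTheory.Pretriangulated Filter Topology
open scoped TensorProduct

universe w v u

noncomputable section

/-! ### Differential graded algebras, dg modules, and the perfect derived category -/

/-- A dg `ℂ`-algebra: a `ℤ`-graded unital associative `ℂ`-algebra with a differential of degree `1`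
satisfying the graded Leibniz rule. -/
structure DGAlgebra where
  carrier : Type w
  [ring : Ring carrier]
  [algebra : Algebra ℂ carrier]
  deg : ℤ → Submodule ℂ carrier
  isInternal : DirectSum.IsInternal deg
  one_mem : (1 : carrier) ∈ deg 0
  mul_mem : ∀ {i j : ℤ} {a b : carrier}, a ∈ deg i → b ∈ deg j → a * b ∈ deg (i + j)
  d : carrier →ₗ[ℂ] carrier
  d_mem : ∀ {i : ℤ} {a : carrier}, a ∈ deg i → d a ∈ deg (i + 1)
  d_d : ∀ a, d (d a) = 0
  leibniz : ∀ {i : ℤ} {a : carrier} (b : carrier), a ∈ deg i →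
    d (a * b) = d a * b + i.negOnePow • (a * d b)

attribute [instance] DGAlgebra.ring DGAlgebra.algebra

/-- A right dg module over a dg algebra `A`; `act m a` is the product `m a`. -/
structure DGModule (A : DGAlgebra.{w}) where
  carrier : Type w
  [addCommGroup : AddCommGroup carrier]
  [module : Module ℂ carrier]
  deg : ℤ → Submodule ℂ carrier
  isInternal : DirectSum.IsInternal deg
  act : carrier →ₗ[ℂ] A.carrier →ₗ[ℂ] carrier
  act_one : ∀ m, act m 1 = m
  act_mul : ∀ m a b, act m (a * b) = act (act m a) b
  act_mem : ∀ {i j : ℤ} {m : carrier} {a : A.carrier}, m ∈ deg i → a ∈ A.deg j →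
    act m a ∈ deg (i + j)
  d : carrier →ₗ[ℂ] carrier
  d_mem : ∀ {i : ℤ} {m : carrier}, m ∈ deg i → d m ∈ deg (i + 1)
  d_d : ∀ m, d (d m) = 0
  leibniz : ∀ {i : ℤ} {m : carrier} (a : A.carrier), m ∈ deg i →
    d (act m a) = act (d m) a + i.negOnePow • act m (A.d a)

attribute [instance] DGModule.addCommGroup DGModule.module

/-- A dg `A`-`A`-bimodule (that is, a dg module over `Aᵒᵖ ⊗ A`): a right dg module with a commuting
left action `lact a m = a m`. -/
structure DGBimodule (A : DGAlgebra.{w}) extends DGModule A where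
  lact : A.carrier →ₗ[ℂ] carrier →ₗ[ℂ] carrier
  one_lact : ∀ m, lact 1 m = m
  mul_lact : ∀ a b m, lact (a * b) m = lact a (lact b m)
  lact_mem : ∀ {i j : ℤ} {a : A.carrier} {m : carrier}, a ∈ A.deg i → m ∈ deg j →
    lact a m ∈ deg (i + j)
  lact_act : ∀ a m b, lact a (act m b) = act (lact a m) b
  lact_leibniz : ∀ {i : ℤ} {a : A.carrier} (m : carrier), a ∈ A.deg i →
    d (lact a m) = lact (A.d a) m + i.negOnePow • lact a (d m)

namespace DGModule

variable {A : DGAlgebra.{w}}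

/-- The (not necessarily closed) `A`-linear maps of degree `n` between two right dg modules. -/
def homDeg (M N : DGModule A) (n : ℤ) : Submodule ℂ (M.carrier →ₗ[ℂ] N.carrier) where
  carrier := {f | (∀ m a, f (M.act m a) = N.act (f m) a) ∧
    ∀ i, ∀ m ∈ M.deg i, f m ∈ N.deg (i + n)}
  add_mem' := by
    rintro f g ⟨hf, hf'⟩ ⟨hg, hg'⟩
    exact ⟨fun m a => by simp [hf, hg], fun i m hm => add_mem (hf' i m hm) (hg' i m hm)⟩
  zero_mem' := ⟨fun m a => by simp, fun i m _ => by simp⟩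
  smul_mem' := by
    rintro c f ⟨hf, hf'⟩
    exact ⟨fun m a => by simp [hf], fun i m hm => Submodule.smul_mem _ c (hf' i m hm)⟩

/-- The morphisms of dg modules: `A`-linear maps of degree `0` commuting with the differentials. -/
def homs (M N : DGModule A) : Submodule ℂ (M.carrier →ₗ[ℂ] N.carrier) where
  carrier := {f | f ∈ homDeg M N 0 ∧ ∀ m, N.d (f m) = f (M.d m)}
  add_mem' := by
    rintro f g ⟨hf, hf'⟩ ⟨hg, hg'⟩
    exact ⟨add_mem hf hg, fun m => by simp [hf', hg']⟩
  zero_mem' := ⟨zero_mem _, fun m => by simp⟩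
  smul_mem' := by
    rintro c f ⟨hf, hf'⟩
    exact ⟨Submodule.smul_mem _ c hf, fun m => by simp [hf']⟩

lemma comp_mem_homDeg {M N P : DGModule A} {f : M.carrier →ₗ[ℂ] N.carrier}
    {g : N.carrier →ₗ[ℂ] P.carrier} {n k l : ℤ} (h : n + k = l)
    (hf : f ∈ homDeg M N n) (hg : g ∈ homDeg N P k) : g ∘ₗ f ∈ homDeg M P l := by
  subst h
  refine ⟨fun m a => by simp [hf.1, hg.1], fun i m hm => ?_⟩
  have := hg.2 _ _ (hf.2 i m hm)
  rwa [add_assoc] at this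

lemma id_mem_homDeg (M : DGModule A) : LinearMap.id ∈ homDeg M M 0 :=
  ⟨fun _ _ => rfl, fun i m hm => by simpa using hm⟩

/-- The category of right dg modules and closed morphisms of degree `0`. -/
instance : Category (DGModule A) where
  Hom M N := homs M N
  id M := ⟨LinearMap.id, id_mem_homDeg M, fun _ => rfl⟩
  comp f g := ⟨g.1 ∘ₗ f.1, comp_mem_homDeg (by simp) f.2.1 g.2.1, fun m => by
    simp [g.2.2, f.2.2]⟩

/-- The linear map underlying a morphism of dg modules. -/
def lin {M N : DGModule A} (f : M ⟶ N) : M.carrier →ₗ[ℂ] N.carrier := f.1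

instance : Preadditive (DGModule A) where
  homGroup M N := inferInstanceAs (AddCommGroup (homs M N))
  add_comp _ _ _ f f' g := Subtype.ext (LinearMap.comp_add f.1 f'.1 g.1)
  comp_add _ _ _ f g g' := Subtype.ext (LinearMap.add_comp f.1 g'.1 g.1)

instance : Linear ℂ (DGModule A) where
  homModule M N := inferInstanceAs (Module ℂ (homs M N))
  smul_comp _ _ _ r f g := Subtype.ext (LinearMap.comp_smul g.1 r f.1)
  comp_smul _ _ _ f r g := Subtype.ext (LinearMap.smul_comp r g.1 f.1)

/-- Two morphisms are homotopic if their difference is `d h + h d` with `h` an `A`-linear map of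
degree `-1`. -/
def homotopic : HomRel (DGModule A) := fun M N f g =>
  ∃ h ∈ homDeg M N (-1), ∀ m, lin f m - lin g m = N.d (h m) + h (M.d m)

lemma homotopic_add {M N : DGModule A} (f₁ f₂ g₁ g₂ : M ⟶ N) (hf : homotopic f₁ f₂)
    (hg : homotopic g₁ g₂) : homotopic (f₁ + g₁) (f₂ + g₂) := by
  obtain ⟨h, hh, e⟩ := hf
  obtain ⟨k, hk, e'⟩ := hg
  refine ⟨h + k, add_mem hh hk, fun m => ?_⟩
  have e1 : lin (f₁ + g₁) m = lin f₁ m + lin g₁ m := rfl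
  have e2 : lin (f₂ + g₂) m = lin f₂ m + lin g₂ m := rfl
  rw [e1, e2, add_sub_add_comm, e, e']
  simp only [LinearMap.add_apply, map_add]
  abel

lemma homotopic_smul (c : ℂ) {M N : DGModule A} (f₁ f₂ : M ⟶ N) (hf : homotopic f₁ f₂) :
    homotopic (c • f₁) (c • f₂) := by
  obtain ⟨h, hh, e⟩ := hf
  refine ⟨c • h, Submodule.smul_mem _ c hh, fun m => ?_⟩
  have e1 : lin (c • f₁) m = c • lin f₁ m := rfl
  have e2 : lin (c • f₂) m = c • lin f₂ m := rfl
  rw [e1, e2, ← smul_sub, e]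
  simp

instance : Congruence (homotopic (A := A)) where
  equivalence := by
    refine ⟨fun f => ⟨0, zero_mem _, fun m => by simp⟩, ?_, ?_⟩
    · rintro f g ⟨h, hh, e⟩
      refine ⟨-h, neg_mem hh, fun m => ?_⟩
      rw [← neg_sub, e]
      simp only [LinearMap.neg_apply, map_neg]
      abel
    · rintro f g k ⟨h, hh, e⟩ ⟨h', hh', e'⟩
      refine ⟨h + h', add_mem hh hh', fun m => ?_⟩
      rw [← sub_add_sub_cancel, e, e']
      simp only [LinearMap.add_apply, map_add]
      abel
  comp_left := by
    rintro M N P f g g' ⟨h, hh, e⟩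
    refine ⟨h ∘ₗ f.1, comp_mem_homDeg (by simp) f.2.1 hh, fun m => ?_⟩
    refine (e (f.1 m)).trans ?_
    simp [f.2.2]
  comp_right := by
    rintro M N P f f' g ⟨h, hh, e⟩
    refine ⟨g.1 ∘ₗ h, comp_mem_homDeg (by simp) hh g.2.1, fun m => ?_⟩
    have e1 : lin (f ≫ g) m - lin (f' ≫ g) m = g.1 (lin f m - lin f' m) := by
      rw [map_sub]; rfl
    rw [e1, e, map_add, LinearMap.comp_apply, LinearMap.comp_apply, g.2.2]

/-- The shift `M[1]`: `M[1]ⁱ = Mⁱ⁺¹`, with differential `-d` and the same right action. -/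
def shift (M : DGModule A) : DGModule A where
  carrier := M.carrier
  deg i := M.deg (i + 1)
  isInternal := by
    have h := (DirectSum.isInternal_submodule_iff_iSupIndep_and_iSup_eq_top _).1 M.isInternal
    refine (DirectSum.isInternal_submodule_iff_iSupIndep_and_iSup_eq_top _).2 ⟨?_, ?_⟩
    · exact h.1.comp (add_left_injective (1 : ℤ))
    · rw [← h.2]
      exact (Equiv.addRight (1 : ℤ)).iSup_comp (g := M.deg)
  act := M.act
  act_one := M.act_one
  act_mul := M.act_mul
  act_mem {i j m a} hm ha := by
    have := M.act_mem hm ha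
    rwa [add_right_comm] at this
  d := -M.d
  d_mem hm := neg_mem (M.d_mem hm)
  d_d m := by simp [M.d_d]
  leibniz {i m} a hm := by
    have := M.leibniz a hm
    simp only [LinearMap.neg_apply, this, map_neg, Int.negOnePow_succ, Units.neg_smul]
    abel

/-- The shift on morphisms (the same underlying linear map). -/
def shiftMap {M N : DGModule A} (f : M ⟶ N) : M.shift ⟶ N.shift :=
  ⟨f.1, ⟨f.2.1.1, fun i m hm => by
    have := f.2.1.2 _ m hm
    rwa [add_right_comm] at this⟩, fun m => by
      have h1 := congrArg Neg.neg (f.2.2 m)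
      rw [← map_neg f.1] at h1
      exact h1⟩

/-- A finitely generated semi-free dg module: free as a graded module on a finite homogeneous
basis `e₁, …, eₚ`, with `d eᵢ` in the submodule generated by the `eⱼ`, `j < i`. -/
def IsFGSemifree (F : DGModule A) : Prop :=
  ∃ (p : ℕ) (n : Fin p → ℤ) (e : Fin p → F.carrier),
    (∀ i, e i ∈ F.deg (n i)) ∧
    (Function.Bijective fun c : Fin p → A.carrier => ∑ i, F.act (e i) (c i)) ∧
    ∀ i, ∃ c : Fin p → A.carrier, (∀ j, i ≤ j → c j = 0) ∧ F.d (e i) = ∑ j, F.act (e j) (c j)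

end DGModule

namespace DGBimodule

variable {A : DGAlgebra.{w}}

/-- `f` is a (not necessarily closed) map of bimodules of degree `n`; the left action is subject to
the Koszul sign rule. -/
def IsHomDeg (M N : DGBimodule A) (n : ℤ) (f : M.carrier →ₗ[ℂ] N.carrier) : Prop :=
  f ∈ DGModule.homDeg M.toDGModule N.toDGModule n ∧
    ∀ j, ∀ a ∈ A.deg j, ∀ m, f (M.lact a m) = (n * j).negOnePow • N.lact a (f m)

/-- `f` is a morphism of dg bimodules. -/
def IsHom (M N : DGBimodule A) (f : M.carrier →ₗ[ℂ] N.carrier) : Prop :=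
  IsHomDeg M N 0 f ∧ ∀ m, N.d (f m) = f (M.d m)

/-- `f` induces an isomorphism on cohomology. -/
def IsQuasiIso (M N : DGBimodule A) (f : M.carrier →ₗ[ℂ] N.carrier) : Prop :=
  (∀ m, M.d m = 0 → (∃ n, f m = N.d n) → ∃ m', m = M.d m') ∧
  ∀ n, N.d n = 0 → ∃ m n', M.d m = 0 ∧ n = f m + N.d n'

/-- `P` is a direct summand of `F` in the homotopy category of dg bimodules. -/
def IsHomotopyRetract (P F : DGBimodule A) : Prop :=
  ∃ (i : P.carrier →ₗ[ℂ] F.carrier) (r : F.carrier →ₗ[ℂ] P.carrier) (h : P.carrier →ₗ[ℂ] P.carrier),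
    IsHom P F i ∧ IsHom F P r ∧ IsHomDeg P P (-1) h ∧ ∀ m, r (i m) - m = P.d (h m) + h (P.d m)

/-- The linear map `A ⊗ A → F`, `a ⊗ b ↦ a e b`. -/
def orbit (F : DGBimodule A) (e : F.carrier) : A.carrier ⊗[ℂ] A.carrier →ₗ[ℂ] F.carrier :=
  TensorProduct.lift (F.act ∘ₗ F.lact.flip e)

/-- A finitely generated semi-free dg bimodule: a finite homogeneous basis `e₁, …, eₚ` such that
the free bimodule `⨁ᵢ A ⊗ A` maps isomorphically to `F` by `a ⊗ b ↦ a eᵢ b`, and `d eᵢ` lies in the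
subbimodule generated by the `eⱼ`, `j < i`. -/
def IsFGSemifree (F : DGBimodule A) : Prop :=
  ∃ (p : ℕ) (n : Fin p → ℤ) (e : Fin p → F.carrier),
    (∀ i, e i ∈ F.deg (n i)) ∧
    (Function.Bijective fun c : Fin p → A.carrier ⊗[ℂ] A.carrier => ∑ i, F.orbit (e i) (c i)) ∧
    ∀ i, ∃ c : Fin p → A.carrier ⊗[ℂ] A.carrier,
      (∀ j, i ≤ j → c j = 0) ∧ F.d (e i) = ∑ j, F.orbit (e j) (c j)

/-- A dg bimodule is perfect if in the derived category it is a direct summand of a finitely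
generated semi-free one, i.e. it is quasi-isomorphic to a homotopy direct summand `P` of such an
`F` (`P` is then h-projective, so that an isomorphism `P ≅ M` in the derived category is
represented by a quasi-isomorphism `P → M`). -/
def IsPerfect (M : DGBimodule A) : Prop :=
  ∃ P F : DGBimodule A, IsFGSemifree F ∧ IsHomotopyRetract P F ∧
    ∃ q : P.carrier →ₗ[ℂ] M.carrier, IsHom P M q ∧ IsQuasiIso P M q

end DGBimodule

namespace DGAlgebra

/-- The diagonal bimodule `A`. -/
def diagonal (A : DGAlgebra.{w}) : DGBimodule A where
  carrier := A.carrier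
  deg := A.deg
  isInternal := A.isInternal
  act := LinearMap.mul ℂ A.carrier
  act_one := by simp
  act_mul m a b := by simp [mul_assoc]
  act_mem hm ha := A.mul_mem hm ha
  d := A.d
  d_mem := A.d_mem
  d_d := A.d_d
  leibniz a hm := A.leibniz a hm
  lact := LinearMap.mul ℂ A.carrier
  one_lact := by simp
  mul_lact a b m := by simp [mul_assoc]
  lact_mem ha hm := A.mul_mem ha hm
  lact_act a m b := by simp [mul_assoc]
  lact_leibniz m ha := A.leibniz m ha

/-- `A` is smooth: it is perfect as a dg bimodule over itself. -/
def IsSmooth (A : DGAlgebra.{w}) : Prop := A.diagonal.IsPerfect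

/-- `A` is proper: its total cohomology `ker d / im d` is finite dimensional. -/
def IsProper (A : DGAlgebra.{w}) : Prop :=
  FiniteDimensional ℂ (LinearMap.ker A.d ⧸ (LinearMap.range A.d).comap (LinearMap.ker A.d).subtype)

/-- The homotopy category of right dg `A`-modules. -/
abbrev HomotopyCat (A : DGAlgebra.{w}) := CategoryTheory.Quotient (DGModule.homotopic (A := A))

namespace HomotopyCat

variable (A : DGAlgebra.{w})

/-- The functor from dg modules to the homotopy category. -/
abbrev Q : DGModule A ⥤ A.HomotopyCat := CategoryTheory.Quotient.functor _

instance : Preadditive A.HomotopyCat :=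
  CategoryTheory.Quotient.preadditive _ (fun _ _ => DGModule.homotopic_add)

instance : (Q A).Additive :=
  CategoryTheory.Quotient.functor_additive _ (fun _ _ => DGModule.homotopic_add)

instance : Linear ℂ A.HomotopyCat :=
  CategoryTheory.Quotient.linear ℂ _ (fun c _ _ => DGModule.homotopic_smul c)

/-- The shift functor on dg modules. -/
def shiftDG : DGModule A ⥤ DGModule A where
  obj M := M.shift
  map f := DGModule.shiftMap f

/-- The shift functor `[1]` on the homotopy category. -/
def shift : A.HomotopyCat ⥤ A.HomotopyCat :=
  CategoryTheory.Quotient.lift _ (shiftDG A ⋙ Q A) (by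
    rintro M N f g ⟨h, hh, e⟩
    refine CategoryTheory.Quotient.sound _ ⟨-h, ⟨fun m a => ?_, fun i m hm => ?_⟩, fun m => ?_⟩
    · exact (neg_mem hh : -h ∈ DGModule.homDeg M N (-1)).1 m a
    · have := (neg_mem hh : -h ∈ DGModule.homDeg M N (-1)).2 _ m hm
      rwa [add_right_comm] at this
    · refine (e m).trans ?_
      change _ = -N.d (-h m) + -h (-M.d m)
      simp)

variable {A}

/-- The distinguished triangles of the homotopy category: those isomorphic to the triangle
`M → N → L → M[1]` of a short exact sequence of dg modules which splits as a sequence of graded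
modules, by `s : L → N` and `r : N → M`, the connecting morphism being `r d s`. -/
def Distinguished {X Y Z : A.HomotopyCat} (f : X ⟶ Y) (g : Y ⟶ Z) (h : Z ⟶ (shift A).obj X) : Prop :=
  ∃ (M N L : DGModule A) (i : M ⟶ N) (p : N ⟶ L) (δ : L ⟶ M.shift),
    (∃ s ∈ DGModule.homDeg L N 0, ∃ r ∈ DGModule.homDeg N M 0,
      (∀ x, r (DGModule.lin i x) = x) ∧ (∀ x, DGModule.lin p (s x) = x) ∧
      (∀ x, DGModule.lin i (r x) + s (DGModule.lin p x) = x) ∧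
      ∀ x, DGModule.lin δ x = r (N.d (s x))) ∧
    ∃ (a : X ≅ (Q A).obj M) (b : Y ≅ (Q A).obj N) (c : Z ≅ (Q A).obj L),
      f ≫ b.hom = a.hom ≫ (Q A).map i ∧
      g ≫ c.hom = b.hom ≫ (Q A).map p ∧
      h ≫ (shift A).map a.hom = c.hom ≫ (Q A).map δ

/-- The objects of the perfect derived category `perf(A)`: the perfect dg modules, i.e. the direct
summands, in the homotopy category, of finitely generated semi-free dg modules. They form the thick
subcategory generated by `A`; as they are h-projective, this full subcategory of the homotopy
category is also the thick subcategory generated by `A` in the derived category. -/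
def perf : ObjectProperty A.HomotopyCat := fun X =>
  ∃ F : DGModule A, F.IsFGSemifree ∧ Nonempty (Retract X ((Q A).obj F))

end HomotopyCat

end DGAlgebra

section Triangulated

variable (T : Type u) [Category.{v} T] [Preadditive T] [Linear ℂ T] [HasZeroObject T]
  [HasShift T ℤ] [∀ n : ℤ, (shiftFunctor T n).Additive] [Pretriangulated T]

/-- A `ℂ`-linear equivalence of triangulated categories between `T` and `perf(A)`, given as a
functor to the homotopy category of dg `A`-modules. -/
structure PerfEquivalence (A : DGAlgebra.{w}) where
  functor : T ⥤ A.HomotopyCat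
  [full : functor.Full]
  [faithful : functor.Faithful]
  essImage : functor.essImage = DGAlgebra.HomotopyCat.perf
  [additive : functor.Additive]
  [linear : functor.Linear ℂ]
  commShift : shiftFunctor T (1 : ℤ) ⋙ functor ≅ functor ⋙ DGAlgebra.HomotopyCat.shift A
  distinguished_iff : ∀ {X Y Z : T} (f : X ⟶ Y) (g : Y ⟶ Z) (h : Z ⟶ X⟦(1 : ℤ)⟧),
    Triangle.mk f g h ∈ distTriang T ↔
      DGAlgebra.HomotopyCat.Distinguished (functor.map f) (functor.map g)
        (functor.map h ≫ commShift.hom.app X)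

variable {T}

/-- `S` is a Serre functor: there are isomorphisms `Hom(X, Y) ≅ Hom(Y, S X)^*`, natural in both
variables. -/
def IsSerreFunctor (S : T ⥤ T) : Prop :=
  ∃ η : ∀ X Y : T, (X ⟶ Y) ≃ₗ[ℂ] Module.Dual ℂ (Y ⟶ S.obj X),
    ∀ {X X' Y Y' : T} (f : X' ⟶ X) (x : X ⟶ Y) (g : Y ⟶ Y') (y : Y' ⟶ S.obj X'),
      η X' Y' (f ≫ x ≫ g) y = η X Y x (g ≫ y ≫ S.map f)

/-- `IsTower l E`: there is a sequence of exact triangles `Eᵢ₋₁ → Eᵢ → Aᵢ → Eᵢ₋₁[1]`,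
`i = 1, …, p`, with `E₀ = 0`, `Eₚ = E`, whose factors, listed from the last one to the first one, are
`l = [Aₚ, …, A₁]`. -/
inductive IsTower : List T → T → Prop
  | nil {E : T} (h : IsZero E) : IsTower [] E
  | cons {l : List T} {E' E A : T} (f : E' ⟶ E) (g : E ⟶ A) (h : A ⟶ E'⟦(1 : ℤ)⟧)
      (ht : Triangle.mk f g h ∈ distTriang T) (hl : IsTower l E') : IsTower (A :: l) E

/-! ### Entropy and the upper Serre dimension -/

/-- `G` is a split-generator: the smallest thick triangulated subcategory containing it is `T`. -/
def IsSplitGenerator (G : T) : Prop :=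
  (ObjectProperty.singleton G).IsClassicalTriangulatedGenerator

/-- The complexity `δ_t(G, E)`: the infimum of `∑ᵢ exp(nᵢ t)` over all towers of `E ⊕ M` with factors
`G[n₁], …, G[nₚ]`. -/
def complexity (t : ℝ) (G E : T) : ENNReal :=
  sInf {x | ∃ (l : List ℤ) (M : T), IsTower (l.map fun n => G⟦n⟧) (E ⊞ M) ∧
    x = ENNReal.ofReal (l.map fun n : ℤ => Real.exp (n * t)).sum}

/-- `h` is the entropy `t ↦ h_t(F)` of the endofunctor `F`: for every split-generator `G`, the limit
of `(1/n) log δ_t(G, Fⁿ G)` exists and is equal to `h t`. -/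
def HasEntropy (F : T ⥤ T) (h : ℝ → EReal) : Prop :=
  (∃ G : T, IsSplitGenerator G) ∧ ∀ G : T, IsSplitGenerator G → ∀ t : ℝ,
    Tendsto (fun n : ℕ => (complexity t G (F.obj^[n] G)).log / (n : EReal)) atTop (𝓝 (h t))

/-- The entropy of the Serre functor `S` of `T` exists, and so does the upper Serre dimension
`lim_{t → +∞} h_t(S) / t`, which is equal to `s`. -/
def HasUpperSerreDimension (S : T ⥤ T) (s : EReal) : Prop :=
  ∃ h : ℝ → EReal, HasEntropy S h ∧ Tendsto (fun t : ℝ => h t / (t : EReal)) atTop (𝓝 s)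

/-! ### Bridgeland stability conditions -/

variable (T) in
/-- The Grothendieck group of a triangulated category. -/
abbrev K₀ : Type u :=
  FreeAbelianGroup T ⧸ AddSubgroup.closure
    {x : FreeAbelianGroup T | ∃ t ∈ distTriang T, x = FreeAbelianGroup.of t.obj₂ -
      FreeAbelianGroup.of t.obj₁ - FreeAbelianGroup.of t.obj₃}

/-- The class of an object in the Grothendieck group. -/
def K₀.of (E : T) : K₀ T := QuotientAddGroup.mk (FreeAbelianGroup.of E)

/-- A stability condition on `T` with respect to `v : K₀ T → Λ`; the support property is expressed
with the norm `nrm` on `Λ ⊗ ℝ`. -/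
structure StabilityCondition {Λ : Type*} [AddCommGroup Λ] (v : K₀ T →+ Λ)
    (nrm : Seminorm ℝ (ℝ ⊗[ℤ] Λ)) where
  /-- the central charge -/
  Z : Λ →+ ℂ
  /-- the slicing: full additive subcategories `P φ` -/
  P : ℝ → ObjectProperty T
  iso_closed : ∀ φ, (P φ).IsClosedUnderIsomorphisms
  zero_mem : ∀ φ, ∀ E : T, IsZero E → P φ E
  biprod_mem : ∀ φ, ∀ E F : T, P φ E → P φ F → P φ (E ⊞ F)
  Z_eq : ∀ φ, ∀ E : T, P φ E → ¬ IsZero E →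
    ∃ m : ℝ, 0 < m ∧ Z (v (K₀.of E)) = m * Complex.exp (Complex.I * Real.pi * φ)
  shift : ∀ φ, P (φ + 1) = (P φ).map (shiftFunctor T (1 : ℤ))
  hom_zero : ∀ φ₁ φ₂, φ₂ < φ₁ → ∀ E₁ E₂ : T, P φ₁ E₁ → P φ₂ E₂ → ∀ f : E₁ ⟶ E₂, f = 0
  /-- Harder-Narasimhan filtrations: towers with factors `A₁ ∈ P φ₁, …, Aₚ ∈ P φₚ`,
  `φ₁ > ⋯ > φₚ` (towers list the factors from the last one to the first one). -/
  hn : ∀ E : T, ¬ IsZero E → ∃ l : List (ℝ × T), (l.map Prod.fst).Pairwise (· < ·) ∧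
    (∀ x ∈ l, P x.1 x.2) ∧ IsTower (l.map Prod.snd) E
  support : ∃ C : ℝ, 0 < C ∧ ∀ φ, ∀ E : T, P φ E → ¬ IsZero E →
    nrm (1 ⊗ₜ[ℤ] v (K₀.of E)) < C * ‖Z (v (K₀.of E))‖

/-- The extension-closed full subcategory generated by `P`. -/
inductive ExtClosure (P : ObjectProperty T) : T → Prop
  | of {E : T} (h : P E) : ExtClosure P E
  | ext {E₁ E E₂ : T} (f : E₁ ⟶ E) (g : E ⟶ E₂) (h : E₂ ⟶ E₁⟦(1 : ℤ)⟧)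
      (ht : Triangle.mk f g h ∈ distTriang T) (h₁ : ExtClosure P E₁) (h₂ : ExtClosure P E₂) :
      ExtClosure P E

namespace StabilityCondition

variable {Λ : Type*} [AddCommGroup Λ] {v : K₀ T →+ Λ} {nrm : Seminorm ℝ (ℝ ⊗[ℤ] Λ)}

/-- `P(I)`, the extension-closed subcategory generated by the `P(φ)`, `φ ∈ I`. -/
def PI (σ : StabilityCondition v nrm) (I : Set ℝ) : ObjectProperty T :=
  ExtClosure fun E => ∃ φ ∈ I, σ.P φ E

/-- The global dimension of a stability condition. -/
def gldim (σ : StabilityCondition v nrm) : EReal :=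
  sSup {x | ∃ (φ₁ φ₂ : ℝ) (E₁ E₂ : T), σ.P φ₁ E₁ ∧ σ.P φ₂ E₂ ∧ (∃ f : E₁ ⟶ E₂, f ≠ 0) ∧
    x = ((φ₂ - φ₁ : ℝ) : EReal)}

end StabilityCondition

end Triangulated

end

/-! The argument rests on a ghost lemma. Let `G` be the object corresponding to `A`; a ghost is a
morphism killed by every morphism from a shift `G[j]`. Smoothness resolves the diagonal bimodule by
a homotopy retract of a semi-free bimodule `F` with `p` basis elements. A morphism from a semi-free
`E` to `X` induces a map `E ⊗_A F → X`, determined by its values on the basis. Composing with a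
ghost allows these values to be made zero on one more basis element, up to homotopy, since over a
field a ghost is null-homotopic as a map of complexes. After `p` ghosts nothing is left, and lifting
`E` along the resolution shows that the composite itself is null-homotopic
(`exists_ghostChain_null`, `exists_isGhostComp_eq_zero`).

This has two consequences. Every nonzero object receives a nonzero morphism from some `G[j]`; and if
such morphisms to `E` exist only for `a ≤ j ≤ b`, then `E` is built from shifts `G[n]` with `n ≤ b +
p(1 + K)`, where `K` bounds `|i - j|` whenever `Hom(G[i], G[j]) ≠ 0` (`HomBounded.exists_builds`).

If `S` shifts phases by `s` up to `ε`, the phases of `Sⁿ G` lie within `nε + O(1)` of `ns`.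
Comparing phases bounds `j` above when `Hom(G[j], Sⁿ G) ≠ 0`, and Serre duality followed by the same
comparison bounds it below. For `t ≥ 0` the logarithm of the complexity of `Sⁿ G` then lies between
`(n(s - ε) - c)t` and `L_n + (n(s + ε) + c)t`. The uncontrolled `L_n` is harmless: by Fekete's lemma
one fixed `n` bounds the entropy, and `L_n / t → 0`.

For global dimensions, duality turns a nonzero `E₁ → E₂` into `E₂ → S E₁`, so `gldim σ_ε ≤ s + ε`.
Conversely, for any stability condition of global dimension `g`, duality shows that `S` raises upper
phase bounds by at most `g`. Hence the same `j` satisfy `j ≤ ng + c'`; comparison with `j ≥ n(s - ε)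
- c` gives `s ≤ g`. -/

noncomputable section

/-! ### Graded pieces, parity, and homogeneous parts of linear maps -/

namespace DGModule

variable {A : DGAlgebra.{w}}

/-- The linear map which is `φ i` on the homogeneous elements of degree `i`. -/
def glue (M : DGModule A) {V : Type*} [AddCommGroup V] [Module ℂ V] (φ : ℤ → M.carrier →ₗ[ℂ] V) :
    M.carrier →ₗ[ℂ] V :=
  DirectSum.toModule ℂ ℤ V (fun i => φ i ∘ₗ (M.deg i).subtype) ∘ₗ
    (LinearEquiv.ofBijective (DirectSum.coeLinearMap M.deg) M.isInternal).symm.toLinearMap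

lemma glue_of_mem (M : DGModule A) {V : Type*} [AddCommGroup V] [Module ℂ V]
    (φ : ℤ → M.carrier →ₗ[ℂ] V) {i : ℤ} {m : M.carrier} (hm : m ∈ M.deg i) :
    M.glue φ m = φ i m := by
  have h : (LinearEquiv.ofBijective (DirectSum.coeLinearMap M.deg) M.isInternal).symm m =
      DirectSum.lof ℂ ℤ (fun i => M.deg i) i ⟨m, hm⟩ := by
    rw [LinearEquiv.symm_apply_eq]
    exact (DirectSum.coeLinearMap_lof M.deg i ⟨m, hm⟩).symm
  simp [glue, h]

@[elab_as_elim]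
lemma homogeneous_induction (M : DGModule A) {p : M.carrier → Prop}
    (h : ∀ i, ∀ m ∈ M.deg i, p m) (hadd : ∀ m m', p m → p m' → p (m + m')) (m : M.carrier) :
    p m := by
  have hm : m ∈ ⨆ i, M.deg i := by rw [M.isInternal.submodule_iSup_eq_top]; trivial
  exact Submodule.iSup_induction M.deg (motive := p) hm h (h 0 0 (zero_mem _)) hadd

/-- The projection to the component of degree `i`. -/
def proj (M : DGModule A) (i : ℤ) : M.carrier →ₗ[ℂ] M.carrier :=
  M.glue fun j => if j = i then LinearMap.id else 0

lemma proj_of_mem {M : DGModule A} {i : ℤ} {m : M.carrier} (hm : m ∈ M.deg i) :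
    M.proj i m = m := by
  simp [proj, M.glue_of_mem _ hm]

lemma proj_of_mem_ne {M : DGModule A} {i j : ℤ} (h : j ≠ i) {m : M.carrier} (hm : m ∈ M.deg j) :
    M.proj i m = 0 := by
  simp [proj, M.glue_of_mem _ hm, h]

lemma proj_mem (M : DGModule A) (i : ℤ) (m : M.carrier) : M.proj i m ∈ M.deg i := by
  induction m using M.homogeneous_induction with
  | h j m hm =>
    by_cases h : j = i
    · subst h; rwa [proj_of_mem hm]
    · rw [proj_of_mem_ne h hm]; exact zero_mem _
  | hadd m m' h h' => rw [map_add]; exact add_mem h h'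

lemma exists_sum_proj (M : DGModule A) (m : M.carrier) :
    ∃ s : Finset ℤ, m = ∑ i ∈ s, M.proj i m := by
  -- Allowing every larger index set makes the claim additive: for `m + m'` the union of the two
  -- sets works.
  suffices h : ∃ s : Finset ℤ, ∀ s', s ⊆ s' → m = ∑ i ∈ s', M.proj i m by
    obtain ⟨s, hs⟩ := h
    exact ⟨s, hs s subset_rfl⟩
  induction m using M.homogeneous_induction with
  | h j m hm =>
    refine ⟨{j}, fun s' hs' => ?_⟩
    rw [Finset.sum_eq_single j, proj_of_mem hm]
    · exact fun i _ hi => proj_of_mem_ne hi.symm hm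
    · exact fun h => absurd (hs' (Finset.mem_singleton_self j)) h
  | hadd m m' h h' =>
    obtain ⟨s, hs⟩ := h
    obtain ⟨s', hs'⟩ := h'
    refine ⟨s ∪ s', fun t ht => ?_⟩
    simp only [map_add, Finset.sum_add_distrib]
    rw [← hs t (Finset.union_subset_left ht), ← hs' t (Finset.union_subset_right ht)]

lemma proj_map {M N : DGModule A} {f : M.carrier →ₗ[ℂ] N.carrier} {k : ℤ}
    (hf : ∀ i, ∀ m ∈ M.deg i, f m ∈ N.deg (i + k)) (i : ℤ) (m : M.carrier) :
    N.proj (i + k) (f m) = f (M.proj i m) := by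
  induction m using M.homogeneous_induction with
  | h j m hm =>
    by_cases h : j = i
    · subst h; rw [proj_of_mem hm, proj_of_mem (hf _ _ hm)]
    · rw [proj_of_mem_ne h hm, proj_of_mem_ne _ (hf _ _ hm), map_zero]
      simpa using h
  | hadd m m' h h' => simp only [map_add, h, h']

/-- The parity involution `m ↦ (-1)^|m| m`. -/
def parity (M : DGModule A) : M.carrier →ₗ[ℂ] M.carrier :=
  M.glue fun i => i.negOnePow • LinearMap.id

lemma parity_of_mem {M : DGModule A} {i : ℤ} {m : M.carrier} (hm : m ∈ M.deg i) :
    M.parity m = i.negOnePow • m := by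
  simp [parity, M.glue_of_mem _ hm]

@[simp] lemma parity_parity (M : DGModule A) (m : M.carrier) : M.parity (M.parity m) = m := by
  induction m using M.homogeneous_induction with
  | h i m hm => rw [parity_of_mem hm, LinearMap.map_smul_of_tower, parity_of_mem hm, smul_smul]; simp
  | hadd m m' h h' => simp only [map_add, h, h']

lemma parity_d (M : DGModule A) (m : M.carrier) : M.parity (M.d m) = - M.d (M.parity m) := by
  induction m using M.homogeneous_induction with
  | h i m hm =>
    rw [parity_of_mem hm, parity_of_mem (M.d_mem hm), LinearMap.map_smul_of_tower,
      Int.negOnePow_succ, Units.neg_smul]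
  | hadd m m' h h' => simp only [map_add, h, h', neg_add]

end DGModule

namespace DGAlgebra

/-- The parity involution of a dg algebra. -/
def parity (A : DGAlgebra.{w}) : A.carrier →ₗ[ℂ] A.carrier := A.diagonal.toDGModule.parity

variable {A : DGAlgebra.{w}}

lemma parity_of_mem {i : ℤ} {a : A.carrier} (ha : a ∈ A.deg i) :
    A.parity a = i.negOnePow • a :=
  DGModule.parity_of_mem (M := A.diagonal.toDGModule) ha

@[elab_as_elim]
lemma homogeneous_induction {p : A.carrier → Prop}
    (h : ∀ i, ∀ m ∈ A.deg i, p m) (hadd : ∀ m m', p m → p m' → p (m + m')) (m : A.carrier) :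
    p m :=
  A.diagonal.toDGModule.homogeneous_induction h hadd m

lemma d_one : A.d 1 = 0 := by
  have h := A.leibniz (a := 1) 1 A.one_mem
  simpa using h

@[simp] lemma parity_one : A.parity 1 = 1 := by
  rw [parity_of_mem A.one_mem]; simp

end DGAlgebra

namespace DGModule

variable {A : DGAlgebra.{w}}

lemma parity_act (M : DGModule A) (m : M.carrier) (a : A.carrier) :
    M.parity (M.act m a) = M.act (M.parity m) (A.parity a) := by
  induction m using M.homogeneous_induction with
  | hadd m m' h h' => simp only [map_add, h, h', LinearMap.add_apply]
  | h i m hm =>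
    induction a using DGAlgebra.homogeneous_induction with
    | hadd a a' h h' => simp only [map_add, h, h']
    | h j a ha =>
      rw [parity_of_mem hm, DGAlgebra.parity_of_mem ha, parity_of_mem (M.act_mem hm ha),
        LinearMap.map_smul_of_tower, Int.negOnePow_add, mul_comm, mul_smul]
      congr 1
      exact ((M.act.flip a).map_smul_of_tower _ _).symm

/-- With `parity` in place of the sign, both sides of the Leibniz rule are bilinear, so it extends
to inhomogeneous elements and later computations need no degrees. -/
lemma d_act (M : DGModule A) (m : M.carrier) (a : A.carrier) :
    M.d (M.act m a) = M.act (M.d m) a + M.act (M.parity m) (A.d a) := by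
  induction m using M.homogeneous_induction with
  | hadd m m' h h' => simp only [map_add, h, h', LinearMap.add_apply]; abel
  | h i m hm =>
    rw [M.leibniz a hm, parity_of_mem hm]
    congr 1
    exact ((M.act.flip _).map_smul_of_tower _ _).symm

lemma parity_map {M N : DGModule A} {f : M.carrier →ₗ[ℂ] N.carrier} {k : ℤ}
    (hf : ∀ i, ∀ m ∈ M.deg i, f m ∈ N.deg (i + k)) (m : M.carrier) :
    N.parity (f m) = k.negOnePow • f (M.parity m) := by
  induction m using M.homogeneous_induction with
  | hadd m m' h h' => simp only [map_add, h, h', smul_add]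
  | h i m hm =>
    rw [parity_of_mem hm, parity_of_mem (hf _ _ hm), LinearMap.map_smul_of_tower,
      smul_smul, Int.negOnePow_add, mul_comm]

lemma parity_map_even {M N : DGModule A} {f : M.carrier →ₗ[ℂ] N.carrier}
    (hf : ∀ i, ∀ m ∈ M.deg i, f m ∈ N.deg (i + 0)) (m : M.carrier) :
    N.parity (f m) = f (M.parity m) := by
  simpa using parity_map hf m

lemma parity_map_odd {M N : DGModule A} {f : M.carrier →ₗ[ℂ] N.carrier}
    (hf : ∀ i, ∀ m ∈ M.deg i, f m ∈ N.deg (i + (-1))) (m : M.carrier) :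
    N.parity (f m) = -f (M.parity m) := by
  simpa using parity_map hf m

/-- The part of degree `-1` of a linear map. -/
def lowerPart {M N : DGModule A} (h : M.carrier →ₗ[ℂ] N.carrier) : M.carrier →ₗ[ℂ] N.carrier :=
  M.glue fun i => N.proj (i + -1) ∘ₗ h

lemma lowerPart_of_mem {M N : DGModule A} (h : M.carrier →ₗ[ℂ] N.carrier) {i : ℤ} {m : M.carrier}
    (hm : m ∈ M.deg i) : lowerPart h m = N.proj (i + -1) (h m) := by
  simp [lowerPart, M.glue_of_mem _ hm]

lemma lowerPart_mem {M N : DGModule A} (h : M.carrier →ₗ[ℂ] N.carrier) (i : ℤ) (m : M.carrier)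
    (hm : m ∈ M.deg i) : lowerPart h m ∈ N.deg (i + -1) := by
  rw [lowerPart_of_mem h hm]
  exact proj_mem _ _ _

/-- Since `f` has degree `0`, only the component of `h` of degree `-1` contributes to `dh + hd`.
Homotopies may thus be constructed without regard to the grading. -/
lemma eq_lowerPart {M N : DGModule A} {f h : M.carrier →ₗ[ℂ] N.carrier}
    (hf : ∀ i, ∀ m ∈ M.deg i, f m ∈ N.deg (i + 0))
    (e : ∀ m, f m = N.d (h m) + h (M.d m)) (m : M.carrier) :
    f m = N.d (lowerPart h m) + lowerPart h (M.d m) := by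
  induction m using M.homogeneous_induction with
  | hadd m m' h h' => simp only [map_add, h, h']; abel
  | h i m hm =>
    have hd : ∀ i, ∀ n ∈ N.deg i, N.d n ∈ N.deg (i + 1) := fun i n hn => N.d_mem hn
    rw [lowerPart_of_mem h hm, lowerPart_of_mem h (M.d_mem hm), ← proj_map hd,
      show i + -1 + 1 = i by ring, show i + 1 + -1 = i by ring, ← map_add, ← e, proj_of_mem]
    simpa using hf i m hm

lemma lowerPart_act {M N : DGModule A} {h : M.carrier →ₗ[ℂ] N.carrier}
    (hh : ∀ m a, h (M.act m a) = N.act (h m) a) (m : M.carrier) (a : A.carrier) :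
    lowerPart h (M.act m a) = N.act (lowerPart h m) a := by
  induction m using M.homogeneous_induction with
  | hadd m m' h h' => simp only [map_add, h, h', LinearMap.add_apply]
  | h i m hm =>
    induction a using DGAlgebra.homogeneous_induction with
    | hadd a a' h h' => simp only [map_add, h, h']
    | h j a ha =>
      rw [lowerPart_of_mem h hm, lowerPart_of_mem h (M.act_mem hm ha), hh,
        show i + j + -1 = (i + -1) + j by ring]
      exact proj_map (f := N.act.flip a) (fun k n hn => N.act_mem hn ha) _ _

lemma lin_mem {M N : DGModule A} (f : M ⟶ N) (i : ℤ) (m : M.carrier) (hm : m ∈ M.deg i) :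
    lin f m ∈ N.deg (i + 0) := f.2.1.2 i m hm

lemma lin_act {M N : DGModule A} (f : M ⟶ N) (m : M.carrier) (a : A.carrier) :
    lin f (M.act m a) = N.act (lin f m) a := f.2.1.1 m a

lemma d_lin {M N : DGModule A} (f : M ⟶ N) (m : M.carrier) :
    N.d (lin f m) = lin f (M.d m) := f.2.2 m

lemma parity_lin {M N : DGModule A} (f : M ⟶ N) (m : M.carrier) :
    N.parity (lin f m) = lin f (M.parity m) := parity_map_even (lin_mem f) m

/-- An `A`-linear null-homotopy of a dg morphism can be made homogeneous. -/
lemma homotopic_zero_of {M N : DGModule A} (f : M ⟶ N) (h : M.carrier →ₗ[ℂ] N.carrier)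
    (hh : ∀ m a, h (M.act m a) = N.act (h m) a)
    (e : ∀ m, lin f m = N.d (h m) + h (M.d m)) : homotopic f 0 := by
  refine ⟨lowerPart h, ⟨lowerPart_act hh, lowerPart_mem h⟩, fun m => ?_⟩
  rw [← eq_lowerPart (lin_mem f) e]
  exact sub_zero _

end DGModule

/-! ### Ghosts between complexes of vector spaces -/

lemma LinearMap.exists_quasi_inverse {V W : Type*} [AddCommGroup V] [Module ℂ V] [AddCommGroup W]
    [Module ℂ W] (d : V →ₗ[ℂ] W) : ∃ g : W →ₗ[ℂ] V, ∀ x, d (g (d x)) = d x := by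
  obtain ⟨s, hs⟩ := d.rangeRestrict.exists_rightInverse_of_surjective d.range_rangeRestrict
  obtain ⟨g, hg⟩ := LinearMap.exists_extend s
  refine ⟨g, fun x => ?_⟩
  have h1 := LinearMap.congr_fun hg (d.rangeRestrict x)
  have h2 := congrArg Subtype.val (LinearMap.congr_fun hs (d.rangeRestrict x))
  change g (d x) = _ at h1
  rw [h1]
  exact h2

namespace DGModule

variable {A : DGAlgebra.{w}}

/-- `f` induces the zero map on cohomology. -/
def IsGhost {M N : DGModule A} (f : M ⟶ N) : Prop :=
  ∀ i, ∀ m ∈ M.deg i, M.d m = 0 → ∃ n, lin f m = N.d n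

lemma IsGhost.exists_eq_d {M N : DGModule A} {f : M ⟶ N} (hf : IsGhost f) (m : M.carrier)
    (hm : M.d m = 0) : ∃ n, lin f m = N.d n := by
  have hd : ∀ i, ∀ n ∈ M.deg i, M.d n ∈ M.deg (i + 1) := fun i n hn => M.d_mem hn
  choose n hn using fun i => hf i (M.proj i m) (proj_mem _ _ _) (by
    rw [← proj_map hd, hm, map_zero])
  obtain ⟨s, hs⟩ := M.exists_sum_proj m
  refine ⟨∑ i ∈ s, n i, ?_⟩
  conv_lhs => rw [hs]
  simp only [map_sum, hn]

/-- Over a field, a ghost is null-homotopic as a morphism of complexes of vector spaces. -/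
lemma IsGhost.exists_contraction {M N : DGModule A} {f : M ⟶ N} (hf : IsGhost f) :
    ∃ h : M.carrier →ₗ[ℂ] N.carrier, (∀ i, ∀ m ∈ M.deg i, h m ∈ N.deg (i + -1)) ∧
      ∀ m, lin f m = N.d (h m) + h (M.d m) := by
  obtain ⟨g, hg⟩ := M.d.exists_quasi_inverse
  obtain ⟨g', hg'⟩ := N.d.exists_quasi_inverse
  have hz : ∀ m, M.d m = 0 → N.d (g' (lin f m)) = lin f m := fun m hm => by
    obtain ⟨n, hn⟩ := hf.exists_eq_d m hm
    rw [hn, hg']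
  -- The first candidate for the contraction is `g' ∘ f`, and `u` is its error. It vanishes on
  -- cycles, so `u = u ∘ g ∘ d`, and its values are cycles. Adding `u ∘ g` to the candidate
  -- therefore absorbs the error.
  set u : M.carrier →ₗ[ℂ] N.carrier :=
    lin f - N.d ∘ₗ g' ∘ₗ lin f - g' ∘ₗ lin f ∘ₗ M.d with hu
  have hu0 : ∀ m, M.d m = 0 → u m = 0 := fun m hm => by
    simp [hu, hm, hz m hm]
  have hdu : ∀ m, N.d (u m) = 0 := fun m => by
    simp [hu, N.d_d, hz _ (M.d_d m), d_lin]
  refine ⟨_, lowerPart_mem (g' ∘ₗ lin f + u ∘ₗ g), eq_lowerPart (lin_mem f) fun m => ?_⟩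
  have h1 : u (g (M.d m)) = u m := by
    rw [← sub_eq_zero, ← map_sub]
    exact hu0 _ (by rw [map_sub, hg, sub_self])
  simp only [LinearMap.add_apply, LinearMap.comp_apply, map_add, hdu, h1]
  simp [hu]

end DGModule

/-! ### Koszul signs on bimodules -/

namespace DGBimodule

variable {A : DGAlgebra.{w}}

lemma parity_lact (M : DGBimodule A) (a : A.carrier) (m : M.carrier) :
    M.parity (M.lact a m) = M.lact (A.parity a) (M.parity m) := by
  induction m using M.homogeneous_induction with
  | hadd m m' h h' => simp only [map_add, h, h']
  | h i m hm =>
    induction a using DGAlgebra.homogeneous_induction with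
    | hadd a a' h h' => simp only [map_add, h, h', LinearMap.add_apply]
    | h j a ha =>
      rw [DGModule.parity_of_mem hm, DGAlgebra.parity_of_mem ha,
        DGModule.parity_of_mem (M.lact_mem ha hm),
        LinearMap.map_smul_of_tower, Int.negOnePow_add, mul_comm, mul_smul]
      congr 1
      exact ((M.lact.flip m).map_smul_of_tower _ _).symm

lemma d_lact (M : DGBimodule A) (a : A.carrier) (m : M.carrier) :
    M.d (M.lact a m) = M.lact (A.d a) m + M.lact (A.parity a) (M.d m) := by
  induction a using DGAlgebra.homogeneous_induction with
  | hadd m m' h h' => simp only [map_add, h, h', LinearMap.add_apply]; abel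
  | h i a ha =>
    rw [M.lact_leibniz m ha, DGAlgebra.parity_of_mem ha]
    congr 1
    exact ((M.lact.flip _).map_smul_of_tower _ _).symm

lemma IsHomDeg.map_lact_even {M N : DGBimodule A} {f : M.carrier →ₗ[ℂ] N.carrier}
    (hf : IsHomDeg M N 0 f) (a : A.carrier) (m : M.carrier) :
    f (M.lact a m) = N.lact a (f m) := by
  induction a using DGAlgebra.homogeneous_induction with
  | hadd m m' h h' => simp only [map_add, h, h', LinearMap.add_apply]
  | h i a ha => simpa using hf.2 i a ha m

lemma IsHomDeg.map_lact_odd {M N : DGBimodule A} {f : M.carrier →ₗ[ℂ] N.carrier}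
    (hf : IsHomDeg M N (-1) f) (a : A.carrier) (m : M.carrier) :
    f (M.lact a m) = N.lact (A.parity a) (f m) := by
  induction a using DGAlgebra.homogeneous_induction with
  | hadd m m' h h' => simp only [map_add, h, h', LinearMap.add_apply]
  | h i a ha =>
    rw [hf.2 i a ha m, DGAlgebra.parity_of_mem ha]
    rw [neg_one_mul, Int.negOnePow_neg]
    exact ((N.lact.flip _).map_smul_of_tower _ _).symm

end DGBimodule

/-- The sign `(-1)^i` as a complex number. -/
def koszulSign (i : ℤ) : ℂ := ((i.negOnePow : ℤ) : ℂ)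

lemma koszulSign_mul_self (i : ℤ) : koszulSign i * koszulSign i = 1 := by
  rw [koszulSign, ← Int.cast_mul, ← Units.val_mul]
  simp

lemma koszulSign_smul_smul {V : Type*} [AddCommGroup V] [Module ℂ V] (i : ℤ) (x : V) :
    koszulSign i • koszulSign i • x = x := by
  rw [smul_smul, koszulSign_mul_self, one_smul]

lemma DGModule.parity_eq_smul {A : DGAlgebra.{w}} {M : DGModule A} {i : ℤ} {m : M.carrier}
    (hm : m ∈ M.deg i) : M.parity m = koszulSign i • m := by
  rw [parity_of_mem hm, koszulSign, Units.smul_def, Int.cast_smul_eq_zsmul]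

/-! ### Balanced pairings -/

section Pairing

variable {A : DGAlgebra.{w}} {E X Y : DGModule A} {F : DGBimodule A}

/-- A bilinear map which is `A`-balanced and right `A`-linear, i.e. a right `A`-linear map
`E ⊗_A F → X`. -/
structure IsBalanced (b : E.carrier →ₗ[ℂ] F.carrier →ₗ[ℂ] X.carrier) : Prop where
  bal : ∀ e a m, b (E.act e a) m = b e (F.lact a m)
  lin : ∀ e m a, b e (F.act m a) = X.act (b e m) a

/-- `b` represents a closed map of degree `0` from `E ⊗_A F` to `X`. -/
structure IsClosedPairing (b : E.carrier →ₗ[ℂ] F.carrier →ₗ[ℂ] X.carrier) : Prop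
    extends IsBalanced b where
  parity : ∀ e m, X.parity (b e m) = b (E.parity e) (F.parity m)
  closed : ∀ e m, X.d (b e m) = b (E.d e) m + b (E.parity e) (F.d m)

/-- The differential `dH + Hd` of a map `H` of odd degree. -/
def pairingBoundary (H : E.carrier →ₗ[ℂ] F.carrier →ₗ[ℂ] X.carrier) :
    E.carrier →ₗ[ℂ] F.carrier →ₗ[ℂ] X.carrier :=
  H.compr₂ X.d + H ∘ₗ E.d + (H ∘ₗ E.parity).compl₂ F.d

@[simp] lemma pairingBoundary_apply (H : E.carrier →ₗ[ℂ] F.carrier →ₗ[ℂ] X.carrier)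
    (e : E.carrier) (m : F.carrier) :
    pairingBoundary H e m = X.d (H e m) + H (E.d e) m + H (E.parity e) (F.d m) := rfl

/-- `b` is the boundary of a balanced map of odd degree. -/
def IsNullPairing (b : E.carrier →ₗ[ℂ] F.carrier →ₗ[ℂ] X.carrier) : Prop :=
  ∃ H, IsBalanced H ∧ pairingBoundary H = b

lemma IsNullPairing.add {b b' : E.carrier →ₗ[ℂ] F.carrier →ₗ[ℂ] X.carrier}
    (h : IsNullPairing b) (h' : IsNullPairing b') : IsNullPairing (b + b') := by
  obtain ⟨H, hH, rfl⟩ := h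
  obtain ⟨H', hH', rfl⟩ := h'
  refine ⟨H + H', ⟨fun e a m => by simp [hH.bal, hH'.bal], fun e m a => by
    simp [hH.lin, hH'.lin]⟩, ?_⟩
  ext e m
  simp only [pairingBoundary_apply, LinearMap.add_apply, map_add]
  abel

lemma IsNullPairing.comp {b : E.carrier →ₗ[ℂ] F.carrier →ₗ[ℂ] X.carrier}
    (h : IsNullPairing b) (f : X ⟶ Y) : IsNullPairing (b.compr₂ (DGModule.lin f)) := by
  obtain ⟨H, hH, rfl⟩ := h
  refine ⟨H.compr₂ (DGModule.lin f), ⟨fun e a m => by simp [hH.bal], fun e m a => by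
    simp [hH.lin, DGModule.lin_act]⟩, ?_⟩
  ext e m
  simp [DGModule.d_lin]

/-- For right linearity, the two terms containing `d a` cancel precisely because `H` is odd (`hp`).
-/
lemma IsBalanced.pairingBoundary {H : E.carrier →ₗ[ℂ] F.carrier →ₗ[ℂ] X.carrier}
    (hH : IsBalanced H) (hp : ∀ e m, X.parity (H e m) = - H (E.parity e) (F.parity m)) :
    IsBalanced (pairingBoundary H) where
  bal e a m := by
    simp only [pairingBoundary_apply, hH.bal, E.d_act, E.parity_act, F.d_lact, map_add,
      LinearMap.add_apply]
    abel
  lin e m a := by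
    simp only [pairingBoundary_apply, hH.lin, X.d_act, F.d_act, map_add, LinearMap.add_apply, hp,
      map_neg, LinearMap.neg_apply]
    abel

lemma IsClosedPairing.comp {b : E.carrier →ₗ[ℂ] F.carrier →ₗ[ℂ] X.carrier}
    (hb : IsClosedPairing b) (f : X ⟶ Y) : IsClosedPairing (b.compr₂ (DGModule.lin f)) where
  bal e a m := by simp [hb.bal]
  lin e m a := by simp [hb.lin, DGModule.lin_act]
  parity e m := by simp [DGModule.parity_lin, hb.parity]
  closed e m := by simp [DGModule.d_lin, hb.closed]

/-- A closed pairing may be changed within its homotopy class: boundaries of odd balanced maps are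
closed because the differentials square to zero. -/
lemma IsClosedPairing.sub_boundary {b H : E.carrier →ₗ[ℂ] F.carrier →ₗ[ℂ] X.carrier}
    (hb : IsClosedPairing b) (hH : IsBalanced H)
    (hp : ∀ e m, X.parity (H e m) = - H (E.parity e) (F.parity m)) :
    IsClosedPairing (b - pairingBoundary H) where
  bal e a m := by
    rw [LinearMap.sub_apply, LinearMap.sub_apply, LinearMap.sub_apply, LinearMap.sub_apply, hb.bal,
      (hH.pairingBoundary hp).bal]
  lin e m a := by
    rw [LinearMap.sub_apply, LinearMap.sub_apply, hb.lin,
      (hH.pairingBoundary hp).lin, LinearMap.sub_apply, LinearMap.map_sub₂]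
  parity e m := by
    simp only [LinearMap.sub_apply, pairingBoundary_apply, map_sub, map_add, hb.parity, hp,
      X.parity_d, E.parity_d, F.parity_d, map_neg, neg_neg, LinearMap.neg_apply]
  closed e m := by
    simp only [LinearMap.sub_apply, pairingBoundary_apply, map_sub, map_add, hb.closed, E.d_d,
      F.d_d, X.d_d, E.parity_d, map_neg, LinearMap.neg_apply, map_zero,
      LinearMap.zero_apply, DGModule.parity_parity]
    abel

end Pairing

/-! ### Pairings with a semi-free bimodule -/

namespace DGBimodule

variable {A : DGAlgebra.{w}} {F : DGBimodule A}

/-- The bimodule generated by `e` consists of the sums of `x e y`. -/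
@[simp] lemma orbit_tmul (e : F.carrier) (x y : A.carrier) :
    F.orbit e (x ⊗ₜ y) = F.act (F.lact x e) y := rfl

/-- The standard basis map of a free bimodule. -/
def basisMap {p : ℕ} (e : Fin p → F.carrier) :
    (Fin p → A.carrier ⊗[ℂ] A.carrier) →ₗ[ℂ] F.carrier :=
  ∑ i, F.orbit (e i) ∘ₗ LinearMap.proj i

lemma basisMap_apply {p : ℕ} (e : Fin p → F.carrier) (c : Fin p → A.carrier ⊗[ℂ] A.carrier) :
    basisMap e c = ∑ i, F.orbit (e i) (c i) := by
  simp [basisMap]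

lemma basisMap_single {p : ℕ} (e : Fin p → F.carrier) (i : Fin p) (t : A.carrier ⊗[ℂ] A.carrier) :
    basisMap e (Pi.single i t) = F.orbit (e i) t := by
  rw [basisMap_apply, Finset.sum_eq_single i]
  · simp
  · intro j _ hj; simp [hj]
  · simp

variable {p : ℕ} {e : Fin p → F.carrier}
  (he : Function.Bijective fun c : Fin p → A.carrier ⊗[ℂ] A.carrier => ∑ i, F.orbit (e i) (c i))

include he

lemma basis_induction {P : F.carrier → Prop} (h : ∀ j x y, P (F.act (F.lact x (e j)) y))
    (h0 : P 0) (hadd : ∀ m m', P m → P m' → P (m + m')) (m : F.carrier) : P m := by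
  obtain ⟨c, rfl⟩ := he.2 m
  refine Finset.sum_induction _ P hadd h0 fun j _ => ?_
  induction c j using TensorProduct.induction_on with
  | zero => simpa using h0
  | tmul x y => exact h j x y
  | add x y hx hy => rw [map_add]; exact hadd _ _ hx hy

lemma exists_coord (k : Fin p) : ∃ c : F.carrier →ₗ[ℂ] A.carrier ⊗[ℂ] A.carrier,
    ∀ j x y, c (F.act (F.lact x (e j)) y) = if j = k then x ⊗ₜ y else 0 := by
  have hb : Function.Bijective (basisMap e) := by
    convert he using 1
    ext c
    exact basisMap_apply e c
  refine ⟨LinearMap.proj k ∘ₗ (LinearEquiv.ofBijective _ hb).symm.toLinearMap, fun j x y => ?_⟩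
  have h : (LinearEquiv.ofBijective _ hb).symm (F.act (F.lact x (e j)) y) =
      Pi.single j (x ⊗ₜ y) := by
    rw [LinearEquiv.symm_apply_eq]
    exact (basisMap_single e j (x ⊗ₜ y)).symm
  simp only [LinearMap.comp_apply, LinearEquiv.coe_coe, h, LinearMap.proj_apply]
  by_cases hjk : j = k
  · subst hjk; simp
  · rw [Pi.single_eq_of_ne (Ne.symm hjk), if_neg hjk]

/-- The balanced map with prescribed value on the `k`-th basis element of a free bimodule, and zero
on the others. -/
lemma exists_pairing (k : Fin p) {E X : DGModule A} (φ : E.carrier →ₗ[ℂ] X.carrier) :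
    ∃ H : E.carrier →ₗ[ℂ] F.carrier →ₗ[ℂ] X.carrier, IsBalanced H ∧
      ∀ x j a b, H x (F.act (F.lact a (e j)) b) =
        if j = k then X.act (φ (E.act x a)) b else 0 := by
  obtain ⟨c, hc⟩ := exists_coord he k
  let B : E.carrier →ₗ[ℂ] A.carrier →ₗ[ℂ] A.carrier →ₗ[ℂ] X.carrier :=
    E.act.compr₂ (X.act ∘ₗ φ)
  let H : E.carrier →ₗ[ℂ] F.carrier →ₗ[ℂ] X.carrier :=
    (TensorProduct.uncurry (RingHom.id ℂ) A.carrier A.carrier X.carrier ∘ₗ B).compl₂ c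
  have hH : ∀ x j a b, H x (F.act (F.lact a (e j)) b) =
        if j = k then X.act (φ (E.act x a)) b else 0 := by
    intro x j a b
    change (TensorProduct.uncurry (RingHom.id ℂ) _ _ _ (B x)) (c _) = _
    rw [hc]
    split_ifs
    · rfl
    · simp
  refine ⟨H, ⟨fun x a m => ?_, fun x m a => ?_⟩, hH⟩
  · induction m using basis_induction he with
    | h0 => simp
    | hadd m m' h h' => simp only [map_add, h, h']
    | h j y z => rw [F.lact_act, ← F.mul_lact, hH, hH, E.act_mul]
  · induction m using basis_induction he with
    | h0 => simp
    | hadd m m' h h' => simp only [map_add, h, h', LinearMap.add_apply]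
    | h j y z =>
      rw [← F.act_mul, hH, hH]
      split_ifs
      · rw [X.act_mul]
      · simp

/-- Balancedness gives `b(x, y e_j z) = b(x y, e_j) z`, so the maps `b(-, e_j)` determine `b`. -/
lemma pairing_eq_zero {E X : DGModule A} {b : E.carrier →ₗ[ℂ] F.carrier →ₗ[ℂ] X.carrier}
    (hb : IsBalanced b) (h : ∀ j x, b x (e j) = 0) : b = 0 := by
  ext x m
  induction m using basis_induction he with
  | h0 => simp
  | hadd m m' h h' => simp only [map_add, h, h']
  | h j y z => rw [hb.lin, ← hb.bal, h]; simp

omit he in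
lemma pairing_orbit_eq_zero {E X : DGModule A} {b : E.carrier →ₗ[ℂ] F.carrier →ₗ[ℂ] X.carrier}
    (hb : IsBalanced b) {j : Fin p} (h : ∀ x, b x (e j) = 0) (x : E.carrier)
    (t : A.carrier ⊗[ℂ] A.carrier) : b x (F.orbit (e j) t) = 0 := by
  induction t using TensorProduct.induction_on with
  | zero => simp
  | add t t' h h' => rw [map_add, map_add, h, h', add_zero]
  | tmul y z => rw [orbit_tmul, hb.lin, ← hb.bal, h]; simp

variable {n : Fin p → ℤ} (hn : ∀ i, e i ∈ F.deg (n i))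
  (hd : ∀ i, ∃ c : Fin p → A.carrier ⊗[ℂ] A.carrier,
      (∀ j, i ≤ j → c j = 0) ∧ F.d (e i) = ∑ j, F.orbit (e j) (c j))

omit he in
include hd in
lemma pairing_d_eq_zero {E X : DGModule A} {b : E.carrier →ₗ[ℂ] F.carrier →ₗ[ℂ] X.carrier}
    (hb : IsBalanced b) {k : Fin p} (h : ∀ j < k, ∀ x, b x (e j) = 0) (x : E.carrier) :
    b x (F.d (e k)) = 0 := by
  obtain ⟨c, hc, hk⟩ := hd k
  rw [hk, map_sum]
  refine Finset.sum_eq_zero fun j _ => ?_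
  by_cases hj : j < k
  · exact pairing_orbit_eq_zero hb (h j hj) x _
  · rw [hc j (not_lt.1 hj)]; simp

include hn hd in
/-- Composition with a ghost allows to kill a map on one more basis element. -/
lemma exists_pairing_step {E X Y : DGModule A} {u : X ⟶ Y} (hu : DGModule.IsGhost u)
    {b : E.carrier →ₗ[ℂ] F.carrier →ₗ[ℂ] X.carrier} (hb : IsClosedPairing b) (k : ℕ)
    (hk : ∀ j : Fin p, (j : ℕ) < k → ∀ x, b x (e j) = 0) :
    ∃ b' : E.carrier →ₗ[ℂ] F.carrier →ₗ[ℂ] Y.carrier, IsClosedPairing b' ∧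
      (∀ j : Fin p, (j : ℕ) < k + 1 → ∀ x, b' x (e j) = 0) ∧
      IsNullPairing (b.compr₂ (DGModule.lin u) - b') := by
  -- With no basis element left, `b` is already zero.
  by_cases hkp : p ≤ k
  · have h0 : b = 0 := pairing_eq_zero he hb.toIsBalanced fun j x => hk j (by lia) x
    subst h0
    refine ⟨0, ⟨⟨by simp, by simp⟩, by simp, by simp⟩, by simp, 0, ⟨by simp, by simp⟩, ?_⟩
    ext x m
    simp
  obtain ⟨h, hdeg, hh⟩ := hu.exists_contraction
  let k' : Fin p := ⟨k, by lia⟩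
  -- `H` sends `x ⊗ y e_k z` to `h(b(x y, e_k)) z`, where `h` contracts the ghost `u`; it vanishes
  -- on the other basis elements.
  obtain ⟨H, hH, hval⟩ := exists_pairing he k' (h ∘ₗ b.flip (e k'))
  have hve : ∀ x j, H x (e j) = if j = k' then h (b x (e k')) else 0 := fun x j => by
    have := hval x j 1 1
    simpa [F.act_one, F.one_lact, E.act_one, Y.act_one] using this
  have hp : ∀ x m, Y.parity (H x m) = - H (E.parity x) (F.parity m) := by
    intro x m
    induction m using basis_induction he with
    | h0 => simp
    | hadd m m' h h' => simp only [map_add, h, h', neg_add]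
    | h j y z =>
      rw [hval, F.parity_act, parity_lact, DGModule.parity_eq_smul (hn j),
        map_smul, LinearMap.map_smul₂, map_smul, hval]
      split_ifs with hj
      · rw [Y.parity_act]
        simp only [LinearMap.comp_apply, LinearMap.flip_apply]
        rw [DGModule.parity_map_odd hdeg, hb.parity, E.parity_act, ← hj,
          DGModule.parity_eq_smul (hn j), map_smul, map_smul]
        simp
      · simp
  have hH0 : ∀ j < k', ∀ x, H x (e j) = 0 := fun j hj x => by rw [hve, if_neg hj.ne]
  have hb0 : ∀ j < k', ∀ x, b x (e j) = 0 := fun j hj x => hk j hj x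
  refine ⟨b.compr₂ (DGModule.lin u) - pairingBoundary H, (hb.comp u).sub_boundary hH hp,
    fun j hj x => ?_, H, hH, by abel⟩
  rw [LinearMap.sub_apply, LinearMap.sub_apply, pairingBoundary_apply]
  rcases (Nat.lt_succ_iff_lt_or_eq.1 hj) with hj | hj
  · rw [LinearMap.compr₂_apply, hk j hj, hH0 j hj, hH0 j hj,
      pairing_d_eq_zero hd hH fun i hi => hH0 i (lt_trans hi hj)]
    simp
  -- By triangularity both `b` and `H` vanish on `d e_k`. So `b(-, e_k)` commutes with the
  -- differentials, and the boundary of `H` at `e_k` is `(dh + hd)(b(x, e_k)) = u(b(x, e_k))`, which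
  -- is what has to be cancelled.
  · have hj : j = k' := Fin.ext hj
    subst hj
    rw [pairing_d_eq_zero hd hH hH0, hve, hve, if_pos rfl, if_pos rfl, LinearMap.compr₂_apply,
      hh, hb.closed, pairing_d_eq_zero hd hb.toIsBalanced hb0]
    simp

end DGBimodule

/-! ### Twisted modules -/

/-- The structure of a dg bimodule on a given vector space, with the grading remembered only through
its parity involution. -/
structure ParityBimodule (A : DGAlgebra.{w}) (V : Type w) [AddCommGroup V] [Module ℂ V] where
  act : V →ₗ[ℂ] A.carrier →ₗ[ℂ] V
  lact : A.carrier →ₗ[ℂ] V →ₗ[ℂ] V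
  d : V →ₗ[ℂ] V
  parity : V →ₗ[ℂ] V
  act_mul : ∀ m a b, act m (a * b) = act (act m a) b
  lact_act : ∀ a m b, lact a (act m b) = act (lact a m) b
  parity_d : ∀ m, parity (d m) = - d (parity m)
  parity_act : ∀ m a, parity (act m a) = act (parity m) (A.parity a)
  parity_lact : ∀ a m, parity (lact a m) = lact (A.parity a) (parity m)
  d_act : ∀ m a, d (act m a) = act (d m) a + act (parity m) (A.d a)
  parity_parity : ∀ m, parity (parity m) = m
  d_d : ∀ m, d (d m) = 0
  d_lact : ∀ a m, d (lact a m) = lact (A.d a) m + lact (A.parity a) (d m)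
  mul_lact : ∀ a b m, lact (a * b) m = lact a (lact b m)

/-- The structure on the space underlying a dg bimodule. -/
def DGBimodule.toParity {A : DGAlgebra.{w}} (P : DGBimodule A) : ParityBimodule A P.carrier where
  act := P.act
  lact := P.lact
  d := P.d
  parity := P.parity
  act_mul := P.act_mul
  lact_act := P.lact_act
  parity_d := P.parity_d
  parity_act := P.parity_act
  parity_lact := P.parity_lact
  d_act := P.d_act
  parity_parity := P.parity_parity
  d_d := P.d_d
  d_lact := P.d_lact
  mul_lact := P.mul_lact

/-- The structure on the diagonal bimodule. -/
def DGAlgebra.toParity (A : DGAlgebra.{w}) : ParityBimodule A A.carrier where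
  act := LinearMap.mul ℂ A.carrier
  lact := LinearMap.mul ℂ A.carrier
  d := A.d
  parity := A.parity
  act_mul m a b := (mul_assoc m a b).symm
  lact_act m a b := (mul_assoc m a b).symm
  parity_d := A.diagonal.parity_d
  parity_act := A.diagonal.parity_act
  parity_lact := A.diagonal.parity_lact
  d_act := A.diagonal.d_act
  parity_parity := A.diagonal.parity_parity
  d_d := A.d_d
  d_lact := A.diagonal.d_lact
  mul_lact := mul_assoc

/-- A quasi-isomorphism from `B` to the diagonal bimodule. -/
structure ParityBimodule.IsResolution {A : DGAlgebra.{w}} {V : Type w} [AddCommGroup V] [Module ℂ V]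
    (B : ParityBimodule A V) (q : V →ₗ[ℂ] A.carrier) : Prop where
  map_act : ∀ m a, q (B.act m a) = q m * a
  map_lact : ∀ a m, q (B.lact a m) = a * q m
  map_d : ∀ m, q (B.d m) = A.d (q m)
  map_parity : ∀ m, q (B.parity m) = A.parity (q m)
  exact : ∀ m a, B.d m = 0 → q m = A.d a → ∃ m' a', m = B.d m' ∧ a = q m' + A.d a'

/-- The field `exact` is acyclicity of the cone of `q`. Injectivity on cohomology gives `m = d m₁`;
then `a - q m₁` is a cycle, and surjectivity supplies the correction `m₂`. -/
lemma DGBimodule.isResolution {A : DGAlgebra.{w}} {P : DGBimodule A}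
    {q : P.carrier →ₗ[ℂ] A.carrier} (hq : DGBimodule.IsHom P A.diagonal q)
    (hqi : DGBimodule.IsQuasiIso P A.diagonal q) : P.toParity.IsResolution q where
  map_act := hq.1.1.1
  map_lact := hq.1.map_lact_even
  map_d m := (hq.2 m).symm
  map_parity m := (DGModule.parity_map_even (M := P.toDGModule) (N := A.diagonal.toDGModule)
    hq.1.1.2 m).symm
  exact m a hm h := by
    have hd : ∀ m, A.d (q m) = q (P.d m) := hq.2
    obtain ⟨m₁, hm₁⟩ := hqi.1 m hm ⟨a, h⟩
    obtain ⟨m₂, a', h2, h3⟩ := hqi.2 (a - q m₁) (by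
      change A.d (a - q m₁) = 0
      rw [map_sub, hd, ← hm₁, h, sub_self])
    change a - q m₁ = q m₂ + A.d a' at h3
    refine ⟨m₁ + m₂, a', ?_, ?_⟩
    · change m = P.d (m₁ + m₂)
      rw [map_add, h2, add_zero, hm₁]
    · rw [map_add, add_assoc, ← h3]
      abel

section Twisted

variable {A : DGAlgebra.{w}} {V : Type w} [AddCommGroup V] [Module ℂ V] {r : ℕ} (n : Fin r → ℤ) (c : Fin r → Fin r → A.carrier)

/-- The parity involution of the twisted module `⨁ B[-nⱼ]`. -/
def twistedParity (B : ParityBimodule A V) : (Fin r → V) →ₗ[ℂ] (Fin r → V) :=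
  LinearMap.pi fun j => koszulSign (n j) • B.parity ∘ₗ LinearMap.proj j

lemma twistedParity_apply (B : ParityBimodule A V) (z : Fin r → V) (j : Fin r) :
    twistedParity n B z j = koszulSign (n j) • B.parity (z j) := rfl

/-- The differential of the twisted module `⨁ B[-nⱼ]` with connection matrix `c`. -/
def twistedD (B : ParityBimodule A V) : (Fin r → V) →ₗ[ℂ] (Fin r → V) :=
  LinearMap.pi fun j => koszulSign (n j) • B.d ∘ₗ LinearMap.proj j +
    ∑ i, B.lact (c j i) ∘ₗ LinearMap.proj i

lemma twistedD_apply (B : ParityBimodule A V) (z : Fin r → V) (j : Fin r) :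
    twistedD n c B z j = koszulSign (n j) • B.d (z j) + ∑ i, B.lact (c j i) (z i) := by
  simp [twistedD]

/-- The right action on a twisted module. -/
def twistedAct (B : ParityBimodule A V) :
    (Fin r → V) →ₗ[ℂ] A.carrier →ₗ[ℂ] (Fin r → V) :=
  LinearMap.mk₂ ℂ (fun z a j => B.act (z j) a) (fun _ _ _ => by ext; simp)
    (fun _ _ _ => by ext; simp) (fun _ _ _ => by ext; simp) (fun _ _ _ => by ext; simp)

@[simp] lemma twistedAct_apply (B : ParityBimodule A V) (z : Fin r → V) (a : A.carrier)
    (j : Fin r) : twistedAct B z a j = B.act (z j) a := rfl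

lemma twistedAct_mul (B : ParityBimodule A V) (z : Fin r → V) (a a' : A.carrier) :
    twistedAct B z (a * a') = twistedAct B (twistedAct B z a) a' := by
  ext j; simp [B.act_mul]

lemma twistedParity_act (B : ParityBimodule A V) (z : Fin r → V) (a : A.carrier) :
    twistedParity n B (twistedAct B z a) = twistedAct B (twistedParity n B z) (A.parity a) := by
  ext j
  simp [twistedParity_apply, B.parity_act]

lemma twistedD_act (B : ParityBimodule A V) (z : Fin r → V) (a : A.carrier) :
    twistedD n c B (twistedAct B z a) =
      twistedAct B (twistedD n c B z) a + twistedAct B (twistedParity n B z) (A.d a) := by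
  ext j
  simp only [Pi.add_apply, twistedAct_apply, twistedD_apply, twistedParity_apply, B.d_act,
    B.lact_act, map_add, map_smul, LinearMap.add_apply, LinearMap.smul_apply, map_sum,
    LinearMap.sum_apply, smul_add]
  abel

variable {n c}

/-- The hypothesis `hcp` says that `c j i` has degree `n i + 1 - n j` modulo `2`, which makes the
twisted differential odd. -/
lemma twistedD_parity (hcp : ∀ i, twistedParity n A.toParity (fun j => c j i) =
      - koszulSign (n i) • fun j => c j i) (B : ParityBimodule A V) (z : Fin r → V) :
    twistedD n c B (twistedParity n B z) = - twistedParity n B (twistedD n c B z) := by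
  ext j
  simp only [Pi.neg_apply, twistedD_apply, twistedParity_apply, map_smul, map_add, B.parity_d,
    map_sum, smul_add, smul_neg, neg_add, neg_neg, Finset.smul_sum, ← Finset.sum_neg_distrib]
  congr 1
  refine Finset.sum_congr rfl fun i _ => ?_
  have h : koszulSign (n j) • A.parity (c j i) = -koszulSign (n i) • c j i := congrFun (hcp i) j
  have h' := congrArg (fun a => B.lact a (B.parity (z i))) h
  simp only [LinearMap.map_smul₂] at h'
  rw [B.parity_lact, h', neg_smul, neg_neg]

/-- The hypothesis `hcc` is the Maurer–Cartan equation `± d c_{jk} + ∑ c_{ji} c_{ik} = 0`. For the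
connection matrix of a semi-free module it expresses `d² = 0` on the basis, and it suffices for
coefficients in any `B`. -/
lemma twistedD_twistedD (hcp : ∀ i, twistedParity n A.toParity (fun j => c j i) =
      - koszulSign (n i) • fun j => c j i)
    (hcc : ∀ i, twistedD n c A.toParity (fun j => c j i) = 0)
    (B : ParityBimodule A V) (z : Fin r → V) : twistedD n c B (twistedD n c B z) = 0 := by
  ext j
  have h1 : ∀ i, koszulSign (n j) • B.d (B.lact (c j i) (z i)) =
      B.lact (koszulSign (n j) • A.d (c j i)) (z i) -
        B.lact (c j i) (koszulSign (n i) • B.d (z i)) := fun i => by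
    have h : koszulSign (n j) • A.parity (c j i) = -koszulSign (n i) • c j i := congrFun (hcp i) j
    have h' := congrArg (fun a => B.lact a (B.d (z i))) h
    simp only [LinearMap.map_smul₂] at h'
    rw [B.d_lact, smul_add, h', LinearMap.map_smul₂, map_smul, neg_smul, sub_eq_add_neg]
  have h2 : ∑ i, B.lact (koszulSign (n j) • A.d (c j i)) (z i) +
      ∑ i, B.lact (c j i) (∑ k, B.lact (c i k) (z k)) = 0 := by
    simp only [map_sum]
    rw [Finset.sum_comm, ← Finset.sum_add_distrib]
    refine Finset.sum_eq_zero fun k _ => ?_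
    have h : koszulSign (n j) • A.d (c j k) + ∑ i, c j i * c i k = 0 := by
      have := congrFun (hcc k) j
      rwa [twistedD_apply] at this
    have h' := congrArg (fun a => B.lact a (z k)) h
    simp only [map_add, map_sum, LinearMap.add_apply, LinearMap.sum_apply, B.mul_lact, map_zero,
      LinearMap.zero_apply] at h'
    exact h'
  rw [twistedD_apply]
  simp only [twistedD_apply, map_add, map_smul, B.d_d, map_sum, Finset.sum_add_distrib,
    Finset.smul_sum, h1, Finset.sum_sub_distrib, Pi.zero_apply, smul_zero, zero_add] at h2 ⊢
  rw [← h2]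
  abel

/-- The right linear map with prescribed values on the standard basis. -/
def twistedComb (B : ParityBimodule A V) (s : Fin r → Fin r → V) :
    (Fin r → A.carrier) →ₗ[ℂ] (Fin r → V) :=
  ∑ j, twistedAct B (s j) ∘ₗ LinearMap.proj j

lemma twistedComb_apply {B : ParityBimodule A V} (s : Fin r → Fin r → V) (y : Fin r → A.carrier) :
    twistedComb B s y = ∑ j, twistedAct B (s j) (y j) := by
  simp [twistedComb]

lemma twistedComb_congr {B : ParityBimodule A V} {s s' : Fin r → Fin r → V}
    {y : Fin r → A.carrier} (h : ∀ j, y j = 0 ∨ s j = s' j) : twistedComb B s y = twistedComb B s' y := by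
  rw [twistedComb_apply, twistedComb_apply]
  refine Finset.sum_congr rfl fun j _ => ?_
  rcases h j with h | h <;> simp [h]

lemma twistedComb_act {B : ParityBimodule A V} (s : Fin r → Fin r → V) (y : Fin r → A.carrier)
    (a : A.carrier) :
    twistedComb B s (twistedAct A.toParity y a) = twistedAct B (twistedComb B s y) a := by
  rw [twistedComb_apply, twistedComb_apply, map_sum, LinearMap.sum_apply]
  exact Finset.sum_congr rfl fun j _ => twistedAct_mul B _ _ _

/-- The comparison of the two ways to differentiate a linear combination. -/
lemma twistedD_comb {B : ParityBimodule A V} (s : Fin r → Fin r → V) (y : Fin r → A.carrier)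
    (ε : ℂ) (hs : ∀ i, y i = 0 ∨ twistedParity n B (s i) = (ε * koszulSign (n i)) • s i) :
    twistedD n c B (twistedComb B s y) =
      ∑ i, twistedAct B (twistedD n c B (s i) - ε • twistedComb B s (fun j => c j i)) (y i) +
        ε • twistedComb B s (twistedD n c A.toParity y) := by
  have h1 : twistedComb B s (twistedD n c A.toParity y) =
      ∑ i, koszulSign (n i) • twistedAct B (s i) (A.d (y i)) +
        ∑ i, twistedAct B (twistedComb B s (fun j => c j i)) (y i) := by
    have h2 : ∀ i, twistedAct B (twistedComb B s (fun j => c j i)) (y i) =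
        ∑ j, twistedAct B (s j) (c j i * y i) := fun i => by
      rw [twistedComb_apply, map_sum, LinearMap.sum_apply]
      exact Finset.sum_congr rfl fun j _ => (twistedAct_mul B _ _ _).symm
    simp only [h2]
    rw [Finset.sum_comm, ← Finset.sum_add_distrib, twistedComb_apply]
    refine Finset.sum_congr rfl fun j _ => ?_
    rw [twistedD_apply]
    rw [map_add, map_sum]
    erw [map_smul]
    rfl
  rw [h1, twistedComb_apply s y, map_sum]
  simp only [twistedD_act, map_sub, LinearMap.sub_apply, map_smul, LinearMap.smul_apply, smul_add,
    Finset.sum_add_distrib, Finset.sum_sub_distrib, Finset.smul_sum]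
  have h3 : ∀ i, twistedAct B (twistedParity n B (s i)) (A.d (y i)) =
      ε • koszulSign (n i) • twistedAct B (s i) (A.d (y i)) := fun i => by
    rcases hs i with h | h
    · simp [h]
    · rw [h, LinearMap.map_smul₂, mul_smul]
  simp only [h3]
  abel

/-- Here `ε` is the parity of the map with columns `s`: `1` for a morphism, `-1` for a homotopy. The
alternative `y i = 0` leaves columns that are not yet constructed unconstrained. -/
lemma twistedParity_comb {B : ParityBimodule A V} (s : Fin r → Fin r → V) (y : Fin r → A.carrier)
    (ε : ℂ) (hs : ∀ i, y i = 0 ∨ twistedParity n B (s i) = (ε * koszulSign (n i)) • s i) :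
    twistedParity n B (twistedComb B s y) =
      ε • twistedComb B s (twistedParity n A.toParity y) := by
  rw [twistedComb_apply, twistedComb_apply, map_sum, Finset.smul_sum]
  refine Finset.sum_congr rfl fun i _ => ?_
  rw [twistedParity_act, twistedParity_apply, map_smul]
  rcases hs i with h | h
  · rw [h]
    erw [map_zero]
    simp
  · rw [h, LinearMap.map_smul₂, mul_smul]
    rfl

variable {P : ParityBimodule A V} {q : V →ₗ[ℂ] A.carrier}

/-- The map of twisted modules induced by a map of bimodules. -/
def twistedMap (q : V →ₗ[ℂ] A.carrier) : (Fin r → V) →ₗ[ℂ] (Fin r → A.carrier) :=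
  LinearMap.pi fun j => q ∘ₗ LinearMap.proj j

@[simp] lemma twistedMap_apply (z : Fin r → V) (j : Fin r) :
    twistedMap q z j = q (z j) := rfl

variable (hq : P.IsResolution q)

include hq

lemma twistedMap_d (z : Fin r → V) :
    twistedMap q (twistedD n c P z) = twistedD n c A.toParity (twistedMap q z) := by
  ext j
  rw [twistedMap_apply, twistedD_apply, twistedD_apply, map_add, map_sum, map_smul, twistedMap_apply,
    hq.map_d]
  congr 1
  exact Finset.sum_congr rfl fun i _ => hq.map_lact _ _

lemma twistedMap_parity (z : Fin r → V) :
    twistedMap q (twistedParity n P z) = twistedParity n A.toParity (twistedMap q z) := by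
  ext j
  rw [twistedMap_apply, twistedParity_apply, twistedParity_apply, map_smul, twistedMap_apply]
  congr 1
  exact hq.map_parity _

lemma twistedMap_comb (s : Fin r → Fin r → V) (y : Fin r → A.carrier) :
    twistedMap q (twistedComb P s y) =
      twistedComb A.toParity (fun j => twistedMap q (s j)) y := by
  rw [twistedComb_apply, twistedComb_apply, map_sum]
  refine Finset.sum_congr rfl fun j _ => ?_
  ext i
  exact hq.map_act _ _

variable (hc : ∀ i j, i ≤ j → c j i = 0)
  (hcp : ∀ i, twistedParity n A.toParity (fun j => c j i) = - koszulSign (n i) • fun j => c j i)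
  (hcc : ∀ i, twistedD n c A.toParity (fun j => c j i) = 0)

include hc hcp hcc

/-- The cone of the map of twisted modules induced by a quasi-isomorphism is acyclic. -/
lemma exists_twisted_cone_contraction (t : ℕ) {z : Fin r → V} {y : Fin r → A.carrier}
    (hzt : ∀ j : Fin r, t ≤ (j : ℕ) → z j = 0) (hyt : ∀ j : Fin r, t ≤ (j : ℕ) → y j = 0)
    (hz : twistedD n c P z = 0) (h : twistedMap q z = twistedD n c A.toParity y) :
    ∃ z' y', z = twistedD n c P z' ∧ y = twistedMap q z' + twistedD n c A.toParity y' := by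
  induction t generalizing z y with
  | zero =>
    obtain rfl : z = 0 := by ext j; exact hzt j (Nat.zero_le _)
    obtain rfl : y = 0 := by ext j; exact hyt j (Nat.zero_le _)
    exact ⟨0, 0, by simp, by simp⟩
  | succ t ih =>
    by_cases htr : r ≤ t
    · exact ih (fun j hj => by lia) (fun j hj => by lia) hz h
    let k : Fin r := ⟨t, by lia⟩
    -- Since `c j i` is nonzero only for `j < i`, the connection does not contribute to the
    -- coordinates from `t` on for vectors supported in degrees of the filtration at most `t`. The
    -- top coordinates thus form a cycle in the untwisted cone, to which `hq.exact` applies; the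
    -- sign `koszulSign (n k)` is moved onto `z k`.
    have hck : ∀ {W : Type w} [AddCommGroup W] [Module ℂ W] (B : ParityBimodule A W) (x : Fin r → W),
        (∀ j : Fin r, t + 1 ≤ (j : ℕ) → x j = 0) → ∀ j : Fin r, t ≤ (j : ℕ) →
        twistedD n c B x j = koszulSign (n j) • B.d (x j) := by
      intro W _ _ B x hx j hj
      rw [twistedD_apply, Finset.sum_eq_zero, add_zero]
      intro i _
      by_cases hi : i ≤ j
      · rw [hc i j hi]; simp
      · rw [hx i (by simp only [not_le, Fin.lt_def] at hi; lia)]; simp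
    have hz' := congrFun hz k
    rw [hck P z hzt k le_rfl] at hz'
    have hzk : P.d (z k) = 0 := by
      rw [← koszulSign_smul_smul (n k) (P.d (z k)), hz']; simp
    have hyk : q (koszulSign (n k) • z k) = A.d (y k) := by
      have h1 := congrFun h k
      rw [hck A.toParity y hyt k le_rfl, twistedMap_apply] at h1
      rw [map_smul, h1]
      exact koszulSign_smul_smul _ _
    obtain ⟨m, a, hm, ha⟩ := hq.exact _ _ (by rw [map_smul, hzk, smul_zero]) hyk
    have hkm : ∀ {W : Type w} [AddCommGroup W] (x : W) (j : Fin r), t + 1 ≤ (j : ℕ) →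
        (Pi.single k x : Fin r → W) j = 0 := by
      intro W _ x j hj
      rw [Pi.single_eq_of_ne]
      rintro rfl
      simp [k] at hj
    -- Subtracting the boundary of the primitive `(m, a)` placed in coordinate `k` kills the top
    -- coordinate.
    obtain ⟨z', y', hz', hy'⟩ := ih (z := z - twistedD n c P (Pi.single k m))
      (y := y - twistedMap q (Pi.single k m) -
        twistedD n c A.toParity (Pi.single k (koszulSign (n k) • a)))
      (by
        intro j hj
        rw [Pi.sub_apply, hck P _ (hkm m) j hj]
        rcases hj.eq_or_lt with hj | hj
        · obtain rfl : j = k := Fin.ext hj.symm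
          rw [Pi.single_eq_same, ← hm, koszulSign_smul_smul, sub_self]
        · rw [hkm m j hj, hzt j hj]; simp)
      (by
        intro j hj
        rw [Pi.sub_apply, Pi.sub_apply, hck A.toParity _ (hkm _) j hj]
        rcases hj.eq_or_lt with hj | hj
        · obtain rfl : j = k := Fin.ext hj.symm
          rw [twistedMap_apply, Pi.single_eq_same, Pi.single_eq_same, map_smul, koszulSign_smul_smul,
            ha]
          change q m + A.d a - q m - A.d a = 0
          abel
        · rw [hkm _ j hj, hyt j hj, twistedMap_apply, hkm m j hj]; simp)
      (by rw [map_sub, hz, twistedD_twistedD hcp hcc, sub_zero])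
      (by
        rw [map_sub, map_sub, map_sub, twistedD_twistedD hcp hcc, sub_zero, h, twistedMap_d hq])
    refine ⟨z' + Pi.single k m, y' + Pi.single k (koszulSign (n k) • a), ?_, ?_⟩
    · rw [map_add, ← hz']; abel
    · rw [map_add, map_add]
      rw [add_add_add_comm, ← hy']
      abel

end Twisted

/-! ### Lifting a semi-free module along a resolution of the diagonal -/

section Section

variable {A : DGAlgebra.{w}} {V : Type w} [AddCommGroup V] [Module ℂ V] {r : ℕ} {n : Fin r → ℤ}
  {c : Fin r → Fin r → A.carrier}

lemma twistedParity_twistedParity (B : ParityBimodule A V) (z : Fin r → V) :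
    twistedParity n B (twistedParity n B z) = z := by
  ext j
  rw [twistedParity_apply, twistedParity_apply, map_smul, koszulSign_smul_smul, B.parity_parity]

/-- The part of parity `ε`, for a sign `ε`. -/
lemma twistedParity_average (B : ParityBimodule A V) {ε : ℂ} (hε : ε * ε = 1) (z : Fin r → V) :
    twistedParity n B ((1 / 2 : ℂ) • (z + ε • twistedParity n B z)) =
      ε • ((1 / 2 : ℂ) • (z + ε • twistedParity n B z)) := by
  rw [map_smul, map_add, map_smul, twistedParity_twistedParity, smul_comm ε, smul_add ε, smul_smul,
    hε, one_smul, add_comm]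

lemma twistedD_single_one (i : Fin r) :
    twistedD n c A.toParity (Pi.single i 1) = fun j => c j i := by
  ext j
  have h : A.d ((Pi.single i 1 : Fin r → A.carrier) j) = 0 := by
    by_cases hj : j = i
    · subst hj; rw [Pi.single_eq_same, A.d_one]
    · rw [Pi.single_eq_of_ne hj, map_zero]
  rw [twistedD_apply]
  change koszulSign (n j) • A.d _ + ∑ k, c j k * _ = _
  rw [h, smul_zero, zero_add, Finset.sum_eq_single i]
  · simp
  · intro k _ hk; rw [Pi.single_eq_of_ne hk, mul_zero]
  · simp

lemma twistedParity_single_one (i : Fin r) :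
    twistedParity n A.toParity (Pi.single i 1) = koszulSign (n i) • Pi.single i 1 := by
  ext j
  rw [twistedParity_apply, Pi.smul_apply]
  change _ • A.parity _ = _
  by_cases hj : j = i
  · subst hj; rw [Pi.single_eq_same, A.parity_one]
  · rw [Pi.single_eq_of_ne hj]; simp

lemma twistedComb_single_one (y : Fin r → A.carrier) :
    twistedComb A.toParity (fun i => Pi.single i 1) y = y := by
  ext j
  rw [twistedComb_apply, Finset.sum_apply, Finset.sum_eq_single j]
  · change (Pi.single j 1 : Fin r → A.carrier) j * y j = _
    simp
  · intro k _ hk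
    change (Pi.single k 1 : Fin r → A.carrier) j * _ = 0
    rw [Pi.single_eq_of_ne hk.symm, zero_mul]
  · simp

variable {P : ParityBimodule A V} {q : V →ₗ[ℂ] A.carrier} (hq : P.IsResolution q)
  (hc : ∀ i j, i ≤ j → c j i = 0)
  (hcp : ∀ i, twistedParity n A.toParity (fun j => c j i) = - koszulSign (n i) • fun j => c j i)
  (hcc : ∀ i, twistedD n c A.toParity (fun j => c j i) = 0)

include hq hc hcp hcc

/-- A semi-free module lifts along a quasi-isomorphism, up to homotopy. -/
lemma exists_twisted_section (t : ℕ) :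
    ∃ (s : Fin r → Fin r → V) (k : Fin r → Fin r → A.carrier), ∀ i : Fin r, (i : ℕ) < t →
      twistedParity n P (s i) = koszulSign (n i) • s i ∧
      twistedParity n A.toParity (k i) = -koszulSign (n i) • k i ∧
      twistedD n c P (s i) = twistedComb P s (fun j => c j i) ∧
      twistedMap q (s i) - Pi.single i 1 =
        twistedD n c A.toParity (k i) + twistedComb A.toParity k (fun j => c j i) := by
  induction t with
  | zero => exact ⟨0, 0, by simp⟩
  | succ t ih =>
    obtain ⟨s, k, h⟩ := ih
    by_cases htr : r ≤ t
    · exact ⟨s, k, fun i _ => h i (by lia)⟩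
    let l : Fin r := ⟨t, by lia⟩
    set σ := koszulSign (n l) with hσ
    have hlt : ∀ j, c j l = 0 ∨ (j : ℕ) < t := fun j => by
      by_cases hj : (j : ℕ) < t
      · exact Or.inr hj
      · exact Or.inl (hc l j (by simpa [l, Fin.le_def] using hj))
    have hs1 : ∀ i, c i l = 0 ∨ twistedParity n P (s i) = (1 * koszulSign (n i)) • s i := fun i =>
      (hlt i).imp_right fun hi => by rw [one_mul]; exact (h i hi).1
    have hk1 : ∀ i, c i l = 0 ∨
        twistedParity n A.toParity (k i) = (-1 * koszulSign (n i)) • k i := fun i =>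
      (hlt i).imp_right fun hi => by rw [neg_one_mul]; exact (h i hi).2.1
    -- The chain-map condition prescribes `z` as the differential of the new column `s l`, and `x`
    -- is the contribution of the known columns of `k` to the homotopy condition. Triangularity
    -- makes both depend on earlier columns only.
    set z := twistedComb P s (fun j => c j l) with hz
    set x := twistedComb A.toParity k (fun j => c j l) with hx
    have hDz : twistedD n c P z = 0 := by
      rw [hz, twistedD_comb s _ 1 hs1, hcc, map_zero, smul_zero, add_zero]
      refine Finset.sum_eq_zero fun i _ => ?_
      rcases hlt i with hi | hi
      · simp [hi]
      · rw [(h i hi).2.2.1]; simp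
    have hDx : twistedD n c A.toParity x = twistedMap q z - fun j => c j l := by
      have h1 := twistedComb_single_one (A := A) (fun j => c j l)
      rw [twistedComb_apply] at h1
      rw [hx, twistedD_comb k _ (-1) hk1, hcc, map_zero, smul_zero, add_zero, hz,
        twistedMap_comb hq, twistedComb_apply (fun j => twistedMap q (s j))]
      refine Eq.trans ?_ (congrArg (HSub.hSub _) h1)
      rw [← Finset.sum_sub_distrib]
      refine Finset.sum_congr rfl fun i _ => ?_
      rcases hlt i with hi | hi
      · simp [hi]
      · rw [← LinearMap.map_sub₂, (h i hi).2.2.2, neg_one_smul, sub_neg_eq_add]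
    have hpz : twistedParity n P z = -σ • z := by
      rw [hz, twistedParity_comb s _ 1 hs1, one_smul, hcp, map_smul]
    have hpx : twistedParity n A.toParity x = σ • x := by
      rw [hx, twistedParity_comb k _ (-1) hk1, hcp, map_smul, smul_smul]
      simp [hσ]
    -- The pair `(z, e_l + x)` is a cycle of the acyclic cone; a primitive `(z', y')` yields the new
    -- columns `s l = z'` and `k l = -y'`, up to parity.
    obtain ⟨z', y', hz', hy'⟩ := exists_twisted_cone_contraction hq hc hcp hcc r
      (z := z) (y := Pi.single l 1 + x) (fun j hj => by lia) (fun j hj => by lia) hDz (by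
        rw [map_add, hDx, twistedD_single_one]; abel)
    have hσσ : σ * σ = 1 := koszulSign_mul_self _
    -- Averaging projects the primitive to the required parities. Both equations survive because `z`
    -- and `e_l + x` already have the matching parities.
    set z₁ := (1 / 2 : ℂ) • (z' + σ • twistedParity n P z') with hz₁
    set y₁ := (1 / 2 : ℂ) • (y' + (-σ) • twistedParity n A.toParity y') with hy₁
    have e1 : twistedD n c P z₁ = z := by
      rw [hz₁, map_smul, map_add, map_smul, twistedD_parity hcp, ← hz', hpz, neg_smul, neg_neg,
        smul_smul, hσσ, one_smul, ← two_smul ℂ z, smul_smul]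
      norm_num
    have e2 : twistedMap q z₁ + twistedD n c A.toParity y₁ = Pi.single l 1 + x := by
      have h2 : σ • twistedParity n A.toParity (Pi.single l 1 + x) = Pi.single l 1 + x := by
        rw [map_add, hpx, twistedParity_single_one, smul_add, smul_smul, smul_smul, hσσ, one_smul,
          one_smul]
      have h3 : twistedMap q z₁ + twistedD n c A.toParity y₁ = (1 / 2 : ℂ) •
          ((twistedMap q z' + twistedD n c A.toParity y') + σ • twistedParity n A.toParity
            (twistedMap q z' + twistedD n c A.toParity y')) := by
        rw [hz₁, hy₁, map_smul, map_smul, ← smul_add, map_add, map_add, map_smul, map_smul,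
          twistedD_parity hcp, twistedMap_parity hq, map_add, smul_add, neg_smul, smul_neg, neg_neg]
        simp only [smul_add]
        abel
      rw [h3, ← hy', h2, ← two_smul ℂ (_ + x), smul_smul]
      norm_num
    have hsl : ∀ {W : Type w} [AddCommGroup W] [Module ℂ W] (B : ParityBimodule A W)
        (f : Fin r → Fin r → W) (b : Fin r → W) (i : Fin r), (i : ℕ) < t + 1 →
        twistedComb B (Function.update f l b) (fun j => c j i) =
          twistedComb B f (fun j => c j i) := by
      intro W _ _ B f b i hi
      refine twistedComb_congr fun j => ?_
      by_cases hj : j = l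
      · left
        subst hj
        exact hc i l (by simp only [Fin.le_def, l]; lia)
      · right; rw [Function.update_of_ne hj]
    refine ⟨Function.update s l z₁, Function.update k l (-y₁), fun i hi => ?_⟩
    rw [hsl _ _ _ i hi, hsl _ _ _ i hi]
    by_cases hil : i = l
    · subst hil
      rw [Function.update_self, Function.update_self]
      refine ⟨twistedParity_average P hσσ z', ?_, e1, ?_⟩
      · rw [map_neg, smul_neg]
        congr 1
        exact twistedParity_average A.toParity (by rw [neg_mul_neg, hσσ]) y'
      · rw [map_neg, eq_sub_of_add_eq e2]
        abel
    · rw [Function.update_of_ne hil, Function.update_of_ne hil]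
      refine h i ?_
      have : (i : ℕ) ≠ t := fun h => hil (Fin.ext h)
      lia

end Section

/-! ### The ghost lemma for dg modules -/

section GhostLemma

variable {A : DGAlgebra.{w}}

namespace DGModule

/-- The standard basis map of a free module. -/
def basisMap {E : DGModule A} {r : ℕ} (e : Fin r → E.carrier) :
    (Fin r → A.carrier) →ₗ[ℂ] E.carrier :=
  ∑ i, E.act (e i) ∘ₗ LinearMap.proj i

lemma basisMap_apply {E : DGModule A} {r : ℕ} (e : Fin r → E.carrier) (y : Fin r → A.carrier) :
    basisMap e y = ∑ i, E.act (e i) (y i) := by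
  simp [basisMap]

variable {E : DGModule A} {r : ℕ} {n : Fin r → ℤ} {e : Fin r → E.carrier}
  {c : Fin r → Fin r → A.carrier}

lemma basisMap_act (y : Fin r → A.carrier) (a : A.carrier) :
    basisMap e (twistedAct A.toParity y a) = E.act (basisMap e y) a := by
  rw [basisMap_apply, basisMap_apply, map_sum, LinearMap.sum_apply]
  exact Finset.sum_congr rfl fun j _ => E.act_mul _ _ _

lemma parity_basisMap (he : ∀ i, e i ∈ E.deg (n i)) (y : Fin r → A.carrier) :
    E.parity (basisMap e y) = basisMap e (twistedParity n A.toParity y) := by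
  rw [basisMap_apply, basisMap_apply, map_sum]
  refine Finset.sum_congr rfl fun j _ => ?_
  rw [parity_act, parity_eq_smul (he j), LinearMap.map_smul₂, twistedParity_apply, map_smul]
  rfl

lemma d_basisMap (he : ∀ i, e i ∈ E.deg (n i))
    (hd : ∀ i, E.d (e i) = ∑ j, E.act (e j) (c j i)) (y : Fin r → A.carrier) :
    E.d (basisMap e y) = basisMap e (twistedD n c A.toParity y) := by
  rw [basisMap_apply, basisMap_apply, map_sum]
  simp only [d_act, Finset.sum_add_distrib, twistedD_apply, map_add, map_sum, hd,
    LinearMap.sum_apply, ← E.act_mul]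
  rw [Finset.sum_comm, add_comm]
  congr 1
  refine Finset.sum_congr rfl fun j _ => ?_
  rw [parity_eq_smul (he j), LinearMap.map_smul₂, map_smul]
  rfl

end DGModule

/-- The balanced map `e ⊗ m ↦ e q(m)`. -/
def resolutionPairing (E : DGModule A) {V : Type w} [AddCommGroup V] [Module ℂ V]
    (q : V →ₗ[ℂ] A.carrier) : E.carrier →ₗ[ℂ] V →ₗ[ℂ] E.carrier :=
  E.act.compl₂ q

@[simp] lemma resolutionPairing_apply (E : DGModule A) {V : Type w} [AddCommGroup V] [Module ℂ V]
    (q : V →ₗ[ℂ] A.carrier) (x : E.carrier) (m : V) :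
    resolutionPairing E q x m = E.act x (q m) := rfl

/-- A morphism from a semi-free module is null-homotopic if it becomes so after tensoring with a
resolution of the diagonal. -/
lemma homotopic_zero_of_isNullPairing {E X : DGModule A} (hE : E.IsFGSemifree) (g : E ⟶ X)
    {P : DGBimodule A} {q : P.carrier →ₗ[ℂ] A.carrier} (hq : P.toParity.IsResolution q)
    (hg : IsNullPairing ((resolutionPairing E q).compr₂ (DGModule.lin g) :
      E.carrier →ₗ[ℂ] P.carrier →ₗ[ℂ] X.carrier)) :
    DGModule.homotopic g 0 := by
  obtain ⟨r, n, e, he, hbij, hd⟩ := hE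
  choose c' hc' hd using hd
  let c : Fin r → Fin r → A.carrier := fun j i => c' i j
  have hc : ∀ i j, i ≤ j → c j i = 0 := fun i j => hc' i j
  replace hd : ∀ i, E.d (e i) = ∑ j, E.act (e j) (c j i) := hd
  have hbij' : Function.Bijective (DGModule.basisMap e) := by
    convert hbij using 1
    ext y
    exact DGModule.basisMap_apply e y
  have hce : ∀ i, DGModule.basisMap e (fun j => c j i) = E.d (e i) := fun i => by
    rw [hd, DGModule.basisMap_apply]
  have hcp : ∀ i, twistedParity n A.toParity (fun j => c j i) =
      - koszulSign (n i) • fun j => c j i := fun i => hbij'.1 (by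
    rw [← DGModule.parity_basisMap he, map_smul, hce, E.parity_d, DGModule.parity_eq_smul (he i),
      map_smul, neg_smul])
  have hcc : ∀ i, twistedD n c A.toParity (fun j => c j i) = 0 := fun i => hbij'.1 (by
    rw [← DGModule.d_basisMap he hd, hce, E.d_d, map_zero])
  obtain ⟨s, k, h⟩ := exists_twisted_section hq hc hcp hcc r
  obtain ⟨H, hH, hHg⟩ := hg
  have hHg' : ∀ x m, X.d (H x m) + H (E.d x) m + H (E.parity x) (P.d m) =
      DGModule.lin g (E.act x (q m)) := fun x m => by
    rw [← pairingBoundary_apply, hHg]; rfl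
  -- `Ht` is `H` in the coordinates `E ⊗_A P ≅ ⨁ P` given by the basis of `E`.
  let Ht : (Fin r → P.carrier) →ₗ[ℂ] X.carrier := ∑ j, H (e j) ∘ₗ LinearMap.proj j
  have Ht_apply : ∀ z, Ht z = ∑ j, H (e j) (z j) := fun z => by simp [Ht]
  have hHt : ∀ z, X.d (Ht z) + Ht (twistedD n c P.toParity z) =
      DGModule.lin g (DGModule.basisMap e (twistedMap q z)) := fun z => by
    have h1 : ∀ j, DGModule.lin g (E.act (e j) (q (z j))) = X.d (H (e j) (z j)) +
        ∑ i, H (e i) (P.lact (c i j) (z j)) + koszulSign (n j) • H (e j) (P.d (z j)) := fun j => by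
      rw [← hHg', hd, DGModule.parity_eq_smul (he j), LinearMap.map_smul₂, map_sum,
        LinearMap.sum_apply]
      simp only [hH.bal]
    rw [DGModule.basisMap_apply, map_sum, Ht_apply, Ht_apply, map_sum]
    simp only [twistedMap_apply, h1, twistedD_apply, map_add, map_sum, map_smul,
      Finset.sum_add_distrib]
    rw [Finset.sum_comm, add_assoc, add_comm (∑ x, ∑ y, _)]
    rfl
  let φ := LinearEquiv.ofBijective _ hbij'
  have hφ : ∀ y, φ.symm (DGModule.basisMap e y) = y := fun y => by
    rw [LinearEquiv.symm_apply_eq]; rfl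
  -- With `d Ht + Ht D = g q` and `q s - 1 = D k + k D`, the map `η = Ht s - g k` satisfies `dη + ηd
  -- = g q s - g(q s - 1) = g`. It need not be homogeneous, since `homotopic_zero_of` extracts its
  -- part of degree `-1`.
  let η : E.carrier →ₗ[ℂ] X.carrier := (Ht ∘ₗ twistedComb P.toParity s -
    DGModule.lin g ∘ₗ DGModule.basisMap e ∘ₗ twistedComb A.toParity k) ∘ₗ φ.symm.toLinearMap
  have hη : ∀ y, η (DGModule.basisMap e y) = Ht (twistedComb P.toParity s y) -
      DGModule.lin g (DGModule.basisMap e (twistedComb A.toParity k y)) := fun y => by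
    simp only [η, LinearMap.comp_apply, LinearEquiv.coe_coe, hφ, LinearMap.sub_apply]
  refine DGModule.homotopic_zero_of g η (fun x a => ?_) fun x => ?_
  · obtain ⟨y, rfl⟩ := hbij'.2 x
    rw [← DGModule.basisMap_act, hη, hη, twistedComb_act, twistedComb_act, DGModule.basisMap_act,
      DGModule.lin_act, map_sub, LinearMap.sub_apply]
    congr 1
    rw [Ht_apply, Ht_apply, map_sum, LinearMap.sum_apply]
    exact Finset.sum_congr rfl fun j _ => hH.lin _ _ _
  · obtain ⟨y, rfl⟩ := hbij'.2 x
    have e1 : twistedD n c P.toParity (twistedComb P.toParity s y) =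
        twistedComb P.toParity s (twistedD n c A.toParity y) := by
      rw [twistedD_comb s y 1 fun i => Or.inr (by rw [one_mul]; exact (h i i.2).1), one_smul,
        Finset.sum_eq_zero, zero_add]
      intro i _
      rw [(h i i.2).2.2.1]; simp
    have e2 : twistedD n c A.toParity (twistedComb A.toParity k y) =
        twistedMap q (twistedComb P.toParity s y) - y -
          twistedComb A.toParity k (twistedD n c A.toParity y) := by
      have h1 := twistedComb_single_one (A := A) y
      rw [twistedComb_apply] at h1
      rw [twistedD_comb k y (-1) fun i => Or.inr (by rw [neg_one_mul]; exact (h i i.2).2.1),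
        neg_one_smul, ← sub_eq_add_neg, twistedMap_comb hq,
        twistedComb_apply (fun j => twistedMap q (s j))]
      congr 1
      refine Eq.trans ?_ (congrArg (HSub.hSub _) h1)
      rw [← Finset.sum_sub_distrib]
      refine Finset.sum_congr rfl fun i _ => ?_
      rw [← LinearMap.map_sub₂, (h i i.2).2.2.2, neg_one_smul, sub_neg_eq_add]
    rw [DGModule.d_basisMap he hd, hη, hη, ← e1, map_sub, DGModule.d_lin,
      DGModule.d_basisMap he hd, e2]
    have e3 := hHt (twistedComb P.toParity s y)
    rw [sub_add_sub_comm, e3, ← map_add, ← map_add, sub_add_cancel, ← map_sub, ← map_sub,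
      sub_sub_cancel]

/-- Composites of `k` ghosts with a morphism starting from `E`. -/
inductive GhostChain (E : DGModule A) : ℕ → ∀ X : DGModule A, (E ⟶ X) → Prop
  | base {X : DGModule A} (f : E ⟶ X) : GhostChain E 0 X f
  | step {k : ℕ} {X Y : DGModule A} {f : E ⟶ X} (h : GhostChain E k X f) {u : X ⟶ Y}
      (hu : DGModule.IsGhost u) : GhostChain E (k + 1) Y (f ≫ u)

/-- The ghost lemma: over a smooth dg algebra, composites of sufficiently many ghosts starting from a
finitely generated semi-free module are null-homotopic. -/
theorem exists_ghostChain_null (hA : A.IsSmooth) : ∃ p : ℕ, ∀ {E X : DGModule A} {f : E ⟶ X},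
    E.IsFGSemifree → GhostChain E p X f → DGModule.homotopic f 0 := by
  obtain ⟨P, F, ⟨p, n, e, hn, he, hd⟩, ⟨i, ρ, h, hi, hρ, hh, hhom⟩, q', hq, hqi⟩ := hA
  obtain ⟨q, hq'⟩ : ∃ q : P.carrier →ₗ[ℂ] A.carrier, P.toParity.IsResolution q :=
    ⟨q', DGBimodule.isResolution hq hqi⟩
  have hq_act : ∀ m a, q (P.act m a) = q m * a := hq'.map_act
  have hq_lact : ∀ a m, q (P.lact a m) = a * q m := hq'.map_lact
  have hq_d : ∀ m, q (P.d m) = A.d (q m) := hq'.map_d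
  have hq_parity : ∀ m, q (P.parity m) = A.parity (q m) := hq'.map_parity
  refine ⟨p, fun {E X f} hE hf => ?_⟩
  -- The composite `E ⊗_A F → E ⊗_A P → E`.
  let b₀ : E.carrier →ₗ[ℂ] F.carrier →ₗ[ℂ] E.carrier := E.act.compl₂ (q ∘ₗ ρ)
  have hb₀ : ∀ x m, b₀ x m = E.act x (q (ρ m)) := fun _ _ => rfl
  have hclosed : IsClosedPairing b₀ :=
    { bal := fun x a m => by
        rw [hb₀, hb₀, hρ.1.map_lact_even, hq_lact, E.act_mul]
      lin := fun x m a => by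
        rw [hb₀, hb₀, hρ.1.1.1, hq_act, E.act_mul]
      parity := fun x m => by
        rw [hb₀, hb₀, E.parity_act, ← hq_parity]
        congr 2
        exact DGModule.parity_map_even hρ.1.1.2 m
      closed := fun x m => by
        rw [hb₀, hb₀, hb₀, E.d_act, ← hq_d]
        congr 2
        exact congrArg q (hρ.2 m) }
  have key : ∀ {k : ℕ} {X : DGModule A} {f : E ⟶ X}, GhostChain E k X f →
      ∃ b : E.carrier →ₗ[ℂ] F.carrier →ₗ[ℂ] X.carrier, IsClosedPairing b ∧
        (∀ j : Fin p, (j : ℕ) < k → ∀ x, b x (e j) = 0) ∧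
        IsNullPairing (b₀.compr₂ (DGModule.lin f) - b) := by
    intro k X f hf
    induction hf with
    | base f =>
      refine ⟨_, hclosed.comp f, by simp, 0, ⟨by simp, by simp⟩, ?_⟩
      ext x m
      simp
    | @step k X Y f hf u hu ih =>
      obtain ⟨b, hb, hbk, hnull⟩ := ih
      obtain ⟨b', hb', hbk', hnull'⟩ := DGBimodule.exists_pairing_step he hn hd hu hb k hbk
      refine ⟨b', hb', hbk', ?_⟩
      have := (hnull.comp u).add hnull'
      convert this using 1
      ext x m
      simp only [LinearMap.sub_apply, LinearMap.compr₂_apply, LinearMap.add_apply, map_sub,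
        sub_add_sub_cancel]
      rfl
  obtain ⟨b, hb, hbk, K, hK, hKb⟩ := key hf
  obtain rfl : b = 0 := DGBimodule.pairing_eq_zero he hb.toIsBalanced fun j x => hbk j j.2 x
  rw [sub_zero] at hKb
  have hKb' : ∀ x m, X.d (K x m) + K (E.d x) m + K (E.parity x) (F.d m) =
      DGModule.lin f (E.act x (q (ρ m))) := fun x m => by
    rw [← pairingBoundary_apply, hKb]; rfl
  refine homotopic_zero_of_isNullPairing hE f hq' ?_
  -- Restricting `K` along `i` contracts the pairing built from `q ρ i` rather than `q`. The
  -- difference `ρ i - 1 = dh + hd` is compensated by `K'`.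
  let K' : E.carrier →ₗ[ℂ] P.carrier →ₗ[ℂ] X.carrier :=
    ((E.act ∘ₗ E.parity).compl₂ (q ∘ₗ h)).compr₂ (DGModule.lin f)
  have hK' : ∀ x m, K' x m = DGModule.lin f (E.act (E.parity x) (q (h m))) := fun _ _ => rfl
  refine ⟨K.compl₂ i - K', ⟨fun x a m => ?_, fun x m a => ?_⟩, ?_⟩
  · rw [LinearMap.sub_apply, LinearMap.sub_apply, LinearMap.sub_apply, LinearMap.sub_apply,
      LinearMap.compl₂_apply, LinearMap.compl₂_apply, hK.bal, hi.1.map_lact_even, hK', hK',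
      hh.map_lact_odd, hq_lact, E.act_mul, E.parity_act]
  · rw [LinearMap.sub_apply, LinearMap.sub_apply, LinearMap.sub_apply, LinearMap.map_sub₂,
      LinearMap.compl₂_apply, LinearMap.compl₂_apply, hi.1.1.1, hK.lin, hK', hK', hh.1.1,
      hq_act, E.act_mul, DGModule.lin_act]
  · ext x m
    have h1 := hKb' x (i m)
    have h2 : q (ρ (i m)) = q m + q (P.d (h m)) + q (h (P.d m)) := by
      rw [add_assoc, ← map_add, ← hhom, ← map_add, add_sub_cancel]
    rw [h2, hq_d, map_add, map_add, map_add, map_add] at h1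
    simp only [pairingBoundary_apply, LinearMap.sub_apply, LinearMap.compl₂_apply, hK', map_sub,
      DGModule.d_lin, E.d_act, E.parity_d, E.parity_parity, map_neg, LinearMap.neg_apply, map_add,
      LinearMap.compr₂_apply, resolutionPairing_apply]
    rw [← hi.2]
    rw [eq_comm, add_comm] at h1
    have h4 : DGModule.lin f (E.act x (q m)) = X.d (K x (i m)) + K (E.d x) (i m) +
        K (E.parity x) (F.d (i m)) - DGModule.lin f (E.act x (A.d (q (h m)))) -
          DGModule.lin f (E.act x (q (h (P.d m)))) := by
      rw [← h1]; abel
    rw [h4]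
    abel

end GhostLemma

namespace DGAlgebra

/-- The free dg module `A[k]`. -/
def freeShift (A : DGAlgebra.{w}) (k : ℤ) : DGModule A where
  carrier := A.carrier
  deg i := A.deg (i + k)
  isInternal := by
    have h := (DirectSum.isInternal_submodule_iff_iSupIndep_and_iSup_eq_top _).1 A.isInternal
    refine (DirectSum.isInternal_submodule_iff_iSupIndep_and_iSup_eq_top _).2 ⟨?_, ?_⟩
    · exact h.1.comp (add_left_injective k)
    · rw [← h.2]
      exact (Equiv.addRight k).iSup_comp (g := A.deg)
  act := LinearMap.mul ℂ A.carrier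
  act_one := by simp
  act_mul m a b := by simp [mul_assoc]
  act_mem {i j m a} hm ha := by
    have := A.mul_mem hm ha
    rwa [add_right_comm] at this
  d := koszulSign k • A.d
  d_mem {i m} hm := Submodule.smul_mem _ _ (by
    have := A.d_mem hm
    rwa [add_right_comm] at this)
  d_d m := by simp [A.d_d]
  leibniz {i m} a hm := by
    have h : koszulSign k * koszulSign (i + k) = koszulSign i := by
      rw [koszulSign, koszulSign, koszulSign, ← Int.cast_mul, ← Units.val_mul,
        Int.negOnePow_add, mul_comm, mul_assoc]
      simp
    have h1 : ∀ (j : ℤ) (x : A.carrier), j.negOnePow • x = koszulSign j • x := fun j x => by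
      rw [koszulSign, Units.smul_def, Int.cast_smul_eq_zsmul]
    have h2 := A.leibniz a hm
    simp only [LinearMap.smul_apply, LinearMap.mul_apply', h1, map_smul] at h2 ⊢
    rw [h2, smul_add, smul_smul, h]

lemma freeShift_isFGSemifree (A : DGAlgebra.{w}) (k : ℤ) : (A.freeShift k).IsFGSemifree := by
  refine ⟨1, fun _ => -k, fun _ => (1 : A.carrier), fun _ => ?_, ?_, fun _ => ⟨0, by simp, ?_⟩⟩
  · change (1 : A.carrier) ∈ A.deg (-k + k)
    rw [neg_add_cancel]
    exact A.one_mem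
  · have h : ∀ c : Fin 1 → A.carrier, ∑ i, (A.freeShift k).act (1 : A.carrier) (c i) = c 0 :=
      fun c => by
        rw [Fin.sum_univ_one]
        exact one_mul (c 0)
    simp only [h]
    exact (Equiv.funUnique (Fin 1) A.carrier).bijective
  · change koszulSign k • A.d 1 = _
    rw [A.d_one, smul_zero]
    refine (Finset.sum_eq_zero fun j _ => ?_).symm
    exact map_zero _

lemma koszulSign_succ (k : ℤ) : koszulSign (k + 1) = -koszulSign k := by
  rw [koszulSign, koszulSign, Int.negOnePow_succ]
  simp

/-- The isomorphism `A[k][1] ≅ A[k + 1]`. -/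
def freeShiftSucc (A : DGAlgebra.{w}) (k : ℤ) : (A.freeShift k).shift ≅ A.freeShift (k + 1) where
  hom := ⟨(LinearMap.id : A.carrier →ₗ[ℂ] A.carrier), ⟨fun _ _ => rfl, fun i m hm => by
    change m ∈ A.deg (i + 1 + k) at hm
    change m ∈ A.deg (i + 0 + (k + 1))
    rwa [show i + 0 + (k + 1) = i + 1 + k by ring]⟩, fun m => by
      change koszulSign (k + 1) • A.d m = -(koszulSign k • A.d m)
      rw [koszulSign_succ, neg_smul]⟩
  inv := ⟨(LinearMap.id : A.carrier →ₗ[ℂ] A.carrier), ⟨fun _ _ => rfl, fun i m hm => by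
    change m ∈ A.deg (i + (k + 1)) at hm
    change m ∈ A.deg (i + 0 + 1 + k)
    rwa [show i + 0 + 1 + k = i + (k + 1) by ring]⟩, fun m => by
      change -(koszulSign k • A.d m) = koszulSign (k + 1) • A.d m
      rw [koszulSign_succ, neg_smul]⟩
  hom_inv_id := rfl
  inv_hom_id := rfl

/-- The morphism `A[-i] → M`, `a ↦ m a` for a closed element `m` of degree `i`. -/
def freeShiftDesc {A : DGAlgebra.{w}} {M : DGModule A} {i : ℤ} {m : M.carrier} (hm : m ∈ M.deg i)
    (h : M.d m = 0) : A.freeShift (-i) ⟶ M :=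
  ⟨M.act m, ⟨fun a b => M.act_mul m a b, fun j a ha => by
    have := M.act_mem hm (show a ∈ A.deg (j + -i) from ha)
    rwa [show i + (j + -i) = j + 0 by ring] at this⟩, by
      change ∀ a : A.carrier, M.d (M.act m a) = M.act m (koszulSign (-i) • A.d a)
      intro a
      rw [M.d_act, h, DGModule.parity_eq_smul hm, map_smul, map_smul]
      simp [koszulSign]⟩

end DGAlgebra

/-! ### Transfer of the ghost lemma to the triangulated category -/

section GhostTriangulated

section

variable {T : Type u} [Category.{v} T] [Preadditive T] [HasShift T ℤ]

/-- `f` is annihilated by all morphisms from shifts of `G`. -/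
def IsGhostFor (G : T) {X Y : T} (f : X ⟶ Y) : Prop :=
  ∀ (j : ℤ) (u : G⟦j⟧ ⟶ X), u ≫ f = 0

/-- `IsGhostComp G k f`: the morphism `f` factors as a morphism followed by `k` ghosts. -/
inductive IsGhostComp (G : T) : ℕ → ∀ {X Y : T}, (X ⟶ Y) → Prop
  | base {X Y : T} (f : X ⟶ Y) : IsGhostComp G 0 f
  | step {k : ℕ} {X Y Z : T} {f : X ⟶ Y} (h : IsGhostComp G k f) {u : Y ⟶ Z}
      (hu : IsGhostFor G u) : IsGhostComp G (k + 1) (f ≫ u)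

end

variable {T : Type u} [Category.{v} T] [Preadditive T] [Linear ℂ T] [HasZeroObject T]
    [HasShift T ℤ] [∀ n : ℤ, (shiftFunctor T n).Additive] [Pretriangulated T]

namespace PerfEquivalence

variable {A : DGAlgebra.{w}} (e : PerfEquivalence T A)

attribute [local instance] PerfEquivalence.full PerfEquivalence.faithful

lemma exists_obj_iso {M : DGModule A} (hM : M.IsFGSemifree) :
    ∃ X : T, Nonempty (e.functor.obj X ≅ (DGAlgebra.HomotopyCat.Q A).obj M) := by
  have h : e.functor.essImage ((DGAlgebra.HomotopyCat.Q A).obj M) := by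
    rw [e.essImage]
    exact ⟨M, hM, ⟨Retract.refl _⟩⟩
  exact h

lemma nonempty_obj_shift_iso {X : T} {k : ℤ}
    (φ : e.functor.obj X ≅ (DGAlgebra.HomotopyCat.Q A).obj (A.freeShift k)) :
    Nonempty (e.functor.obj (X⟦(1 : ℤ)⟧) ≅
      (DGAlgebra.HomotopyCat.Q A).obj (A.freeShift (k + 1))) :=
  ⟨e.commShift.app X ≪≫ (DGAlgebra.HomotopyCat.shift A).mapIso φ ≪≫
    (DGAlgebra.HomotopyCat.Q A).mapIso (A.freeShiftSucc k)⟩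

lemma nonempty_obj_iso {G : T} (φ : e.functor.obj G ≅ (DGAlgebra.HomotopyCat.Q A).obj (A.freeShift 0))
    (k : ℤ) : Nonempty (e.functor.obj (G⟦k⟧) ≅ (DGAlgebra.HomotopyCat.Q A).obj (A.freeShift k)) := by
  induction k using Int.induction_on with
  | zero => exact ⟨e.functor.mapIso ((shiftFunctorZero T ℤ).app G) ≪≫ φ⟩
  | succ k ih =>
    obtain ⟨ψ⟩ := ih
    obtain ⟨χ⟩ := e.nonempty_obj_shift_iso ψ
    exact ⟨e.functor.mapIso ((shiftFunctorAdd T (k : ℤ) 1).app G) ≪≫ χ⟩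
  | pred k ih =>
    obtain ⟨ψ⟩ := ih
    -- `e` is compatible with `[1]` only. So an object `Y` realizing `A[-k-1]` is compared with
    -- `G[-k-1]` after applying `[1]`, which is fully faithful.
    obtain ⟨Y, ⟨θ⟩⟩ := e.exists_obj_iso (A.freeShift_isFGSemifree (-(k : ℤ) - 1))
    obtain ⟨χ⟩ := e.nonempty_obj_shift_iso θ
    rw [sub_add_cancel] at χ
    have α : Y⟦(1 : ℤ)⟧ ≅ (G⟦(-(k : ℤ) - 1)⟧)⟦(1 : ℤ)⟧ :=
      e.functor.preimageIso (χ ≪≫ ψ.symm) ≪≫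
        (shiftFunctorAdd' T (-(k : ℤ) - 1) 1 (-(k : ℤ)) (by ring)).app G
    exact ⟨e.functor.mapIso ((shiftFunctor T (1 : ℤ)).preimageIso α).symm ≪≫ θ⟩

/-- A cycle `m` of degree `i` is a morphism `A[-i] → X`. Its composite with `f` is null-homotopic,
and the homotopy evaluated at `1` is a primitive of the image of `m`. -/
lemma isGhost_of_isGhostFor {G : T}
    (φ : e.functor.obj G ≅ (DGAlgebra.HomotopyCat.Q A).obj (A.freeShift 0)) {X Y : T} {f : X ⟶ Y}
    (hf : IsGhostFor G f) {f' : (e.functor.obj X).as ⟶ (e.functor.obj Y).as}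
    (hf' : (DGAlgebra.HomotopyCat.Q A).map f' = e.functor.map f) : DGModule.IsGhost f' := by
  intro i m hm hd
  obtain ⟨ψ⟩ := e.nonempty_obj_iso φ (-i)
  obtain ⟨u, hu⟩ := e.functor.map_surjective
    (ψ.hom ≫ (DGAlgebra.HomotopyCat.Q A).map (DGAlgebra.freeShiftDesc hm hd))
  have h0 : (DGAlgebra.HomotopyCat.Q A).map (DGAlgebra.freeShiftDesc hm hd ≫ f') =
      (DGAlgebra.HomotopyCat.Q A).map 0 := by
    rw [← cancel_epi ψ.hom, Functor.map_comp, ← Category.assoc, hf']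
    erw [← hu, ← e.functor.map_comp, hf]
    have := e.additive
    simp
  rw [Quotient.functor_map_eq_iff] at h0
  obtain ⟨h, -, hh⟩ := h0
  refine ⟨h (1 : A.carrier), ?_⟩
  have h1 := hh (1 : A.carrier)
  have h2 : (A.freeShift (-i)).d (1 : A.carrier) = 0 := by
    change koszulSign (-i) • A.d 1 = 0
    rw [A.d_one, smul_zero]
  rw [h2, map_zero, add_zero] at h1
  rw [← h1]
  have h3 : DGModule.lin (DGAlgebra.freeShiftDesc hm hd ≫ f') (1 : A.carrier) =
      DGModule.lin f' ((e.functor.obj X).as.act m 1) := rfl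
  have h4 : DGModule.lin (0 : A.freeShift (-i) ⟶ (e.functor.obj Y).as) (1 : A.carrier) = 0 := rfl
  rw [h3, h4, DGModule.act_one, sub_zero]

include e in
/-- The ghost lemma in a triangulated category equivalent to the perfect derived category of a smooth
dg algebra. -/
theorem exists_isGhostComp_eq_zero (hA : A.IsSmooth) :
    ∃ (G : T) (p : ℕ), ∀ {X Y : T} {f : X ⟶ Y}, IsGhostComp G p f → f = 0 := by
  obtain ⟨p, hp⟩ := exists_ghostChain_null hA
  obtain ⟨G, ⟨φ⟩⟩ := e.exists_obj_iso (A.freeShift_isFGSemifree 0)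
  refine ⟨G, p, fun {X Y f} hf => ?_⟩
  have := e.additive
  have hX : DGAlgebra.HomotopyCat.perf (e.functor.obj X) := by
    rw [← e.essImage]
    exact e.functor.obj_mem_essImage X
  obtain ⟨F, hF, ⟨ret⟩⟩ := hX
  -- Precomposing with a retraction `F → X` from a semi-free module and choosing representatives
  -- gives a chain of dg ghosts starting at `F`.
  have key : ∀ {k : ℕ} {X Y : T} {f : X ⟶ Y}, IsGhostComp G k f →
      ∀ ρ : (DGAlgebra.HomotopyCat.Q A).obj F ⟶ e.functor.obj X,
      ∃ f' : F ⟶ (e.functor.obj Y).as, GhostChain F k _ f' ∧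
        (DGAlgebra.HomotopyCat.Q A).map f' = ρ ≫ e.functor.map f := by
    intro k X Y f hf ρ
    induction hf with
    | base f =>
      obtain ⟨f', hf'⟩ := (DGAlgebra.HomotopyCat.Q A).map_surjective (ρ ≫ e.functor.map f)
      exact ⟨f', .base _, hf'⟩
    | @step k X Y Z f h u hu ih =>
      obtain ⟨f', hf', hff⟩ := ih ρ
      obtain ⟨u', hu'⟩ := (DGAlgebra.HomotopyCat.Q A).map_surjective (X := (e.functor.obj Y).as)
        (Y := (e.functor.obj Z).as) (e.functor.map u)
      refine ⟨f' ≫ u', .step hf' (e.isGhost_of_isGhostFor φ hu hu'), ?_⟩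
      rw [Functor.map_comp, hu', hff, Functor.map_comp, ← Category.assoc]
  obtain ⟨f', hf', hff⟩ := key hf ret.r
  have h0 : (DGAlgebra.HomotopyCat.Q A).map f' = (DGAlgebra.HomotopyCat.Q A).map 0 := by
    rw [Quotient.functor_map_eq_iff]
    exact hp hF hf'
  apply e.functor.map_injective
  rw [hff, Functor.map_zero] at h0
  rw [← Category.id_comp (e.functor.map f), ← ret.retract, Category.assoc, h0]
  simp

end PerfEquivalence

end GhostTriangulated

/-! ### Towers and objects built from shifts of a generator -/

section Towers

variable {T : Type u} [Category.{v} T] [Preadditive T] [HasZeroObject T]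
    [HasShift T ℤ] [∀ n : ℤ, (shiftFunctor T n).Additive] [Pretriangulated T]

lemma IsTower.of_iso {l : List T} {E E' : T} (h : IsTower l E) (i : E ≅ E') : IsTower l E' := by
  cases h with
  | nil h => exact .nil (h.of_iso i.symm)
  | cons f g h ht hl =>
    refine .cons (f ≫ i.hom) (i.inv ≫ g) h (isomorphic_distinguished _ ht _ ?_) hl
    exact Triangle.isoMk _ _ (Iso.refl _) i.symm (Iso.refl _)
      (by
        change (f ≫ i.hom) ≫ i.inv = 𝟙 _ ≫ f
        simp)
      (by
        change (i.inv ≫ g) ≫ 𝟙 _ = i.inv ≫ g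
        simp)
      (by
        change h ≫ (𝟙 _)⟦(1 : ℤ)⟧' = 𝟙 _ ≫ h
        rw [CategoryTheory.Functor.map_id, Category.comp_id, Category.id_comp])

lemma IsTower.single (E : T) : IsTower [E] E :=
  .cons 0 (𝟙 E) 0 (contractible_distinguished₁ E) (.nil (isZero_zero T))

/-- If `A` is the last factor of `Z` and `E'` the previous stage, the octahedral axiom makes the
fiber of `Y → Z → A` an extension of `E'` by `X`, to which induction applies. -/
lemma IsTower.append [IsTriangulated T] {l l' : List T} {X Z : T} (hX : IsTower l X)
    (hZ : IsTower l' Z) : ∀ {Y : T} (f : X ⟶ Y) (g : Y ⟶ Z) (h : Z ⟶ X⟦(1 : ℤ)⟧),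
      Triangle.mk f g h ∈ distTriang T → IsTower (l' ++ l) Y := by
  induction hZ with
  | nil hZ =>
    intro Y f g h ht
    have : IsIso f := (Triangle.isZero₃_iff_isIso₁ _ ht).1 hZ
    exact hX.of_iso (asIso f)
  | cons f' g' h' ht' _ ih =>
    intro Y f g h ht
    obtain ⟨W, f'', h'', ht''⟩ := distinguished_cocone_triangle₁ (g ≫ g')
    let o := Triangulated.someOctahedron' rfl ht ht' ht''
    exact .cons _ _ _ ht'' (ih _ _ _ o.mem)

lemma IsTower.map (F : T ⥤ T) [F.CommShift ℤ] [F.IsTriangulated] {l : List T} {E : T}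
    (h : IsTower l E) : IsTower (l.map F.obj) (F.obj E) := by
  induction h with
  | nil h => exact .nil (F.map_isZero h)
  | cons f g h ht _ ih => exact .cons _ _ _ (F.map_distinguished _ ht) ih

lemma IsTower.shift (k : ℤ) {l : List T} {E : T} (h : IsTower l E) :
    IsTower (l.map fun A => A⟦k⟧) (E⟦k⟧) := by
  induction h with
  | nil h => exact .nil ((shiftFunctor T k).map_isZero h)
  | cons f g h ht _ ih => exact .cons _ _ _ (Triangle.shift_distinguished _ ht k) ih

/-- `E` is a direct summand of an object with a tower with factors `l`. -/
def TowerSummand (l : List T) (E : T) : Prop := ∃ Y : T, Nonempty (Retract E Y) ∧ IsTower l Y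

lemma TowerSummand.of_retract {l : List T} {E E' : T} (r : Retract E' E) (h : TowerSummand l E) :
    TowerSummand l E' := by
  obtain ⟨Y, ⟨r'⟩, hY⟩ := h
  exact ⟨Y, ⟨r.trans r'⟩, hY⟩

lemma IsTower.summand {l : List T} {E : T} (h : IsTower l E) : TowerSummand l E :=
  ⟨E, ⟨Retract.refl E⟩, h⟩

/-- `Y'` is the extension of the ambient objects with connecting morphism `Z' → Z → X[1] → X'[1]`.
The composite `Y → Y' → Y` need not be the identity, but it is an isomorphism by the five lemma, and
its inverse corrects the retraction. -/
lemma TowerSummand.ext [IsTriangulated T] {l l' : List T} {X Y Z : T} (hX : TowerSummand l X)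
    (hZ : TowerSummand l' Z) {f : X ⟶ Y} {g : Y ⟶ Z} {h : Z ⟶ X⟦(1 : ℤ)⟧}
    (hT : Triangle.mk f g h ∈ distTriang T) : TowerSummand (l' ++ l) Y := by
  obtain ⟨X', ⟨⟨a₁, b₁, h₁⟩⟩, hX'⟩ := hX
  obtain ⟨Z', ⟨⟨a₃, b₃, h₃⟩⟩, hZ'⟩ := hZ
  obtain ⟨Y', g₁, g₂, hT'⟩ := distinguished_cocone_triangle₂ (b₃ ≫ h ≫ a₁⟦(1 : ℤ)⟧')
  have h₁' : a₁⟦(1 : ℤ)⟧' ≫ b₁⟦(1 : ℤ)⟧' = 𝟙 _ := by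
    rw [← Functor.map_comp, h₁, CategoryTheory.Functor.map_id]
  obtain ⟨a₂ : Y ⟶ Y', ha₁₂, ha₂₃⟩ :=
    complete_distinguished_triangle_morphism₂ _ _ hT hT' a₁ a₃ (by
      change h ≫ a₁⟦(1 : ℤ)⟧' = a₃ ≫ b₃ ≫ h ≫ a₁⟦(1 : ℤ)⟧'
      rw [reassoc_of% h₃])
  obtain ⟨b₂ : Y' ⟶ Y, hb₁₂, hb₂₃⟩ :=
    complete_distinguished_triangle_morphism₂ _ _ hT' hT b₁ b₃ (by
      change (b₃ ≫ h ≫ a₁⟦(1 : ℤ)⟧') ≫ b₁⟦(1 : ℤ)⟧' = b₃ ≫ h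
      rw [Category.assoc, Category.assoc, h₁', Category.comp_id])
  change f ≫ a₂ = a₁ ≫ g₁ at ha₁₂
  change g ≫ a₃ = a₂ ≫ g₂ at ha₂₃
  change g₁ ≫ b₂ = b₁ ≫ f at hb₁₂
  change g₂ ≫ b₃ = b₂ ≫ g at hb₂₃
  let φ : Triangle.mk f g h ⟶ Triangle.mk f g h :=
    { hom₁ := 𝟙 X
      hom₂ := a₂ ≫ b₂
      hom₃ := 𝟙 Z
      comm₁ := by
        change f ≫ a₂ ≫ b₂ = 𝟙 X ≫ f
        rw [reassoc_of% ha₁₂, hb₁₂, reassoc_of% h₁, Category.id_comp]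
      comm₂ := by
        change g ≫ 𝟙 Z = (a₂ ≫ b₂) ≫ g
        rw [Category.assoc, ← hb₂₃, ← reassoc_of% ha₂₃, h₃]
      comm₃ := by
        change h ≫ (𝟙 X)⟦(1 : ℤ)⟧' = 𝟙 Z ≫ h
        rw [CategoryTheory.Functor.map_id, Category.comp_id, Category.id_comp] }
  have : IsIso (a₂ ≫ b₂) := isIso₂_of_isIso₁₃ φ hT hT (IsIso.id _) (IsIso.id _)
  exact ⟨Y', ⟨⟨a₂, b₂ ≫ inv (a₂ ≫ b₂), by rw [← Category.assoc, IsIso.hom_inv_id]⟩⟩,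
    hX'.append hZ' _ _ _ hT'⟩

lemma IsTower.flatMap [IsTriangulated T] {ι : Type*} {A : ι → T} {L : ι → List T}
    (hL : ∀ i, TowerSummand (L i) (A i)) {ns : List ι} {E : T} (h : IsTower (ns.map A) E) :
    TowerSummand (ns.flatMap L) E := by
  induction ns generalizing E with
  | nil => exact h.summand
  | cons n ns ih =>
    cases h with
    | cons f g h ht hl => exact (ih hl).ext (hL n) ht

lemma TowerSummand.flatMap [IsTriangulated T] {ι : Type*} {A : ι → T} {L : ι → List T}
    (hL : ∀ i, TowerSummand (L i) (A i)) {ns : List ι} {E : T} (h : TowerSummand (ns.map A) E) :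
    TowerSummand (ns.flatMap L) E := by
  obtain ⟨Y, ⟨r⟩, hY⟩ := h
  exact (hY.flatMap hL).of_retract r

lemma TowerSummand.congr [IsTriangulated T] {ι : Type*} {A B : ι → T} (e : ∀ i, A i ≅ B i)
    {ns : List ι} {E : T} (h : TowerSummand (ns.map A) E) : TowerSummand (ns.map B) E := by
  have := h.flatMap (L := fun i => [B i]) fun i =>
    (IsTower.single (B i)).summand.of_retract (Retract.ofIso (e i))
  rwa [← List.map_eq_flatMap] at this

lemma TowerSummand.exists_biprod {l : List T} {E : T} (h : TowerSummand l E) :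
    ∃ M, IsTower l (E ⊞ M) := by
  obtain ⟨Y, ⟨r⟩, hY⟩ := h
  obtain ⟨M, f, k, ht⟩ := distinguished_cocone_triangle₁ r.r
  have hk : k = 0 := by
    have := comp_distTriang_mor_zero₂₃ _ ht
    change r.r ≫ k = 0 at this
    rw [← Category.id_comp k, ← r.retract, Category.assoc, this, comp_zero]
  obtain ⟨i, -⟩ := exists_iso_binaryBiproduct_of_distTriang _ ht hk
  exact ⟨M, hY.of_iso (i ≪≫ biprod.braiding _ _)⟩

/-- A nonzero morphism into an object with a tower yields one into a factor of the tower. -/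
lemma IsTower.exists_ne_zero {l : List T} {E : T} (h : IsTower l E) {X : T} {f : X ⟶ E}
    (hf : f ≠ 0) : ∃ A ∈ l, ∃ g : X ⟶ A, g ≠ 0 := by
  induction h with
  | nil h => exact absurd (h.eq_of_tgt _ _) hf
  | cons f' g' h' ht _ ih =>
    by_cases h0 : f ≫ g' = 0
    · obtain ⟨k, hk⟩ := Triangle.coyoneda_exact₂ _ ht f h0
      have hk0 : k ≠ 0 := by
        rintro rfl
        exact hf (hk.trans zero_comp)
      obtain ⟨A, hA, g, hg⟩ := ih hk0
      exact ⟨A, List.mem_cons_of_mem _ hA, g, hg⟩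
    · exact ⟨_, List.mem_cons_self, _, h0⟩

/-- `E` is a direct summand of an object with a tower with factors `G[n]`, `n ∈ l`. -/
def Builds (G : T) (l : List ℤ) (E : T) : Prop := TowerSummand (l.map fun n => G⟦n⟧) E

namespace Builds

variable {G H E : T} {l l' : List ℤ}

lemma of_retract {E' : T} (r : Retract E' E) (h : Builds G l E) : Builds G l E' :=
  TowerSummand.of_retract r h

lemma refl (G : T) : Builds G [0] G :=
  (IsTower.single (G⟦(0 : ℤ)⟧)).summand.of_retract
    (Retract.ofIso ((shiftFunctorZero T ℤ).app G).symm)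

lemma exists_ne_zero (h : Builds G l E) {X : T} {f : X ⟶ E} (hf : f ≠ 0) :
    ∃ n ∈ l, ∃ g : X ⟶ G⟦n⟧, g ≠ 0 := by
  obtain ⟨Y, ⟨r⟩, hY⟩ := h
  obtain ⟨A, hA, g, hg⟩ := hY.exists_ne_zero (f := f ≫ r.i) fun h0 => hf (by
    rw [← Category.comp_id f, ← r.retract, ← Category.assoc, h0, zero_comp])
  obtain ⟨n, hn, rfl⟩ := List.mem_map.1 hA
  exact ⟨n, hn, g, hg⟩

variable [IsTriangulated T]

lemma ext {X Y Z : T} (hX : Builds G l X) (hZ : Builds G l' Z) {f : X ⟶ Y} {g : Y ⟶ Z}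
    {h : Z ⟶ X⟦(1 : ℤ)⟧} (hT : Triangle.mk f g h ∈ distTriang T) : Builds G (l' ++ l) Y := by
  have := TowerSummand.ext hX hZ hT
  rwa [← List.map_append] at this

lemma shift (h : Builds G l E) (k : ℤ) : Builds G (l.map (· + k)) (E⟦k⟧) := by
  obtain ⟨Y, ⟨r⟩, hY⟩ := h
  have h1 := (hY.shift k).summand.of_retract (r.map (shiftFunctor T k))
  rw [List.map_map] at h1
  have h2 := h1.congr (B := fun n : ℤ => G⟦n + k⟧) fun n => ((shiftFunctorAdd T n k).app G).symm
  rw [Builds, List.map_map]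
  exact h2

lemma map (F : T ⥤ T) [F.CommShift ℤ] [F.IsTriangulated] (h : Builds G l E) :
    Builds (F.obj G) l (F.obj E) := by
  obtain ⟨Y, ⟨r⟩, hY⟩ := h
  have h1 := (hY.map F).summand.of_retract (r.map F)
  rw [List.map_map] at h1
  exact h1.congr fun n => (F.commShiftIso n).app G

lemma trans (h : Builds G l E) (h' : Builds H l' G) :
    Builds H (l.flatMap fun n => l'.map (· + n)) E := by
  have := TowerSummand.flatMap (L := fun n : ℤ => (l'.map (· + n)).map fun m => H⟦m⟧)
    (fun n => h'.shift n) h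
  rwa [← List.map_flatMap] at this

end Builds

/-- Every object is built from shifts of a split-generator. -/
lemma IsSplitGenerator.exists_builds [IsTriangulated T] {G : T} (hG : IsSplitGenerator G) (E : T) :
    ∃ l, Builds G l E := by
  let Q : ObjectProperty T := fun E => ∃ l, Builds G l E
  have hQr : Q.IsStableUnderRetracts := ⟨fun r ⟨l, hl⟩ => ⟨l, hl.of_retract r⟩⟩
  have hQs : Q.IsStableUnderShift ℤ :=
    ⟨fun k => ⟨fun E ⟨l, hl⟩ => ⟨_, hl.shift k⟩⟩⟩
  have hQz : Q.ContainsZero := ⟨⟨_, isZero_zero T, [], (IsTower.nil (isZero_zero T)).summand⟩⟩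
  have hQe : Q.IsTriangulatedClosed₂ := .mk' fun t ht ⟨l, hl⟩ ⟨l', hl'⟩ => ⟨_, hl.ext hl' ht⟩
  have hQt : Q.IsTriangulated := {}
  have h1 : (ObjectProperty.singleton G).triangEnvelope ≤ Q := by
    rw [ObjectProperty.triangEnvelope_le_iff]
    rintro _ ⟨⟩
    exact ⟨_, .refl G⟩
  exact h1 E (by rw [show (ObjectProperty.singleton G).triangEnvelope = ⊤ from hG]; trivial)

lemma isSplitGenerator_of_builds [IsTriangulated T] {G : T} (h : ∀ E : T, ∃ l, Builds G l E) :
    IsSplitGenerator G := by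
  refine top_le_iff.1 fun E _ => ?_
  obtain ⟨l, Y, ⟨r⟩, hY⟩ := h E
  refine (ObjectProperty.singleton G).triangEnvelope.prop_of_retract r ?_
  generalize hL : l.map (fun n : ℤ => G⟦n⟧) = L at hY
  have hL' : ∀ A ∈ L, (ObjectProperty.singleton G).triangEnvelope A := by
    subst hL
    intro A hA
    obtain ⟨n, -, rfl⟩ := List.mem_map.1 hA
    exact (ObjectProperty.singleton G).triangEnvelope.le_shift n _
      ((ObjectProperty.singleton G).le_triangEnvelope _ ⟨()⟩)
  clear hL r
  induction hY with
  | nil h => exact ObjectProperty.prop_of_isZero _ h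
  | cons f g h ht _ ih =>
    exact ObjectProperty.ext_of_isTriangulatedClosed₂ _ _ ht
      (ih fun A hA => hL' A (List.mem_cons_of_mem _ hA))
      (hL' _ List.mem_cons_self)

end Towers

section

variable {T : Type u} [Category.{v} T] [Preadditive T] [HasShift T ℤ]

/-- Here the identity of `X` is itself a ghost, and so is any power of it; the ghost lemma then
forces `X = 0`. -/
lemma IsGhostComp.id_of_forall_eq_zero {G X : T} (h : ∀ (j : ℤ) (u : G⟦j⟧ ⟶ X), u = 0) (p : ℕ) :
    IsGhostComp G p (𝟙 X) := by
  induction p with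
  | zero => exact .base _
  | succ p ih =>
    rw [← Category.comp_id (𝟙 X)]
    exact .step ih fun j u => by rw [Category.comp_id, h j u]

end

/-! ### Approximation by ghosts -/

section Approximation

variable {T : Type u} [Category.{v} T] [Preadditive T] [HasZeroObject T]
    [HasShift T ℤ] [∀ n : ℤ, (shiftFunctor T n).Additive] [Pretriangulated T]

/-- The fiber of `f` is built from the shifts `G[n]`, `n ∈ l`. -/
def FiberBuilds (G : T) (l : List ℤ) {E E' : T} (f : E ⟶ E') : Prop :=
  ∃ (Y : T) (g : Y ⟶ E) (h : E' ⟶ Y⟦(1 : ℤ)⟧), Triangle.mk g f h ∈ distTriang T ∧ Builds G l Y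

lemma FiberBuilds.id (G E : T) : FiberBuilds G [] (𝟙 E) :=
  ⟨_, 0, 0, contractible_distinguished₁ E, (IsTower.nil (isZero_zero T)).summand⟩

lemma FiberBuilds.comp [IsTriangulated T] {G E E₁ E₂ : T} {l₁ l₂ : List ℤ} {f₁ : E ⟶ E₁}
    {f₂ : E₁ ⟶ E₂} (h₁ : FiberBuilds G l₁ f₁) (h₂ : FiberBuilds G l₂ f₂) :
    FiberBuilds G (l₂ ++ l₁) (f₁ ≫ f₂) := by
  obtain ⟨Y₁, g₁, k₁, ht₁, hY₁⟩ := h₁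
  obtain ⟨Y₂, g₂, k₂, ht₂, hY₂⟩ := h₂
  obtain ⟨W, g, k, ht⟩ := distinguished_cocone_triangle₁ (f₁ ≫ f₂)
  let o := Triangulated.someOctahedron' rfl ht₁ ht₂ ht
  exact ⟨W, g, k, ht, hY₁.ext hY₂ o.mem⟩

/-- The source of a zero morphism is a retract of its fiber. -/
lemma FiberBuilds.builds {G E E' : T} {l : List ℤ} {f : E ⟶ E'} (h : FiberBuilds G l f)
    (hf : f = 0) : Builds G l E := by
  obtain ⟨Y, g, k, ht, hY⟩ := h
  obtain ⟨i, hi⟩ := Triangle.coyoneda_exact₂ _ ht (𝟙 E) (by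
    change 𝟙 E ≫ f = 0
    rw [hf, comp_zero])
  exact hY.of_retract ⟨i, g, hi.symm⟩

/-- Finitely many morphisms `G[j] ⟶ E` are annihilated by a morphism whose fiber is built from their
sources. -/
lemma exists_fiberBuilds_comp_eq_zero [IsTriangulated T] (G E : T)
    (us : List (Σ j : ℤ, (G⟦j⟧ ⟶ E))) : ∃ (E' : T) (f : E ⟶ E'),
      FiberBuilds G (us.map Sigma.fst) f ∧ ∀ u ∈ us, u.2 ≫ f = 0 := by
  induction us with
  | nil => exact ⟨E, 𝟙 E, .id G E, by simp⟩
  | cons u us ih =>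
    obtain ⟨E₁, f₁, hf₁, h₁⟩ := ih
    obtain ⟨E₂, f₂, k, ht⟩ := distinguished_cocone_triangle (u.2 ≫ f₁)
    have hf₂ : FiberBuilds G [u.1] f₂ := ⟨_, _, _, ht, (IsTower.single _).summand⟩
    refine ⟨E₂, f₁ ≫ f₂, hf₁.comp hf₂, ?_⟩
    rintro w hw
    rcases List.mem_cons.1 hw with rfl | hw
    · rw [← Category.assoc]
      exact comp_distTriang_mor_zero₁₂ _ ht
    · rw [reassoc_of% h₁ w hw, zero_comp]

/-- Nonzero morphisms `G[j] ⟶ E` exist only for `a ≤ j ≤ b`. -/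
def HomBounded (G E : T) (a b : ℤ) : Prop := ∀ (j : ℤ) (u : G⟦j⟧ ⟶ E), u ≠ 0 → a ≤ j ∧ j ≤ b

/-- A morphism `G[j] → E'` that vanishes in `Y[1]` lifts to `E` and is killed by the ghost `f`. A
nonzero one therefore stays nonzero in `Y[1]`, hence maps nontrivially to some `G[n + 1]` with `n ∈
l`. -/
lemma FiberBuilds.homBounded [IsTriangulated T] {G E E' : T} {l : List ℤ} {f : E ⟶ E'}
    (h : FiberBuilds G l f) (hf : IsGhostFor G f) {K a b : ℤ}
    (hK : ∀ (i j : ℤ) (g : G⟦i⟧ ⟶ G⟦j⟧), g ≠ 0 → |i - j| ≤ K) (hl : ∀ n ∈ l, a ≤ n ∧ n ≤ b) :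
    HomBounded G E' (a + 1 - K) (b + 1 + K) := by
  intro j u hu
  obtain ⟨Y, g, k, ht, hY⟩ := h
  by_cases h0 : u ≫ k = 0
  · obtain ⟨w, hw⟩ := Triangle.coyoneda_exact₃ _ ht u h0
    exact absurd (hw.trans (hf j w)) hu
  · obtain ⟨n, hn, g, hg⟩ := (hY.shift 1).exists_ne_zero h0
    obtain ⟨m, hm, rfl⟩ := List.mem_map.1 hn
    have h1 := abs_le.1 (hK _ _ g hg)
    have h2 := hl m hm
    constructor <;> linarith

variable [Linear ℂ T] [IsTriangulated T]

/-- It suffices to kill finite spanning sets of the finitely many possibly nonzero spaces `Hom(G[j],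
E)`. -/
lemma HomBounded.exists_ghost {G E : T} [∀ X Y : T, Module.Finite ℂ (X ⟶ Y)] {a b : ℤ}
    (h : HomBounded G E a b) : ∃ (E' : T) (f : E ⟶ E') (l : List ℤ),
      FiberBuilds G l f ∧ IsGhostFor G f ∧ ∀ n ∈ l, a ≤ n ∧ n ≤ b := by
  choose B hB using fun j : ℤ => (Module.Finite.fg_top : (⊤ : Submodule ℂ (G⟦j⟧ ⟶ E)).FG)
  let us : List (Σ j : ℤ, (G⟦j⟧ ⟶ E)) :=
    (Finset.Icc a b).toList.flatMap fun j => (B j).toList.map fun u => ⟨j, u⟩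
  obtain ⟨E', f, hf, hu⟩ := exists_fiberBuilds_comp_eq_zero G E us
  refine ⟨E', f, _, hf, fun j u => ?_, fun n hn => ?_⟩
  · by_cases h0 : u = 0
    · rw [h0, zero_comp]
    have hj := h j u h0
    have h1 : ∀ w ∈ Submodule.span ℂ (B j : Set (G⟦j⟧ ⟶ E)), w ≫ f = 0 := by
      intro w hw
      induction hw using Submodule.span_induction with
      | mem w hw =>
        exact hu ⟨j, w⟩ (List.mem_flatMap.2 ⟨j, by simpa using hj,
          List.mem_map.2 ⟨w, by simpa using hw, rfl⟩⟩)
      | zero => exact zero_comp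
      | add x y _ _ hx hy => rw [Preadditive.add_comp, hx, hy, add_zero]
      | smul c x _ hx => rw [Linear.smul_comp, hx, smul_zero]
    exact h1 u (by rw [hB]; trivial)
  · obtain ⟨w, hw, rfl⟩ := List.mem_map.1 hn
    obtain ⟨j, hj, hw⟩ := List.mem_flatMap.1 hw
    obtain ⟨u, -, rfl⟩ := List.mem_map.1 hw
    simpa using hj

/-- Objects with bounded cohomology with respect to `G` are built from `G` in a bounded range. -/
theorem HomBounded.exists_builds {G : T} [∀ X Y : T, Module.Finite ℂ (X ⟶ Y)] {p : ℕ}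
    (hp : ∀ {X Y : T} {f : X ⟶ Y}, IsGhostComp G p f → f = 0) {K : ℤ} (hK0 : 0 ≤ K)
    (hK : ∀ (i j : ℤ) (g : G⟦i⟧ ⟶ G⟦j⟧), g ≠ 0 → |i - j| ≤ K) {E : T} {a b : ℤ}
    (h : HomBounded G E a b) : ∃ l, Builds G l E ∧ ∀ n ∈ l, n ≤ b + p * (1 + K) := by
  -- Each ghost raises the upper bound by `1 + K`. The lower bound `a'` only needs to exist, since
  -- for `t ≥ 0` large exponential sums come from large shifts.
  have key : ∀ k : ℕ, ∃ (E' : T) (f : E ⟶ E') (l : List ℤ) (a' : ℤ), FiberBuilds G l f ∧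
      IsGhostComp G k f ∧ HomBounded G E' a' (b + k * (1 + K)) ∧
      ∀ n ∈ l, n ≤ b + k * (1 + K) := by
    intro k
    induction k with
    | zero => exact ⟨E, 𝟙 E, [], a, .id G E, .base _, by simpa using h, by simp⟩
    | succ k ih =>
      obtain ⟨E₁, f₁, l₁, a₁, hf₁, hg₁, hb₁, hl₁⟩ := ih
      obtain ⟨E₂, f₂, l₂, hf₂, hg₂, hl₂⟩ := hb₁.exists_ghost
      have hb : b + (k + 1 : ℕ) * (1 + K) = b + k * (1 + K) + 1 + K := by
        push_cast
        ring
      refine ⟨E₂, f₁ ≫ f₂, l₂ ++ l₁, a₁ + 1 - K, hf₁.comp hf₂, .step hg₁ hg₂, ?_, ?_⟩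
      · rw [hb]
        exact hf₂.homBounded hg₂ hK hl₂
      · intro n hn
        rw [hb]
        rcases List.mem_append.1 hn with hn | hn
        · linarith [(hl₂ n hn).2]
        · linarith [hl₁ n hn]
  obtain ⟨E', f, l, -, hf, hg, -, hl⟩ := key p
  exact ⟨l, hf.builds (hp hg), hl⟩

end Approximation

/-! ### Exponential sums and complexity -/

section Complexity

/-- The exponential sum of a list of integers. -/
def expSum (t : ℝ) (l : List ℤ) : ℝ := (l.map fun n : ℤ => Real.exp (n * t)).sum

lemma expSum_nonneg (t : ℝ) (l : List ℤ) : 0 ≤ expSum t l :=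
  List.sum_nonneg fun x hx => by
    obtain ⟨n, -, rfl⟩ := List.mem_map.1 hx
    exact (Real.exp_pos _).le

lemma expSum_cons (t : ℝ) (n : ℤ) (l : List ℤ) :
    expSum t (n :: l) = Real.exp (n * t) + expSum t l := by
  simp [expSum]

lemma expSum_append (t : ℝ) (l l' : List ℤ) : expSum t (l ++ l') = expSum t l + expSum t l' := by
  simp [expSum]

lemma expSum_shift (t : ℝ) (l : List ℤ) (n : ℤ) :
    expSum t (l.map (· + n)) = Real.exp (n * t) * expSum t l := by
  induction l with
  | nil => simp [expSum]
  | cons m l ih =>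
    rw [List.map_cons, expSum_cons, expSum_cons, ih, mul_add, ← Real.exp_add]
    push_cast
    ring_nf

lemma expSum_flatMap (t : ℝ) (l l' : List ℤ) :
    expSum t (l.flatMap fun n => l'.map (· + n)) = expSum t l * expSum t l' := by
  induction l with
  | nil => simp [expSum]
  | cons m l ih => rw [List.flatMap_cons, expSum_append, expSum_cons, ih, expSum_shift, add_mul]

lemma exp_le_expSum (t : ℝ) {l : List ℤ} {n : ℤ} (hn : n ∈ l) : Real.exp (n * t) ≤ expSum t l := by
  refine List.single_le_sum (fun x hx => ?_) _ (List.mem_map.2 ⟨n, hn, rfl⟩)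
  obtain ⟨n, -, rfl⟩ := List.mem_map.1 hx
  exact (Real.exp_pos _).le

lemma expSum_le {t : ℝ} (ht : 0 ≤ t) {l : List ℤ} {b : ℝ} (h : ∀ n ∈ l, (n : ℝ) ≤ b) :
    expSum t l ≤ l.length * Real.exp (b * t) := by
  induction l with
  | nil => simp [expSum]
  | cons m l ih =>
    rw [expSum_cons, List.length_cons]
    have h1 := ih fun n hn => h n (List.mem_cons_of_mem _ hn)
    have h2 := Real.exp_le_exp.2 (mul_le_mul_of_nonneg_right (h m List.mem_cons_self) ht)
    push_cast
    linarith

variable {T : Type u} [Category.{v} T] [Preadditive T] [HasZeroObject T]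
    [HasShift T ℤ] [∀ n : ℤ, (shiftFunctor T n).Additive] [Pretriangulated T]

lemma complexity_le {t : ℝ} {G E : T} {l : List ℤ} (h : Builds G l E) :
    complexity t G E ≤ ENNReal.ofReal (expSum t l) := by
  obtain ⟨M, hM⟩ := TowerSummand.exists_biprod h
  exact sInf_le ⟨l, M, hM, rfl⟩

lemma le_complexity {t : ℝ} {G E : T} {x : ENNReal}
    (h : ∀ l, Builds G l E → x ≤ ENNReal.ofReal (expSum t l)) : x ≤ complexity t G E := by
  refine le_sInf ?_
  rintro _ ⟨l, M, hM, rfl⟩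
  exact h l ⟨_, ⟨⟨biprod.inl, biprod.fst, biprod.inl_fst⟩⟩, hM⟩

lemma exists_builds_of_complexity_lt {t : ℝ} {G E : T} {x : ENNReal} (h : complexity t G E < x) :
    ∃ l, Builds G l E ∧ ENNReal.ofReal (expSum t l) < x := by
  by_contra! h'
  exact absurd (le_complexity h') (not_le.2 h)

lemma complexity_ne_top [IsTriangulated T] {G : T} (hG : IsSplitGenerator G) (t : ℝ) (E : T) :
    complexity t G E ≠ ⊤ := by
  obtain ⟨l, hl⟩ := hG.exists_builds E
  exact ((complexity_le hl).trans_lt ENNReal.ofReal_lt_top).ne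

/-- Substituting towers over `G` for the factors of a tower over `H` multiplies the exponential
sums. Finiteness excludes the product `0 * ⊤`. -/
lemma complexity_le_mul [IsTriangulated T] (t : ℝ) (G H E : T) (h₁ : complexity t H E ≠ ⊤)
    (h₂ : complexity t G H ≠ ⊤) :
    complexity t G E ≤ complexity t H E * complexity t G H := by
  refine ENNReal.le_mul_of_forall_lt (Or.inr h₂) (Or.inl h₁) fun x hx y hy => ?_
  obtain ⟨l, hl, hl'⟩ := exists_builds_of_complexity_lt hx
  obtain ⟨m, hm, hm'⟩ := exists_builds_of_complexity_lt hy
  refine (complexity_le (hl.trans hm)).trans ?_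
  rw [expSum_flatMap, ENNReal.ofReal_mul (expSum_nonneg _ _)]
  exact mul_le_mul' hl'.le hm'.le

lemma complexity_map_le (F : T ⥤ T) [F.CommShift ℤ] [F.IsTriangulated] [IsTriangulated T] (t : ℝ)
    (G E : T) : complexity t (F.obj G) (F.obj E) ≤ complexity t G E :=
  le_complexity fun _ hl => complexity_le (hl.map F)

end Complexity

/-! ### Serre duality -/

section SerreFunctor

variable {T : Type u} [Category.{v} T] [Preadditive T] [Linear ℂ T]

namespace IsSerreFunctor

variable {S : T ⥤ T} (hS : IsSerreFunctor S)

include hS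

lemma exists_ne_zero_of_hom {X Y : T} {f : X ⟶ Y} (hf : f ≠ 0) : ∃ g : Y ⟶ S.obj X, g ≠ 0 := by
  obtain ⟨η, -⟩ := hS
  by_contra! h
  refine hf ((η X Y).map_eq_zero_iff.1 (LinearMap.ext fun g => ?_))
  rw [h g, map_zero, map_zero]

lemma exists_ne_zero_of_hom_obj {X Y : T} {g : Y ⟶ S.obj X} (hg : g ≠ 0) :
    ∃ f : X ⟶ Y, f ≠ 0 := by
  obtain ⟨η, -⟩ := hS
  by_contra! h
  refine hg ((Module.forall_dual_apply_eq_zero_iff ℂ g).1 fun φ => ?_)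
  have h1 : φ = 0 := by
    rw [← (η X Y).apply_symm_apply φ, h ((η X Y).symm φ), map_zero]
  rw [h1, LinearMap.zero_apply]

/-- Applying duality twice gives `Hom(X, Y) ≅ Hom(SX, SY)^** ≅ Hom(X, Y)^**`, whereas an
infinite-dimensional space has strictly smaller dimension than its dual. -/
lemma finite_hom [S.Additive] [S.Linear ℂ] [S.IsEquivalence] (X Y : T) :
    Module.Finite ℂ (X ⟶ Y) := by
  obtain ⟨η, -⟩ := hS
  let e : (X ⟶ Y) ≃ₗ[ℂ] (S.obj X ⟶ S.obj Y) :=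
    LinearEquiv.ofBijective (S.mapLinearMap ℂ)
      ((Functor.FullyFaithful.ofFullyFaithful S).map_bijective X Y)
  let d : (X ⟶ Y) ≃ₗ[ℂ] Module.Dual ℂ (Module.Dual ℂ (X ⟶ Y)) :=
    η X Y ≪≫ₗ (η Y (S.obj X) ≪≫ₗ e.dualMap).symm.dualMap
  rw [← Module.rank_lt_aleph0_iff]
  by_contra! h
  have h1 := lift_rank_lt_rank_dual h
  have h2 := lift_rank_lt_rank_dual (h.trans (by simpa using h1.le))
  rw [Cardinal.lift_uzero] at h1 h2
  exact absurd (h1.trans h2) (not_lt.2 d.rank_eq.ge)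

end IsSerreFunctor

end SerreFunctor

/-! ### Extension closures and phases -/

section ExtClosure

variable {T : Type u} [Category.{v} T] [Preadditive T] [HasZeroObject T]
    [HasShift T ℤ] [∀ n : ℤ, (shiftFunctor T n).Additive] [Pretriangulated T]

namespace ExtClosure

variable {P Q : ObjectProperty T}

lemma mono (h : ∀ E, P E → Q E) {E : T} (hE : ExtClosure P E) : ExtClosure Q E := by
  induction hE with
  | of hE => exact .of (h _ hE)
  | ext f g h ht _ _ h₁ h₂ => exact .ext f g h ht h₁ h₂

lemma map (F : T ⥤ T) [F.CommShift ℤ] [F.IsTriangulated]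
    (h : ∀ E, P E → ExtClosure Q (F.obj E)) {E : T} (hE : ExtClosure P E) :
    ExtClosure Q (F.obj E) := by
  induction hE with
  | of hE => exact h _ hE
  | ext f g h ht _ _ h₁ h₂ => exact .ext _ _ _ (F.map_distinguished _ ht) h₁ h₂

lemma shift (k : ℤ) (h : ∀ E, P E → Q (E⟦k⟧)) {E : T} (hE : ExtClosure P E) :
    ExtClosure Q (E⟦k⟧) := by
  induction hE with
  | of hE => exact .of (h _ hE)
  | ext f g h ht _ _ h₁ h₂ => exact .ext _ _ _ (Triangle.shift_distinguished _ ht k) h₁ h₂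

lemma hom_eq_zero (h : ∀ X Y, P X → Q Y → ∀ f : X ⟶ Y, f = 0) {X Y : T} (hX : ExtClosure P X)
    (hY : ExtClosure Q Y) (f : X ⟶ Y) : f = 0 := by
  have h1 : ∀ {X : T}, P X → ∀ f : X ⟶ Y, f = 0 := by
    clear hX f
    intro X hX
    induction hY with
    | of hY => exact h _ _ hX hY
    | ext f' g' h' ht _ _ h₁ h₂ =>
      intro f
      obtain ⟨k, hk⟩ := Triangle.coyoneda_exact₂ _ ht f (h₂ (f ≫ g'))
      rw [hk, h₁ k]
      exact zero_comp
  induction hX with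
  | of hX => exact h1 hX f
  | ext f' g' h' ht _ _ h₁ h₂ =>
    obtain ⟨k, hk⟩ := Triangle.yoneda_exact₂ _ ht f (h₁ (f' ≫ f))
    rw [hk, h₂ k]
    exact comp_zero

end ExtClosure

end ExtClosure

namespace StabilityCondition

variable {T : Type u} [Category.{v} T] [Preadditive T] [HasZeroObject T]
    [HasShift T ℤ] [∀ n : ℤ, (shiftFunctor T n).Additive] [Pretriangulated T]
    {Λ : Type*} [AddCommGroup Λ] {cl : K₀ T →+ Λ} {nrm : Seminorm ℝ (ℝ ⊗[ℤ] Λ)}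
    (σ : StabilityCondition cl nrm)

variable {σ}

lemma P.of_iso {φ : ℝ} {E E' : T} (h : σ.P φ E) (i : E ≅ E') : σ.P φ E' := by
  have := σ.iso_closed φ
  exact (σ.P φ).prop_of_iso i h

lemma P.shift_one {φ : ℝ} {E : T} (h : σ.P φ E) : σ.P (φ + 1) (E⟦(1 : ℤ)⟧) := by
  rw [σ.shift]
  exact ObjectProperty.prop_map_obj _ _ h

lemma P.of_shift_one {φ : ℝ} {E : T} (h : σ.P (φ + 1) (E⟦(1 : ℤ)⟧)) : σ.P φ E := by
  rw [σ.shift] at h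
  obtain ⟨E', hE', ⟨i⟩⟩ := h
  exact hE'.of_iso ((shiftFunctor T (1 : ℤ)).preimageIso i)

lemma P.shift {φ : ℝ} {E : T} (h : σ.P φ E) (k : ℤ) : σ.P (φ + k) (E⟦k⟧) := by
  induction k using Int.induction_on with
  | zero =>
    rw [Int.cast_zero, add_zero]
    exact h.of_iso ((shiftFunctorZero T ℤ).app E).symm
  | succ k ih =>
    have := ih.shift_one.of_iso ((shiftFunctorAdd T (k : ℤ) 1).app E).symm
    push_cast at this ⊢
    rwa [← add_assoc]
  | pred k ih =>
    refine P.of_shift_one ?_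
    have := ih.of_iso ((shiftFunctorAdd' T (-(k : ℤ) - 1) 1 (-k) (by ring)).app E)
    push_cast at this ⊢
    rwa [show φ + (-(k : ℝ) - 1) + 1 = φ + -k by ring]

lemma P.PI {φ : ℝ} {I : Set ℝ} {E : T} (h : σ.P φ E) (hφ : φ ∈ I) : σ.PI I E :=
  .of ⟨φ, hφ, h⟩

lemma PI.mono {I J : Set ℝ} {E : T} (h : σ.PI I E) (hIJ : I ⊆ J) : σ.PI J E :=
  ExtClosure.mono (fun _ ⟨φ, hφ, hE⟩ => ⟨φ, hIJ hφ, hE⟩) h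

lemma PI.shift {a b : ℝ} {E : T} (h : σ.PI (Set.Icc a b) E) (k : ℤ) :
    σ.PI (Set.Icc (a + k) (b + k)) (E⟦k⟧) :=
  ExtClosure.shift k (fun _ ⟨φ, hφ, hE⟩ => ⟨φ + k, ⟨by linarith [hφ.1], by linarith [hφ.2]⟩,
    hE.shift k⟩) h

lemma PI.hom_eq_zero {I J : Set ℝ} (hIJ : ∀ φ ∈ I, ∀ ψ ∈ J, ψ < φ) {X Y : T} (hX : σ.PI I X)
    (hY : σ.PI J Y) (f : X ⟶ Y) : f = 0 :=
  ExtClosure.hom_eq_zero (fun X Y ⟨φ, hφ, hX⟩ ⟨ψ, hψ, hY⟩ f =>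
    σ.hom_zero _ _ (hIJ φ hφ ψ hψ) X Y hX hY f) hX hY f

lemma PI.le_of_ne_zero {a b a' b' : ℝ} {X Y : T} (hX : σ.PI (Set.Icc a b) X)
    (hY : σ.PI (Set.Icc a' b') Y) {f : X ⟶ Y} (hf : f ≠ 0) : a ≤ b' := by
  by_contra! h
  exact hf (PI.hom_eq_zero (fun φ hφ ψ hψ => (hψ.2.trans_lt h).trans_le hφ.1) hX hY f)

lemma PI.of_isTower {I : Set ℝ} (hI : I.Nonempty) {l : List (ℝ × T)} {E : T}
    (h : IsTower (l.map Prod.snd) E) (hl : ∀ x ∈ l, x.1 ∈ I ∧ σ.P x.1 x.2) : σ.PI I E := by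
  induction l generalizing E with
  | nil =>
    cases h with
    | nil h =>
      obtain ⟨φ, hφ⟩ := hI
      exact .of ⟨φ, hφ, σ.zero_mem φ E h⟩
  | cons x l ih =>
    cases h with
    | cons f g h ht h' =>
      exact .ext f g h ht (ih h' fun y hy => hl y (List.mem_cons_of_mem _ hy))
        (.of ⟨_, hl x List.mem_cons_self⟩)

variable (σ)

lemma exists_isTower (E : T) : ∃ l : List (ℝ × T), (l.map Prod.fst).Pairwise (· < ·) ∧
    (∀ x ∈ l, σ.P x.1 x.2) ∧ IsTower (l.map Prod.snd) E := by
  by_cases h : IsZero E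
  · exact ⟨[], by simp, by simp, .nil h⟩
  · exact σ.hn E h

lemma exists_PI_Icc (E : T) : ∃ a b, σ.PI (Set.Icc a b) E := by
  obtain ⟨l, -, hl, ht⟩ := σ.exists_isTower E
  have h : ∃ C : ℝ, 0 ≤ C ∧ ∀ x ∈ l, |x.1| ≤ C := by
    clear hl ht
    induction l with
    | nil => exact ⟨0, le_rfl, by simp⟩
    | cons y l ih =>
      obtain ⟨C, h0, hC⟩ := ih
      refine ⟨max C |y.1|, le_max_of_le_left h0, fun x hx => ?_⟩
      rcases List.mem_cons.1 hx with rfl | hx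
      · exact le_max_right _ _
      · exact (hC x hx).trans (le_max_left _ _)
  obtain ⟨C, h0, hC⟩ := h
  exact ⟨-C, C, PI.of_isTower ⟨0, by simpa using h0⟩ ht fun x hx => ⟨abs_le.1 (hC x hx), hl x hx⟩⟩

/-- An object without nonzero morphisms from semistable objects of phase greater than `b` lies in
`P((-∞, b])`. -/
lemma PI_Iic_of_forall {b : ℝ} {E : T}
    (h : ∀ ψ, b < ψ → ∀ X, σ.P ψ X → ∀ f : X ⟶ E, f = 0) : σ.PI (Set.Iic b) E := by
  obtain ⟨l, hl, hP, ht⟩ := σ.exists_isTower E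
  induction l generalizing E with
  | nil => exact PI.of_isTower ⟨b, Set.mem_Iic.2 le_rfl⟩ ht (by simp)
  | cons x l ih =>
    rw [List.map_cons, List.pairwise_cons] at hl
    -- The head of the list is the last Harder–Narasimhan factor, of smallest phase. If that phase
    -- is at most `b`, the previous stage inherits the hypothesis: a morphism to it that dies in `E`
    -- comes from the factor shifted by `-1`, whose phase is still smaller.
    by_cases hx : x.1 ≤ b
    · cases ht with
      | cons f g k ht ht' =>
        refine .ext f g k ht (ih ?_ hl.2 (fun y hy => hP y (List.mem_cons_of_mem _ hy)) ht')
          (.of ⟨_, hx, hP x List.mem_cons_self⟩)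
        intro ψ hψ X hX u
        obtain ⟨w, hw⟩ := Triangle.coyoneda_exact₂ _ (inv_rot_of_distTriang _ ht) u
          (h ψ hψ X hX (u ≫ f))
        have : w = 0 := σ.hom_zero ψ (x.1 + (-1 : ℤ)) (by push_cast; linarith) _ _ hX
          ((hP x List.mem_cons_self).shift (-1)) w
        rw [hw, this]
        exact zero_comp
    -- Otherwise all phases exceed `b`, and the hypothesis makes the identity of `E` zero.
    · have h1 : σ.PI (Set.Ioi b) E := PI.of_isTower ⟨b + 1, by simp⟩ ht fun y hy => by
        refine ⟨?_, hP y hy⟩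
        rcases List.mem_cons.1 hy with rfl | hy
        · exact not_le.1 hx
        · exact (not_le.1 hx).trans (hl.1 _ (List.mem_map_of_mem hy))
      have h2 : 𝟙 E = 0 := by
        refine ExtClosure.hom_eq_zero (P := fun E => ∃ φ ∈ Set.Ioi b, σ.P φ E) (Q := fun Y => Y = E)
          ?_ h1 (.of rfl) (𝟙 E)
        rintro X Y ⟨ψ, hψ, hX⟩ rfl f
        exact h ψ hψ X hX f
      exact .of ⟨b, Set.mem_Iic.2 le_rfl, σ.zero_mem b E ((IsZero.iff_id_eq_zero E).2 h2)⟩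

end StabilityCondition

section Iterate

variable {T : Type u} [Category.{v} T] [Preadditive T]

lemma not_isZero_iterate (S : T ⥤ T) [S.PreservesZeroMorphisms] [S.Faithful] {G : T}
    (hG : ¬ IsZero G) (n : ℕ) : ¬ IsZero (S.obj^[n] G) := by
  induction n with
  | zero => exact hG
  | succ n ih =>
    rw [Function.iterate_succ_apply']
    intro h
    refine ih ((IsZero.iff_id_eq_zero _).2 (S.map_injective ?_))
    exact h.eq_of_src _ _

variable [HasZeroObject T] [HasShift T ℤ] [∀ n : ℤ, (shiftFunctor T n).Additive]
    [Pretriangulated T]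

lemma complexity_iterate_le [IsTriangulated T] (S : T ⥤ T) [S.CommShift ℤ] [S.IsTriangulated]
    (t : ℝ) (G E : T) (n : ℕ) :
    complexity t (S.obj^[n] G) (S.obj^[n] E) ≤ complexity t G E := by
  induction n with
  | zero => exact le_rfl
  | succ n ih =>
    rw [Function.iterate_succ_apply', Function.iterate_succ_apply']
    exact (complexity_map_le S t _ _).trans ih

end Iterate

/-! ### Phases under iterates of the Serre functor -/

namespace StabilityCondition

variable {T : Type u} [Category.{v} T] [Preadditive T] [Linear ℂ T] [HasZeroObject T]
    [HasShift T ℤ] [∀ n : ℤ, (shiftFunctor T n).Additive] [Pretriangulated T]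
    {Λ : Type*} [AddCommGroup Λ] {cl : K₀ T →+ Λ} {nrm : Seminorm ℝ (ℝ ⊗[ℤ] Λ)}
    {σ : StabilityCondition cl nrm}

/-- The functor `S` changes the phases of semistable objects by `s`, up to an error `ε`. -/
def ShiftsPhases (σ : StabilityCondition cl nrm) (S : T ⥤ T) (s ε : ℝ) : Prop :=
  ∀ (φ : ℝ) (E : T), σ.P φ E → σ.PI (Set.Icc (φ + s - ε) (φ + s + ε)) (S.obj E)

variable {S : T ⥤ T} {s ε : ℝ}

section

variable [S.CommShift ℤ] [S.IsTriangulated]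

omit [Linear ℂ T] in
lemma ShiftsPhases.PI_obj (h : σ.ShiftsPhases S s ε) {a b : ℝ} {E : T}
    (hE : σ.PI (Set.Icc a b) E) : σ.PI (Set.Icc (a + (s - ε)) (b + (s + ε))) (S.obj E) :=
  ExtClosure.map S (fun E ⟨φ, hφ, hE⟩ => PI.mono (h φ E hE)
    (Set.Icc_subset_Icc (by linarith [hφ.1]) (by linarith [hφ.2]))) hE

omit [Linear ℂ T] in
lemma ShiftsPhases.PI_iterate (h : σ.ShiftsPhases S s ε) {a b : ℝ} {E : T}
    (hE : σ.PI (Set.Icc a b) E) (n : ℕ) :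
    σ.PI (Set.Icc (a + n * (s - ε)) (b + n * (s + ε))) (S.obj^[n] E) := by
  induction n with
  | zero => simpa using hE
  | succ n ih =>
    rw [Function.iterate_succ_apply']
    convert h.PI_obj ih using 2 <;> push_cast <;> ring

/-- One inequality compares phases along `u`, the other along a dual nonzero morphism `E → S(G[j])`.
-/
lemma ShiftsPhases.bounds (hS : IsSerreFunctor S) (h : σ.ShiftsPhases S s ε) {a b a' b' : ℝ}
    {G E : T} (hG : σ.PI (Set.Icc a b) G) (hE : σ.PI (Set.Icc a' b') E) {j : ℤ} {u : G⟦j⟧ ⟶ E}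
    (hu : u ≠ 0) : a' ≤ b + j + (s + ε) ∧ (a + j : ℝ) ≤ b' := by
  refine ⟨?_, PI.le_of_ne_zero (PI.shift hG j) hE hu⟩
  obtain ⟨g, hg⟩ := hS.exists_ne_zero_of_hom hu
  exact PI.le_of_ne_zero hE (h.PI_obj (PI.shift hG j)) hg

/-- The integers `j` with `Hom(G[j], Sⁿ G) ≠ 0` are close to `n s`. -/
lemma ShiftsPhases.exists_bounds (hS : IsSerreFunctor S) (h : σ.ShiftsPhases S s ε) (G : T) :
    ∃ c : ℝ, ∀ (n : ℕ) (j : ℤ) (u : G⟦j⟧ ⟶ S.obj^[n] G), u ≠ 0 →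
      n * (s - ε) - c ≤ j ∧ j ≤ n * (s + ε) + c := by
  obtain ⟨a, b, hG⟩ := σ.exists_PI_Icc G
  refine ⟨|b - a| + |s + ε|, fun n j u hu => ?_⟩
  obtain ⟨h1, h2⟩ := h.bounds hS hG (h.PI_iterate hG n) hu
  have h3 := le_abs_self (b - a)
  have h4 := le_abs_self (s + ε)
  have h5 := abs_nonneg (s + ε)
  constructor <;> linarith

lemma ShiftsPhases.exists_abs_sub_le (hS : IsSerreFunctor S) (h : σ.ShiftsPhases S s ε) (G : T) :
    ∃ K : ℤ, 0 ≤ K ∧ ∀ (i j : ℤ) (g : G⟦i⟧ ⟶ G⟦j⟧), g ≠ 0 → |i - j| ≤ K := by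
  obtain ⟨a, b, hG⟩ := σ.exists_PI_Icc G
  refine ⟨⌈|b - a| + |s + ε|⌉, Int.ceil_nonneg (by positivity), fun i j g hg => ?_⟩
  obtain ⟨h1, h2⟩ := h.bounds hS hG (PI.shift hG j) hg
  have h3 := le_abs_self (b - a)
  have h4 := le_abs_self (s + ε)
  have h5 := abs_nonneg (s + ε)
  have h6 : ((|i - j| : ℤ) : ℝ) ≤ |b - a| + |s + ε| := by
    push_cast
    rw [abs_le]
    constructor <;> linarith
  exact_mod_cast h6.trans (Int.le_ceil _)

lemma ShiftsPhases.exists_homBounded (hS : IsSerreFunctor S) (h : σ.ShiftsPhases S s ε) (G E : T) :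
    ∃ a b : ℤ, HomBounded G E a b := by
  obtain ⟨a, b, hG⟩ := σ.exists_PI_Icc G
  obtain ⟨a', b', hE⟩ := σ.exists_PI_Icc E
  refine ⟨⌊a' - b - (s + ε)⌋, ⌈b' - a⌉, fun j u hu => ?_⟩
  obtain ⟨h1, h2⟩ := h.bounds hS hG hE hu
  constructor
  · have : (⌊a' - b - (s + ε)⌋ : ℝ) ≤ j := (Int.floor_le _).trans (by linarith)
    exact_mod_cast this
  · have : (j : ℝ) ≤ ⌈b' - a⌉ := le_trans (by linarith) (Int.le_ceil _)
    exact_mod_cast this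

end

omit [Linear ℂ T] in
lemma sub_le_gldim {φ₁ φ₂ : ℝ} {E₁ E₂ : T} (h₁ : σ.P φ₁ E₁) (h₂ : σ.P φ₂ E₂) {f : E₁ ⟶ E₂}
    (hf : f ≠ 0) : ((φ₂ - φ₁ : ℝ) : EReal) ≤ σ.gldim :=
  le_sSup ⟨φ₁, φ₂, E₁, E₂, h₁, h₂, ⟨f, hf⟩, rfl⟩

/-- A nonzero `E₁ → E₂` has a nonzero dual `E₂ → S E₁`, and the phases of `S E₁` are at most `φ₁ + s
+ ε`. -/
lemma ShiftsPhases.gldim_le (hS : IsSerreFunctor S) (h : σ.ShiftsPhases S s ε) :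
    σ.gldim ≤ ((s + ε : ℝ) : EReal) := by
  refine sSup_le ?_
  rintro _ ⟨φ₁, φ₂, E₁, E₂, h₁, h₂, ⟨f, hf⟩, rfl⟩
  obtain ⟨g, hg⟩ := hS.exists_ne_zero_of_hom hf
  have := PI.le_of_ne_zero (P.PI h₂ ⟨le_rfl, le_rfl⟩) (h _ _ h₁) hg
  exact_mod_cast (by linarith : φ₂ - φ₁ ≤ s + ε)

omit [Linear ℂ T] in
lemma exists_semistable (σ : StabilityCondition cl nrm) {E : T} (hE : ¬ IsZero E) :
    ∃ φ X, σ.P φ X ∧ ¬ IsZero X := by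
  obtain ⟨l, -, hP, ht⟩ := σ.hn E hE
  have hid : 𝟙 E ≠ 0 := fun h => hE ((IsZero.iff_id_eq_zero E).2 h)
  obtain ⟨A, hA, g, hg⟩ := ht.exists_ne_zero hid
  obtain ⟨x, hx, rfl⟩ := List.mem_map.1 hA
  exact ⟨x.1, x.2, hP x hx, fun h => hg (h.eq_of_tgt _ _)⟩

omit [Linear ℂ T] in
lemma gldim_nonneg (σ : StabilityCondition cl nrm) {E : T} (hE : ¬ IsZero E) : 0 ≤ σ.gldim := by
  obtain ⟨φ, X, hX, h⟩ := σ.exists_semistable hE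
  have := sub_le_gldim hX hX (f := 𝟙 X) fun h' => h ((IsZero.iff_id_eq_zero X).2 h')
  simpa using this

/-- The Serre functor raises the upper bound of the phases at most by the global dimension. -/
lemma PI_Iic_obj_of_gldim_le (hS : IsSerreFunctor S) {g : ℝ} (hg : σ.gldim ≤ (g : EReal)) {b : ℝ}
    {E : T} (hE : σ.PI (Set.Iic b) E) : σ.PI (Set.Iic (b + g)) (S.obj E) := by
  refine σ.PI_Iic_of_forall fun ψ hψ X hX f => ?_
  by_contra hf
  obtain ⟨u, hu⟩ := hS.exists_ne_zero_of_hom_obj hf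
  refine hu (ExtClosure.hom_eq_zero (P := fun E => ∃ φ ∈ Set.Iic b, σ.P φ E) (Q := σ.P ψ) ?_ hE
    (.of hX) u)
  rintro Y Z ⟨φ, hφ, hY⟩ hZ v
  by_contra hv
  have h1 := (sub_le_gldim hY hZ hv).trans hg
  have h2 : ψ - φ ≤ g := by exact_mod_cast h1
  linarith [Set.mem_Iic.1 hφ]

lemma PI_Iic_iterate_of_gldim_le (hS : IsSerreFunctor S) {g : ℝ} (hg : σ.gldim ≤ (g : EReal))
    {b : ℝ} {E : T} (hE : σ.PI (Set.Iic b) E) (n : ℕ) :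
    σ.PI (Set.Iic (b + n * g)) (S.obj^[n] E) := by
  induction n with
  | zero => simpa using hE
  | succ n ih =>
    rw [Function.iterate_succ_apply']
    convert PI_Iic_obj_of_gldim_le hS hg ih using 2
    push_cast
    ring

/-- An upper bound for the integers `j` with `Hom(G[j], Sⁿ G) ≠ 0` by the global dimension. -/
lemma exists_le_of_gldim_le (hS : IsSerreFunctor S) {g : ℝ} (hg : σ.gldim ≤ (g : EReal)) (G : T) :
    ∃ c : ℝ, ∀ (n : ℕ) (j : ℤ) (u : G⟦j⟧ ⟶ S.obj^[n] G), u ≠ 0 → j ≤ n * g + c := by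
  obtain ⟨a, b, hG⟩ := σ.exists_PI_Icc G
  refine ⟨b - a, fun n j u hu => ?_⟩
  by_contra! h
  refine hu (PI.hom_eq_zero (fun φ hφ ψ hψ => ?_) (PI.shift hG j)
    (PI_Iic_iterate_of_gldim_le hS hg (PI.mono hG fun x hx => hx.2) n) u)
  linarith [hφ.1, Set.mem_Iic.1 hψ]

end StabilityCondition

/-! ### Growth of families of subadditive sequences -/

section Asymptotics

/-- A family of subadditive sequences `u t n` which for large `t` grows like `n s t`. -/
lemma exists_tendsto_div_of_subadditive {u : ℝ → ℕ → ℝ} {s : ℝ} (hu : ∀ t, Subadditive (u t))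
    (hl : ∀ ε : ℝ, 0 < ε → ε < 1 → ∃ c : ℝ, ∀ (t : ℝ) (n : ℕ), ∃ m : ℝ,
      n * (s - ε) - c ≤ m ∧ m ≤ n * (s + ε) + c ∧ m * t ≤ u t n)
    (hr : ∀ ε : ℝ, 0 < ε → ε < 1 → ∃ c : ℝ, ∀ n : ℕ, ∃ L : ℝ, ∀ t : ℝ, 0 ≤ t →
      u t n ≤ L + (n * (s + ε) + c) * t) :
    ∃ h : ℝ → ℝ, (∀ t, Tendsto (fun n : ℕ => u t n / n) atTop (𝓝 (h t))) ∧
      Tendsto (fun t => h t / t) atTop (𝓝 s) := by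
  -- Fekete's lemma is needed for every real `t`; for negative `t` the upper bound on `m` enters.
  -- The term `n = 0` is `0` by the convention for division by zero.
  have hb : ∀ t, BddBelow (Set.range fun n : ℕ => u t n / n) := by
    intro t
    obtain ⟨c, hc⟩ := hl (1 / 2) (by norm_num) (by norm_num)
    refine ⟨-((|s| + 1 + |c|) * |t|), ?_⟩
    rintro _ ⟨n, rfl⟩
    rcases Nat.eq_zero_or_pos n with rfl | hn
    · simp only [Nat.cast_zero, div_zero, Left.neg_nonpos_iff]
      positivity
    · have hn' : (1 : ℝ) ≤ n := by exact_mod_cast hn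
      obtain ⟨m, h1, h2, h3⟩ := hc t n
      have h4 : |m| ≤ (|s| + 1 + |c|) * n := by
        have h5 := mul_le_mul_of_nonneg_left (le_abs_self s) (by linarith : (0 : ℝ) ≤ n)
        have h6 := mul_le_mul_of_nonneg_left (neg_abs_le s) (by linarith : (0 : ℝ) ≤ n)
        have h7 := mul_le_mul_of_nonneg_left hn' (abs_nonneg c)
        have h8 := le_abs_self c
        rw [abs_le]
        constructor <;> linarith
      have h5 : -(|m| * |t|) ≤ m * t := by
        rw [← abs_mul]
        exact neg_abs_le _
      have h6 := mul_le_mul_of_nonneg_right h4 (abs_nonneg t)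
      change _ ≤ u t n / n
      rw [le_div_iff₀ (by linarith)]
      linarith
  refine ⟨fun t => (hu t).lim, fun t => (hu t).tendsto_lim (hb t), ?_⟩
  have hlow : ∀ ε : ℝ, 0 < ε → ε < 1 → ∀ t, 0 ≤ t → (s - ε) * t ≤ (hu t).lim := by
    intro ε h0 h1 t ht
    obtain ⟨c, hc⟩ := hl ε h0 h1
    have h2 : Tendsto (fun n : ℕ => (s - ε) * t - c * t / n) atTop (𝓝 ((s - ε) * t - 0)) :=
      tendsto_const_nhds.sub (tendsto_const_div_atTop_nhds_zero_nat (c * t))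
    rw [sub_zero] at h2
    refine le_of_tendsto_of_tendsto h2 ((hu t).tendsto_lim (hb t)) ?_
    filter_upwards [eventually_gt_atTop 0] with n hn
    have hn' : (0 : ℝ) < n := by exact_mod_cast hn
    obtain ⟨m, h3, -, h4⟩ := hc t n
    rw [le_div_iff₀ hn', sub_mul, div_mul_cancel₀ _ hn'.ne']
    have := mul_le_mul_of_nonneg_right h3 ht
    linarith
  rw [Metric.tendsto_atTop]
  intro η hη
  obtain ⟨ε, h0, h1, hε⟩ : ∃ ε : ℝ, 0 < ε ∧ ε < 1 ∧ 3 * ε < η :=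
    ⟨min (η / 4) (1 / 2), by positivity, (min_le_right _ _).trans_lt (by norm_num), by
      linarith [min_le_left (η / 4) (1 / 2)]⟩
  obtain ⟨c, hc⟩ := hr ε h0 h1
  -- The limit is at most `u t N / N` for a single `N`. Taking `N` large gives `c ≤ εN`, and then
  -- `t` large gives `L ≤ εNt`; with the original `ε` the total error is `3ε`.
  obtain ⟨N, hN⟩ := exists_nat_gt (max (|c| / ε) 0)
  have hN0 : (0 : ℝ) < N := (le_max_right _ _).trans_lt hN
  have hcN : c ≤ ε * N := by
    have := (div_lt_iff₀ h0).1 ((le_max_left _ _).trans_lt hN)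
    linarith [le_abs_self c]
  obtain ⟨L, hL⟩ := hc N
  refine ⟨max 1 (|L| / (ε * N)), fun t ht => ?_⟩
  have ht1 : 0 < t := zero_lt_one.trans_le ((le_max_left _ _).trans ht)
  have ht2 : L ≤ ε * N * t := by
    have := (div_le_iff₀ (by positivity)).1 ((le_max_right _ _).trans ht)
    linarith [le_abs_self L]
  have h2 : (hu t).lim ≤ (s + 3 * ε) * t := by
    refine ((hu t).lim_le_div (hb t) (by exact_mod_cast hN0.ne')).trans ?_
    rw [div_le_iff₀ hN0]
    have h3 := hL t ht1.le
    have h4 := mul_le_mul_of_nonneg_right hcN ht1.le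
    linarith
  have h3 := hlow ε h0 h1 t ht1.le
  rw [Real.dist_eq, abs_lt]
  have h4 : (hu t).lim / t ≤ s + 3 * ε := (div_le_iff₀ ht1).2 h2
  have h5 : s - ε ≤ (hu t).lim / t := (le_div_iff₀ ht1).2 h3
  constructor <;> linarith

end Asymptotics

/-! ### Existence of the entropy and independence of the generator -/

section Entropy

variable {T : Type u} [Category.{v} T] [Preadditive T] [HasZeroObject T]
    [HasShift T ℤ] [∀ n : ℤ, (shiftFunctor T n).Additive] [Pretriangulated T] [IsTriangulated T]
    {S : T ⥤ T} [S.CommShift ℤ] [S.IsTriangulated]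

/-- Pass through `Sᵐ G`; applying `Sᵐ` to towers bounds the complexity of `Sᵐ⁺ⁿ G` over `Sᵐ G` by
that of `Sⁿ G` over `G`. -/
lemma complexity_iterate_add_le {G : T} (hG : IsSplitGenerator G) (t : ℝ) (m n : ℕ) :
    complexity t G (S.obj^[m + n] G) ≤
      complexity t G (S.obj^[m] G) * complexity t G (S.obj^[n] G) := by
  have h1 : complexity t (S.obj^[m] G) (S.obj^[m + n] G) ≤ complexity t G (S.obj^[n] G) := by
    rw [Function.iterate_add_apply]
    exact complexity_iterate_le S t _ _ m
  refine (complexity_le_mul t G (S.obj^[m] G) _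
    (h1.trans_lt (complexity_ne_top hG t _).lt_top).ne (complexity_ne_top hG t _)).trans ?_
  rw [mul_comm]
  exact mul_le_mul_right h1 _

lemma complexity_iterate_le_mul {G H : T} (hG : IsSplitGenerator G) (hH : IsSplitGenerator H)
    (t : ℝ) (n : ℕ) : complexity t H (S.obj^[n] H) ≤
      complexity t G H * complexity t H G * complexity t G (S.obj^[n] G) := by
  have h1 := complexity_iterate_le S t G H n
  have h2 : complexity t G (S.obj^[n] H) ≤ complexity t G H * complexity t G (S.obj^[n] G) :=
    (complexity_le_mul t G (S.obj^[n] G) _ (h1.trans_lt (complexity_ne_top hG t _).lt_top).ne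
      (complexity_ne_top hG t _)).trans (mul_le_mul_left h1 _)
  refine (complexity_le_mul t H G _ (complexity_ne_top hG t _) (complexity_ne_top hH t _)).trans ?_
  rw [mul_right_comm]
  exact mul_le_mul_left h2 _

/-- The logarithm of the complexity of `Sⁿ G` with respect to `G`. -/
def logComplexity (S : T ⥤ T) (G : T) (t : ℝ) (n : ℕ) : ℝ :=
  Real.log (complexity t G (S.obj^[n] G)).toReal

/-- The logarithmic complexities for two generators differ by at most a constant independent of `n`,
which disappears after division by `n`. -/
lemma hasEntropy_of_tendsto {G : T} (hG : IsSplitGenerator G)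
    (h0 : ∀ t n, complexity t G (S.obj^[n] G) ≠ 0) {h : ℝ → ℝ}
    (hh : ∀ t, Tendsto (fun n : ℕ => logComplexity S G t n / n) atTop (𝓝 (h t))) :
    HasEntropy S fun t => (h t : EReal) := by
  refine ⟨⟨G, hG⟩, fun H hH t => ?_⟩
  set C : ENNReal := complexity t G H * complexity t H G with hC
  have hCtop : C ≠ ⊤ := ENNReal.mul_ne_top (complexity_ne_top hG t _) (complexity_ne_top hH t _)
  have hGH : ∀ n, complexity t G (S.obj^[n] G) ≤ C * complexity t H (S.obj^[n] H) := fun n => by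
    rw [hC, mul_comm (complexity t G H)]
    exact complexity_iterate_le_mul hH hG t n
  have hHG : ∀ n, complexity t H (S.obj^[n] H) ≤ C * complexity t G (S.obj^[n] G) :=
    complexity_iterate_le_mul hG hH t
  have hH0 : ∀ n, complexity t H (S.obj^[n] H) ≠ 0 := fun n h' =>
    h0 t n (nonpos_iff_eq_zero.1 (by simpa [h'] using hGH n))
  have hC0 : C ≠ 0 := fun h' => h0 t 0 (nonpos_iff_eq_zero.1 (by simpa [h'] using hGH 0))
  have hpos : ∀ {x : ENNReal}, x ≠ 0 → x ≠ ⊤ → 0 < x.toReal := fun h h' => ENNReal.toReal_pos h h'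
  have hlog : ∀ {x y : ENNReal}, x ≠ 0 → x ≠ ⊤ → y ≠ 0 → y ≠ ⊤ → x ≤ C * y →
      Real.log x.toReal ≤ Real.log C.toReal + Real.log y.toReal := by
    intro x y hx hx' hy hy' hxy
    rw [← Real.log_mul (hpos hC0 hCtop).ne' (hpos hy hy').ne', ← ENNReal.toReal_mul]
    exact Real.log_le_log (hpos hx hx') (ENNReal.toReal_mono (ENNReal.mul_ne_top hCtop hy') hxy)
  have h1 : ∀ n, logComplexity S G t n ≤ Real.log C.toReal + logComplexity S H t n := fun n =>
    hlog (h0 t n) (complexity_ne_top hG t _) (hH0 n) (complexity_ne_top hH t _) (hGH n)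
  have h2 : ∀ n, logComplexity S H t n ≤ Real.log C.toReal + logComplexity S G t n := fun n =>
    hlog (hH0 n) (complexity_ne_top hH t _) (h0 t n) (complexity_ne_top hG t _) (hHG n)
  have h3 : Tendsto (fun n : ℕ => Real.log C.toReal / n) atTop (𝓝 0) :=
    tendsto_const_div_atTop_nhds_zero_nat _
  have h4 : Tendsto (fun n : ℕ => logComplexity S H t n / n) atTop (𝓝 (h t)) := by
    refine tendsto_of_tendsto_of_tendsto_of_le_of_le (g := fun n : ℕ =>
      logComplexity S G t n / n - Real.log C.toReal / n) (h := fun n : ℕ =>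
      logComplexity S G t n / n + Real.log C.toReal / n) (by simpa using (hh t).sub h3)
      (by simpa using (hh t).add h3) (fun n => ?_) (fun n => ?_)
    · change _ - _ ≤ _
      rw [← sub_div]
      exact div_le_div_of_nonneg_right (by linarith [h1 n]) n.cast_nonneg
    · change _ ≤ _ + _
      rw [← add_div]
      exact div_le_div_of_nonneg_right (by linarith [h2 n]) n.cast_nonneg
  refine (EReal.tendsto_coe.2 h4).congr fun n => ?_
  rw [ENNReal.log_pos_real (hH0 n) (complexity_ne_top hH t _), EReal.coe_div]
  rfl

end Entropy

/-! ### The upper Serre dimension and the lower bound for global dimensions -/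

section SerreDimension

variable {T : Type u} [Category.{v} T] [Preadditive T] [Linear ℂ T] [HasZeroObject T]
    [HasShift T ℤ] [∀ n : ℤ, (shiftFunctor T n).Additive] [Pretriangulated T]
    {S : T ⥤ T} {G : T} {p : ℕ}

omit [Linear ℂ T] [HasZeroObject T] [∀ n : ℤ, (shiftFunctor T n).Additive]
  [Pretriangulated T] in
/-- An object satisfying the ghost lemma detects nonzero objects. -/
lemma exists_hom_ne_zero_of_ghost (hp : ∀ {X Y : T} {f : X ⟶ Y}, IsGhostComp G p f → f = 0) {X : T}
    (hX : ¬ IsZero X) : ∃ (j : ℤ) (u : G⟦j⟧ ⟶ X), u ≠ 0 := by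
  by_contra! h
  exact hX ((IsZero.iff_id_eq_zero X).2 (hp (.id_of_forall_eq_zero h p)))

omit [Linear ℂ T] [HasZeroObject T] [Pretriangulated T] in
lemma not_isZero_of_ghost (hT : ∃ X : T, ¬ IsZero X)
    (hp : ∀ {X Y : T} {f : X ⟶ Y}, IsGhostComp G p f → f = 0) : ¬ IsZero G := by
  obtain ⟨X, hX⟩ := hT
  obtain ⟨j, u, hu⟩ := exists_hom_ne_zero_of_ghost hp hX
  exact fun h => hu (((shiftFunctor T j).map_isZero h).eq_of_src _ _)

variable [IsTriangulated T] [S.Additive] [S.Linear ℂ] [S.CommShift ℤ] [S.IsTriangulated]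
    [S.IsEquivalence] {Λ : Type*} [AddCommGroup Λ] {cl : K₀ T →+ Λ}
    {nrm : Seminorm ℝ (ℝ ⊗[ℤ] Λ)} {s : ℝ}

/-- The upper Serre dimension is `s` if the Serre functor shifts the phases by `s` up to arbitrarily
small errors. -/
theorem hasUpperSerreDimension_of_shiftsPhases (hT : ∃ X : T, ¬ IsZero X)
    (hS : IsSerreFunctor S) (hp : ∀ {X Y : T} {f : X ⟶ Y}, IsGhostComp G p f → f = 0)
    (h : ∀ ε : ℝ, 0 < ε → ε < 1 → ∃ σ : StabilityCondition cl nrm, σ.ShiftsPhases S s ε) :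
    HasUpperSerreDimension S (s : EReal) := by
  have hfin : ∀ X Y : T, Module.Finite ℂ (X ⟶ Y) := hS.finite_hom
  obtain ⟨σ, hσ⟩ := h (1 / 2) (by norm_num) (by norm_num)
  obtain ⟨K, hK0, hK⟩ := hσ.exists_abs_sub_le hS G
  have hsplit : IsSplitGenerator G := isSplitGenerator_of_builds fun E => by
    obtain ⟨a, b, hab⟩ := hσ.exists_homBounded hS G E
    obtain ⟨l, hl, -⟩ := hab.exists_builds hp hK0 hK
    exact ⟨l, hl⟩
  have hG := not_isZero_of_ghost hT hp
  have hmem : ∀ (n : ℕ) (l : List ℤ), Builds G l (S.obj^[n] G) → ∃ j : ℤ,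
      (∃ u : G⟦j⟧ ⟶ S.obj^[n] G, u ≠ 0) ∧ ∃ m ∈ l, |j - m| ≤ K := by
    intro n l hl
    obtain ⟨j, u, hu⟩ := exists_hom_ne_zero_of_ghost hp (not_isZero_iterate S hG n)
    obtain ⟨m, hm, g, hg⟩ := hl.exists_ne_zero hu
    exact ⟨j, ⟨u, hu⟩, m, hm, hK _ _ g hg⟩
  -- A nonzero `G[j] → Sⁿ G` forces every tower to contain some `G[m]` with `|j - m| ≤ K`, whose
  -- term alone gives the bound.
  have hlow : ∀ (t : ℝ) (n : ℕ) (j : ℤ) (u : G⟦j⟧ ⟶ S.obj^[n] G), u ≠ 0 →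
      ENNReal.ofReal (Real.exp (j * t - K * |t|)) ≤ complexity t G (S.obj^[n] G) := by
    intro t n j u hu
    refine le_complexity fun l hl => ENNReal.ofReal_le_ofReal ?_
    obtain ⟨m, hm, g, hg⟩ := hl.exists_ne_zero hu
    refine le_trans (Real.exp_le_exp.2 ?_) (exp_le_expSum t hm)
    have h1 : |(j : ℝ) - m| ≤ K := by exact_mod_cast hK _ _ g hg
    have h2 := mul_le_mul_of_nonneg_right h1 (abs_nonneg t)
    rw [← abs_mul] at h2
    linarith [le_abs_self (((j : ℝ) - m) * t)]
  have h0 : ∀ t n, complexity t G (S.obj^[n] G) ≠ 0 := by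
    intro t n h'
    obtain ⟨j, u, hu⟩ := exists_hom_ne_zero_of_ghost hp (not_isZero_iterate S hG n)
    exact absurd (hlow t n j u hu) (by simpa [h'] using Real.exp_pos _)
  have htop := fun t n => complexity_ne_top hsplit t (S.obj^[n] G)
  have hsub : ∀ t, Subadditive (logComplexity S G t) := by
    intro t m n
    rw [logComplexity, logComplexity, logComplexity,
      ← Real.log_mul (ENNReal.toReal_pos (h0 t m) (htop t m)).ne'
        (ENNReal.toReal_pos (h0 t n) (htop t n)).ne', ← ENNReal.toReal_mul]
    exact Real.log_le_log (ENNReal.toReal_pos (h0 _ _) (htop _ _))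
      (ENNReal.toReal_mono (ENNReal.mul_ne_top (htop _ _) (htop _ _))
        (complexity_iterate_add_le hsplit t m n))
  obtain ⟨H, hH, hlim⟩ := exists_tendsto_div_of_subadditive (s := s) hsub (by
    intro ε hε hε1
    obtain ⟨σ, hσ⟩ := h ε hε hε1
    obtain ⟨c, hc⟩ := hσ.exists_bounds hS G
    refine ⟨c + K, fun t n => ?_⟩
    obtain ⟨j, u, hu⟩ := exists_hom_ne_zero_of_ghost hp (not_isZero_iterate S hG n)
    obtain ⟨h1, h2⟩ := hc n j u hu
    have hKR : (0 : ℝ) ≤ K := by exact_mod_cast hK0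
    have h3 : j * t - K * |t| ≤ logComplexity S G t n := by
      rw [logComplexity, Real.le_log_iff_exp_le (ENNReal.toReal_pos (h0 t n) (htop t n))]
      exact (ENNReal.ofReal_le_iff_le_toReal (htop t n)).1 (hlow t n j u hu)
    -- The loss `K|t|` is absorbed by replacing `j` with `j - K` or `j + K` according to the sign of
    -- `t`.
    rcases le_total 0 t with ht | ht
    · refine ⟨j - K, by linarith, by linarith, ?_⟩
      rw [abs_of_nonneg ht] at h3
      linarith
    · refine ⟨j + K, by linarith, by linarith, ?_⟩
      rw [abs_of_nonpos ht] at h3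
      linarith) (by
    intro ε hε hε1
    obtain ⟨σ, hσ⟩ := h ε hε hε1
    obtain ⟨c, hc⟩ := hσ.exists_bounds hS G
    -- The `1` pays for rounding up, and `p * (1 + K)` for the `p` ghost steps. The number of
    -- factors depends on `n` but not on `t`, so its logarithm serves as `L`.
    refine ⟨c + 1 + p * (1 + K), fun n => ?_⟩
    have hb : HomBounded G (S.obj^[n] G) ⌊n * (s - ε) - c⌋ ⌈n * (s + ε) + c⌉ := by
      intro j u hu
      obtain ⟨h1, h2⟩ := hc n j u hu
      constructor
      · exact_mod_cast (Int.floor_le _).trans h1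
      · exact_mod_cast h2.trans (Int.le_ceil _)
    obtain ⟨l, hl, hl'⟩ := hb.exists_builds hp hK0 hK
    refine ⟨Real.log l.length, fun t ht => ?_⟩
    have h1 : ∀ m ∈ l, (m : ℝ) ≤ n * (s + ε) + (c + 1 + p * (1 + K)) := by
      intro m hm
      have h2 : (m : ℝ) ≤ ⌈n * (s + ε) + c⌉ + p * (1 + K) := by exact_mod_cast hl' m hm
      linarith [Int.ceil_lt_add_one (n * (s + ε) + c)]
    have h2 : (complexity t G (S.obj^[n] G)).toReal ≤
        l.length * Real.exp ((n * (s + ε) + (c + 1 + p * (1 + K))) * t) :=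
      (ENNReal.toReal_le_of_le_ofReal (expSum_nonneg _ _) (complexity_le hl)).trans
        (expSum_le ht h1)
    have h3 : (l.length : ℝ) ≠ 0 := by
      obtain ⟨-, -, m, hm, -⟩ := hmem n l hl
      exact_mod_cast (List.length_pos_of_mem hm).ne'
    refine (Real.log_le_log (ENNReal.toReal_pos (h0 t n) (htop t n)) h2).trans ?_
    rw [Real.log_mul h3 (Real.exp_pos _).ne', Real.log_exp])
  exact ⟨_, hasEntropy_of_tendsto hsplit h0 hH, EReal.tendsto_coe.2 hlim⟩

omit [IsTriangulated T] [S.Additive] [S.Linear ℂ] in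
/-- The global dimension of any stability condition is at least `s`. -/
lemma le_gldim_of_shiftsPhases (hT : ∃ X : T, ¬ IsZero X) (hS : IsSerreFunctor S)
    (hp : ∀ {X Y : T} {f : X ⟶ Y}, IsGhostComp G p f → f = 0)
    (h : ∀ ε : ℝ, 0 < ε → ε < 1 → ∃ σ : StabilityCondition cl nrm, σ.ShiftsPhases S s ε)
    (τ : StabilityCondition cl nrm) : (s : EReal) ≤ τ.gldim := by
  obtain ⟨X, hX⟩ := hT
  have hnn := τ.gldim_nonneg hX
  by_cases htop : τ.gldim = ⊤
  · rw [htop]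
    exact le_top
  obtain ⟨g, hg⟩ : ∃ g : ℝ, τ.gldim = (g : EReal) :=
    ⟨τ.gldim.toReal, (EReal.coe_toReal htop (ne_bot_of_le_ne_bot (by simp) hnn)).symm⟩
  rw [hg, EReal.coe_le_coe_iff]
  have hG := not_isZero_of_ghost ⟨X, hX⟩ hp
  refine le_of_forall_pos_le_add fun ε hε => ?_
  obtain ⟨σ, hσ⟩ := h (min ε (1 / 2)) (by positivity)
    ((min_le_right _ _).trans_lt (by norm_num))
  obtain ⟨c, hc⟩ := hσ.exists_bounds hS G
  obtain ⟨c', hc'⟩ := StabilityCondition.exists_le_of_gldim_le hS hg.le G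
  -- The same `j` is bounded below through `σ` and above through `τ`; boundedness in `n` forces the
  -- coefficient to be nonpositive.
  have h1 : ∀ n : ℕ, n * (s - min ε (1 / 2) - g) ≤ c + c' := by
    intro n
    obtain ⟨j, u, hu⟩ := exists_hom_ne_zero_of_ghost hp (not_isZero_iterate S hG n)
    linarith [(hc n j u hu).1, hc' n j u hu]
  have h2 : s - min ε (1 / 2) - g ≤ 0 := by
    by_contra! h3
    obtain ⟨n, hn⟩ := exists_nat_gt ((c + c') / (s - min ε (1 / 2) - g))
    rw [div_lt_iff₀ h3] at hn
    exact absurd (h1 n) (not_le.2 hn)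
  linarith [min_le_left ε (1 / 2)]

end SerreDimension

end

theorem proposition4p3
    {T : Type u} [Category.{v} T] [Preadditive T] [Linear ℂ T] [HasZeroObject T]
    [HasShift T ℤ] [∀ n : ℤ, (shiftFunctor T n).Additive] [∀ n : ℤ, (shiftFunctor T n).Linear ℂ]
    [Pretriangulated T] [IsTriangulated T]
    (hT : ∃ X : T, ¬ IsZero X)
    (A : DGAlgebra.{w}) (hsmooth : A.IsSmooth) (hproper : A.IsProper)
    (e : PerfEquivalence T A)
    (S : T ⥤ T) [S.Additive] [S.Linear ℂ] [S.CommShift ℤ] [S.IsTriangulated] [S.IsEquivalence]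
    (hS : IsSerreFunctor S)
    {Λ : Type*} [AddCommGroup Λ] [Module.Free ℤ Λ] [Module.Finite ℤ Λ]
    (cl : K₀ T →+ Λ) (hcl : Function.Surjective cl)
    (nrm : Seminorm ℝ (ℝ ⊗[ℤ] Λ)) (hnrm : ∀ x, nrm x = 0 → x = 0)
    (s : ℝ) :
    ((∀ ε : ℝ, 0 < ε → ε < 1 → ∃ σ : StabilityCondition cl nrm, ∀ (φ : ℝ) (E : T), σ.P φ E →
        σ.PI (Set.Icc (φ + s - ε) (φ + s + ε)) (S.obj E)) →
      HasUpperSerreDimension S (s : EReal) ∧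
        (⨅ σ : StabilityCondition cl nrm, σ.gldim) = (s : EReal)) ∧
    (∀ σ : StabilityCondition cl nrm, (∀ φ : ℝ, (σ.P φ).map S = σ.P (φ + s)) →
      HasUpperSerreDimension S (s : EReal) ∧
        (⨅ σ' : StabilityCondition cl nrm, σ'.gldim) = (s : EReal) ∧
        σ.gldim = (s : EReal) ∧ 0 ≤ s) := by
  obtain ⟨G, p, hp⟩ := e.exists_isGhostComp_eq_zero hsmooth
  have h1 : (∀ ε : ℝ, 0 < ε → ε < 1 → ∃ σ : StabilityCondition cl nrm, σ.ShiftsPhases S s ε) →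
      HasUpperSerreDimension S (s : EReal) ∧
        (⨅ σ : StabilityCondition cl nrm, σ.gldim) = (s : EReal) := fun h => by
    refine ⟨hasUpperSerreDimension_of_shiftsPhases hT hS hp h, le_antisymm ?_
      (le_iInf (le_gldim_of_shiftsPhases hT hS hp h))⟩
    refine EReal.le_of_forall_lt_iff_le.1 fun z hz => ?_
    have hz' : 0 < z - s := sub_pos.2 (EReal.coe_lt_coe_iff.1 hz)
    obtain ⟨σ, hσ⟩ := h (min (z - s) (1 / 2)) (by positivity)
      ((min_le_right _ _).trans_lt (by norm_num))
    refine ((iInf_le _ σ).trans (hσ.gldim_le hS)).trans (EReal.coe_le_coe_iff.2 ?_)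
    linarith [min_le_left (z - s) (1 / 2)]
  refine ⟨h1, fun σ hσ => ?_⟩
  have hshift : ∀ ε : ℝ, 0 ≤ ε → σ.ShiftsPhases S s ε := fun ε hε φ E hE => by
    have h2 : σ.P (φ + s) (S.obj E) := by
      rw [← hσ]
      exact ObjectProperty.prop_map_obj _ _ hE
    exact StabilityCondition.P.PI h2 ⟨by linarith, by linarith⟩
  have hex : ∀ ε : ℝ, 0 < ε → ε < 1 → ∃ σ : StabilityCondition cl nrm, σ.ShiftsPhases S s ε :=
    fun ε hε _ => ⟨σ, hshift ε hε.le⟩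
  obtain ⟨h2, h3⟩ := h1 hex
  -- An exact shift is a shift with error `0`, so the upper bound is attained by `σ` itself.
  have h4 : σ.gldim = (s : EReal) :=
    le_antisymm (by simpa using (hshift 0 le_rfl).gldim_le hS)
      (le_gldim_of_shiftsPhases hT hS hp hex σ)
  obtain ⟨X, hX⟩ := hT
  exact ⟨h2, h3, h4, EReal.coe_nonneg.1 (h4 ▸ σ.gldim_nonneg hX)⟩
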